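/- All graphs are finite, simple, undirected and have at least one vertex; $G[S]$ denotes the subgraph of $G=(V,E)$ induced by $S\subseteq V$. A set $S\subseteq V$ is a \emph{2-club} if $G[S]$ has diameter at most two. For an integer $t\ge 0$, a set $S\subseteq V$ is - a \emph{$t$-robust 2-club} if any two distinct vertices of $S$ are connected in $G[S]$ by $t$ pairwise distinct, internally vertex-disjoint paths of length at most two; - a \emph{$t$-hereditary 2-club} if $S\setminus U$ is a 2-club for all $U\subset S$ with $|U|\le t$; - a \emph{$t$-connected 2-club} if $S$ is a 2-club, $|S|>t$, and $G[S\setminus U]$ is connected for all $U\subseteq S$ with $|U|<t$. In the problem \textsc{$t$-Robust 2-Club} (respectively \textsc{$t$-Hereditary 2-Club}, \textsc{$t$-Connected 2-Club}) the input consists of a graph $G$ and nonnegative integers $t$ and $k$, and the question is whether $G$ contains a $t$-robust (respectively $t$-hereditary, $t$-connected) 2-club of size at least $k$. \textbf{Corollary.} Each of the problems \textsc{$t$-Robust 2-Club}, \textsc{$t$-Hereditary 2-Club} and \textsc{$t$-Connected 2-Club} can be solved in $O(1.62^{\Delta^2}\cdot n)$ time, where $n$ is the number of vertices and $\Delta$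 the maximum degree of the input graph. That is, for each of them there is a single random access machine program, with unit cost per operation and machine words of $O(\log(n+t+k+2))$ bits, and a constant $C$ independent of $G$, $t$ and $k$, such that the program, given $G$ by adjacency lists together with $t$ and $k$, answers the question correctly after at most $C\cdot 1.62^{\Delta^2}\cdot n$ steps. -/

import Mathlib

/-! ### Well-connected 2-clubs -/

/-- `S` is a 2-club: the induced subgraph `G[S]` has diameter at most two. -/
def IsTwoClub {V : Type*} (G : SimpleGraph V) (S : Set V) : Prop :=
  (G.induce S).ediam ≤ 2

/-- `S` is a `t`-robust 2-club: any two distinct vertices of `S` are joined in `G[S]` by `t`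
(pairwise distinct) internally vertex-disjoint paths of length at most two. -/
def IsRobustTwoClub {V : Type*} (G : SimpleGraph V) (t : ℕ) (S : Finset V) : Prop :=
  ∀ u v : (S : Set V), u ≠ v →
    ∃ P : Fin t → (G.induce (S : Set V)).Path u v,
      Function.Injective P ∧
      (∀ i, (P i : (G.induce (S : Set V)).Walk u v).length ≤ 2) ∧
      ∀ i j, i ≠ j → ∀ x,
        x ∈ (P i : (G.induce (S : Set V)).Walk u v).support →
        x ∈ (P j : (G.induce (S : Set V)).Walk u v).support → x = u ∨ x = v

/-- `S` is a `t`-hereditary 2-club: `S \ U` is a 2-club for all `U ⊂ S` with `|U| ≤ t`. -/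
def IsHereditaryTwoClub {V : Type*} (G : SimpleGraph V) (t : ℕ) (S : Finset V) : Prop :=
  ∀ U : Finset V, U ⊂ S → U.card ≤ t → IsTwoClub G ((S : Set V) \ (U : Set V))

/-- `S` is a `t`-connected 2-club: `S` is a 2-club, `|S| > t`, and `G[S \ U]` is connected for all
`U ⊆ S` with `|U| < t`. -/
def IsConnectedTwoClub {V : Type*} (G : SimpleGraph V) (t : ℕ) (S : Finset V) : Prop :=
  IsTwoClub G (S : Set V) ∧ t < S.card ∧
    ∀ U : Finset V, U ⊆ S → U.card < t →
      (G.induce ((S : Set V) \ (U : Set V))).Connected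

/-! ### Random access machine

Programs of a random access machine in structured form. The memory consists of registers
`reg 0, reg 1, …` and of arrays `arr 0, arr 1, …` with random access; a program mentions only
finitely many registers and arrays. Every arithmetic operation, comparison, register access, array
access and control step costs one time unit. -/

namespace RAM

/-- Memory contents. -/
structure State where
  reg : ℕ → ℕ
  arr : ℕ → ℕ → ℕ

/-- Elementary operations; subtraction is truncated, division rounds down (and gives `0` for the
divisor `0`), comparisons return `1` for true and `0` for false. -/
inductive Op
  | add | sub | mul | div | lt | eq

/-- The value of an elementary operation. -/
def Op.eval : Op → ℕ → ℕ → ℕ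
  | add, a, b => a + b
  | sub, a, b => a - b
  | mul, a, b => a * b
  | div, a, b => a / b
  | lt, a, b => if a < b then 1 else 0
  | eq, a, b => if a = b then 1 else 0

/-- Expressions: constants, registers, array cells `arr a [e]`, and elementary operations. -/
inductive Expr
  | const (c : ℕ)
  | reg (x : ℕ)
  | arr (a : ℕ) (e : Expr)
  | op (o : Op) (e₁ e₂ : Expr)

/-- The value of an expression. -/
def Expr.eval (s : State) : Expr → ℕ
  | const c => c
  | reg x => s.reg x
  | arr a e => s.arr a (e.eval s)
  | op o e₁ e₂ => o.eval (e₁.eval s) (e₂.eval s)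

/-- The number of time units for evaluating an expression: one for each of its nodes. -/
def Expr.cost : Expr → ℕ
  | const _ => 1
  | reg _ => 1
  | arr _ e => e.cost + 1
  | op _ e₁ e₂ => e₁.cost + e₂.cost + 1

/-- Programs. A condition counts as true if its value is not `0`. -/
inductive Prog
  | skip
  | assign (x : ℕ) (e : Expr)
  | store (a : ℕ) (i e : Expr)
  | seq (p q : Prog)
  | cond (b : Expr) (p q : Prog)
  | loop (b : Expr) (p : Prog)

/-- `reg x := v`. -/
def State.setReg (s : State) (x v : ℕ) : State :=
  { s with reg := Function.update s.reg x v }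

/-- `arr a [i] := v`. -/
def State.setArr (s : State) (a i v : ℕ) : State :=
  { s with arr := Function.update s.arr a (Function.update (s.arr a) i v) }

/-- `Exec B p s T s'`: started in `s`, the program `p` halts after `T` time units in `s'`, and every
number that it writes into a register or an array cell is at most `B` (the largest number that fits
into a machine word). -/
inductive Exec (B : ℕ) : Prog → State → ℕ → State → Prop
  | skip (s : State) : Exec B .skip s 1 s
  | assign (s : State) (x : ℕ) (e : Expr) (h : e.eval s ≤ B) :
      Exec B (.assign x e) s (e.cost + 1) (s.setReg x (e.eval s))
  | store (s : State) (a : ℕ) (i e : Expr) (h : e.eval s ≤ B) :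
      Exec B (.store a i e) s (i.cost + e.cost + 1) (s.setArr a (i.eval s) (e.eval s))
  | seq {p q : Prog} {s s₁ s₂ : State} {T₁ T₂ : ℕ}
      (h₁ : Exec B p s T₁ s₁) (h₂ : Exec B q s₁ T₂ s₂) :
      Exec B (.seq p q) s (T₁ + T₂) s₂
  | cond_true {b : Expr} {p q : Prog} {s s' : State} {T : ℕ}
      (hb : b.eval s ≠ 0) (h : Exec B p s T s') :
      Exec B (.cond b p q) s (b.cost + 1 + T) s'
  | cond_false {b : Expr} {p q : Prog} {s s' : State} {T : ℕ}
      (hb : b.eval s = 0) (h : Exec B q s T s') :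
      Exec B (.cond b p q) s (b.cost + 1 + T) s'
  | loop_true {b : Expr} {p : Prog} {s s₁ s₂ : State} {T₁ T₂ : ℕ}
      (hb : b.eval s ≠ 0) (h₁ : Exec B p s T₁ s₁) (h₂ : Exec B (.loop b p) s₁ T₂ s₂) :
      Exec B (.loop b p) s (b.cost + 1 + T₁ + T₂) s₂
  | loop_false {b : Expr} {p : Prog} {s : State}
      (hb : b.eval s = 0) :
      Exec B (.loop b p) s (b.cost + 1) s

end RAM

/-! ### Solving a problem on graphs within a time bound -/

/-- `adj` is an adjacency-list representation of `G`: `adj v` lists every neighbor of `v` exactly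
once, in any order. -/
def IsAdjacencyList {n : ℕ} (G : SimpleGraph (Fin n)) (adj : Fin n → List (Fin n)) : Prop :=
  ∀ v, (adj v).Nodup ∧ ∀ w, w ∈ adj v ↔ G.Adj v w

/-- The initial memory for a graph given by adjacency lists and numbers `t`, `k`: the registers
`1, 2, 3` hold `n, t, k`; array `1` is the concatenation of the adjacency lists of the vertices
`0, …, n - 1`; for `v ≤ n`, cell `v` of array `0` is the total length of the lists of the vertices
below `v`, so that the list of `v` occupies the cells of array `1` from `arr 0 [v]` up to, but not
including, `arr 0 [v + 1]`. All other registers and cells hold `0`. -/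
def inputState {n : ℕ} (adj : Fin n → List (Fin n)) (t k : ℕ) : RAM.State where
  reg x := if x = 1 then n else if x = 2 then t else if x = 3 then k else 0
  arr a i :=
    if a = 0 then
      if i ≤ n then (((List.finRange n).take i).map fun v => (adj v).length).sum else 0
    else if a = 1 then
      (((List.finRange n).flatMap adj).map Fin.val).getD i 0
    else 0

/-- The decision problem "given a graph `G` and numbers `t, k`, is there a set `S` of at least `k`
vertices with `Club G t S`?" can be solved within `O(f(G))` time: a single program decides it on
every graph with at least one vertex, given by adjacency lists, and for all `t` and `k`, in at most
`C * f(G)` time units, where `C` does not depend on the input, using machine words that hold numbers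
up to `(n + t + k + 2) ^ c`, that is, words of `O(log (n + t + k + 2))` bits. The answer (`1` for
yes, `0` for no) is found in register `0`. -/
def SolvableInTime
    (Club : ∀ n : ℕ, SimpleGraph (Fin n) → ℕ → Finset (Fin n) → Prop)
    (f : ∀ n : ℕ, SimpleGraph (Fin n) → ℝ) : Prop :=
  ∃ (p : RAM.Prog) (c : ℕ) (C : ℝ),
    ∀ (n : ℕ), 0 < n → ∀ (G : SimpleGraph (Fin n)) (adj : Fin n → List (Fin n)),
      IsAdjacencyList G adj → ∀ t k : ℕ,
        ∃ (T : ℕ) (s : RAM.State),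
          RAM.Exec ((n + t + k + 2) ^ c) p (inputState adj t k) T s ∧
          (T : ℝ) ≤ C * f n G ∧
          ((∃ S : Finset (Fin n), Club n G t S ∧ k ≤ S.card) → s.reg 0 = 1) ∧
          ((¬ ∃ S : Finset (Fin n), Club n G t S ∧ k ≤ S.card) → s.reg 0 = 0)

open Classical in
/-- The bound `1.62 ^ (Δ ^ 2) * n`, where `Δ` is the maximum degree of `G`. -/
noncomputable def maxDegreeBound (n : ℕ) (G : SimpleGraph (Fin n)) : ℝ :=
  (1.62 : ℝ) ^ (G.maxDegree ^ 2) * (n : ℝ)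

/-! ### Program logic with time bounds -/

namespace RAM

/-! Each of the three properties says that no two distinct vertices `u`, `w` of `S` are in conflict,
for a suitable relation `bad S u w` (`isRobustTwoClub_iff`, `isHereditaryTwoClub_iff`,
`isConnectedTwoClub_iff`): fewer than `t` short paths, nonadjacent with at most `t` common
neighbors, or nonadjacent with no common neighbor or a separator of fewer than `t` vertices. A
conflict persists when `S` shrinks around `u` and `w`, so a conflicting pair among the vertices not
yet deleted forces every solution to omit `u` or `w`.

This gives a branching algorithm (`extendable_branch`): delete `u`, or keep `u` and delete `w`. One
branch decides one vertex and the other decides two, and a vertex already kept leaves only one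
branch. The tree size therefore grows like the Fibonacci numbers (`treeSize_le`). The algorithm runs
iteratively on a stack of status vectors whose total remaining tree size strictly decreases
(`searchStep_runs`).

Vertices at distance more than two always conflict, so a nonempty solution lies in the ball of
radius two around any of its members (`exists_subset_ballList_iff`). Such a ball has at most `Δ ^ 2
+ 1` vertices (`length_ballList_le`). Searching every ball costs `n` times a polynomial in `Δ` times
a power of `1.6181`, and the gap between `1.6181` and `1.62` absorbs the polynomial
(`exists_vertexTime_le`).

It remains to decide conflicts in polynomial time. For the first two problems, counting common
neighbors suffices. For the third, augmenting paths compute a maximum flow in the split graph with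
unit capacities, and its value is compared with `t` (`exists_separates_iff_value_lt`), which is
Menger's theorem for two nonadjacent vertices.

Two cases need separate care. For `t = 0` every set is a robust 2-club, so conflicts are not local
and the answer is read off from `k` and `n`. The condition `t < |S|` of connected 2-clubs is
absorbed into the target size. -/

instance : Add Expr := ⟨.op .add⟩
instance : Sub Expr := ⟨.op .sub⟩
instance : Mul Expr := ⟨.op .mul⟩

/-- The comparison `a < b`. -/
def Expr.lt (a b : Expr) : Expr := .op .lt a b

/-- The test `a = b`. -/
def Expr.eq (a b : Expr) : Expr := .op .eq a b

infixr:60 ";;" => Prog.seq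

section Simp

variable (s : State) (a b e : Expr) (x y c i v : ℕ)

@[simp] theorem Expr.eval_const : (Expr.const c).eval s = c := rfl
@[simp] theorem Expr.eval_reg : (Expr.reg x).eval s = s.reg x := rfl
@[simp] theorem Expr.eval_arr : (Expr.arr x e).eval s = s.arr x (e.eval s) := rfl
@[simp] theorem Expr.eval_add : (a + b).eval s = a.eval s + b.eval s := rfl
@[simp] theorem Expr.eval_sub : (a - b).eval s = a.eval s - b.eval s := rfl
@[simp] theorem Expr.eval_mul : (a * b).eval s = a.eval s * b.eval s := rfl
@[simp] theorem Expr.eval_lt : (Expr.lt a b).eval s = if a.eval s < b.eval s then 1 else 0 := rfl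
@[simp] theorem Expr.eval_eq : (Expr.eq a b).eval s = if a.eval s = b.eval s then 1 else 0 := rfl


@[simp] theorem State.setReg_reg : (s.setReg x v).reg y = if y = x then v else s.reg y := by
  simp [State.setReg, Function.update_apply]
@[simp] theorem State.setReg_arr : (s.setReg x v).arr = s.arr := rfl
@[simp] theorem State.setArr_reg : (s.setArr x i v).reg = s.reg := rfl
@[simp] theorem State.setArr_arr :
    (s.setArr x i v).arr y = if y = x then Function.update (s.arr x) i v else s.arr y := by
  simp only [State.setArr, Function.update_apply]

end Simp

/-- The registers that occur on the left-hand side of an assignment. -/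
def Prog.regs : Prog → List ℕ
  | skip => []
  | assign x _ => [x]
  | store _ _ _ => []
  | seq p q => p.regs ++ q.regs
  | cond _ p q => p.regs ++ q.regs
  | loop _ p => p.regs

/-- The arrays that a program may write to. -/
def Prog.arrs : Prog → List ℕ
  | skip => []
  | assign _ _ => []
  | store a _ _ => [a]
  | seq p q => p.arrs ++ q.arrs
  | cond _ p q => p.arrs ++ q.arrs
  | loop _ p => p.arrs

/-- The two states agree outside of the listed registers and arrays. -/
structure Agree (R A : List ℕ) (s s' : State) : Prop where
  reg : ∀ x, x ∉ R → s'.reg x = s.reg x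
  arr : ∀ a, a ∉ A → s'.arr a = s.arr a

theorem Agree.refl (R A : List ℕ) (s : State) : Agree R A s s :=
  ⟨fun _ _ => rfl, fun _ _ => rfl⟩

theorem Agree.trans {R A : List ℕ} {s s₁ s₂ : State} (h : Agree R A s s₁) (h' : Agree R A s₁ s₂) :
    Agree R A s s₂ :=
  ⟨fun x hx => (h'.reg x hx).trans (h.reg x hx), fun a ha => (h'.arr a ha).trans (h.arr a ha)⟩

theorem Agree.mono {R A R' A' : List ℕ} {s s' : State} (h : Agree R A s s') (hR : R ⊆ R')
    (hA : A ⊆ A') : Agree R' A' s s' :=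
  ⟨fun x hx => h.reg x fun h => hx (hR h), fun a ha => h.arr a fun h => ha (hA h)⟩

/-- The syntactic lists of written registers and arrays over-approximate the effect of any run.
Preservation of a cell by a concrete program is thereby a membership check, so specifications need
to mention only what changes. -/
theorem Exec.agree {B : ℕ} {p : Prog} {s s' : State} {T : ℕ} (h : Exec B p s T s') :
    Agree p.regs p.arrs s s' := by
  induction h with
  | skip s => exact .refl _ _ _
  | assign s x e h => constructor <;> simp +contextual [Prog.regs, Prog.arrs]
  | store s a i e h => constructor <;> simp +contextual [Prog.regs, Prog.arrs]
  | seq _ _ ih₁ ih₂ =>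
    exact (ih₁.mono (by simp [Prog.regs]) (by simp [Prog.arrs])).trans
      (ih₂.mono (by simp [Prog.regs]) (by simp [Prog.arrs]))
  | cond_true _ _ ih => exact ih.mono (by simp [Prog.regs]) (by simp [Prog.arrs])
  | cond_false _ _ ih => exact ih.mono (by simp [Prog.regs]) (by simp [Prog.arrs])
  | loop_true _ _ _ ih₁ ih₂ =>
    exact (ih₁.mono (by simp [Prog.regs]) (by simp [Prog.arrs])).trans ih₂
  | loop_false _ => exact .refl _ _ _

/-- Started in `s`, the program halts within `T` time units in a state with the property `Q`. -/
def Runs (B : ℕ) (p : Prog) (s : State) (T : ℕ) (Q : State → Prop) : Prop :=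
  ∃ T' s', T' ≤ T ∧ Exec B p s T' s' ∧ Q s'

section Rules

variable {B : ℕ} {p q : Prog} {s : State} {T T₁ T₂ : ℕ} {Q Q' : State → Prop} {e b i : Expr}
  {x a : ℕ}

theorem Runs.le (h : Runs B p s T₁ Q) (hT : T₁ ≤ T) : Runs B p s T Q := by
  obtain ⟨T', s', h₁, h₂, h₃⟩ := h
  exact ⟨T', s', h₁.trans hT, h₂, h₃⟩

/-- The consequence rule, with the frame condition for free. -/
theorem Runs.post (h : Runs B p s T Q) (hQ : ∀ s', Agree p.regs p.arrs s s' → Q s' → Q' s') :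
    Runs B p s T Q' := by
  obtain ⟨T', s', h₁, h₂, h₃⟩ := h
  exact ⟨T', s', h₁, h₂, hQ s' h₂.agree h₃⟩

theorem Runs.skip (hQ : Q s) : Runs B .skip s 1 Q := ⟨1, s, le_rfl, .skip s, hQ⟩

theorem Runs.assign (he : e.eval s ≤ B) (hQ : Q (s.setReg x (e.eval s))) :
    Runs B (.assign x e) s (e.cost + 1) Q := ⟨_, _, le_rfl, .assign s x e he, hQ⟩

theorem Runs.store (he : e.eval s ≤ B) (hQ : Q (s.setArr a (i.eval s) (e.eval s))) :
    Runs B (.store a i e) s (i.cost + e.cost + 1) Q := ⟨_, _, le_rfl, .store s a i e he, hQ⟩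

theorem Runs.seq (h : Runs B p s T₁ fun s' => Runs B q s' T₂ Q) :
    Runs B (p ;; q) s (T₁ + T₂) Q := by
  obtain ⟨T', s', h₁, h₂, T'', s'', h₃, h₄, h₅⟩ := h
  exact ⟨_, _, Nat.add_le_add h₁ h₃, .seq h₂ h₄, h₅⟩

/-- Sequential composition after a program with a known specification. -/
theorem Runs.andThen (h : Runs B p s T₁ Q')
    (h' : ∀ s', Agree p.regs p.arrs s s' → Q' s' → Runs B q s' T₂ Q) :
    Runs B (p ;; q) s (T₁ + T₂) Q := .seq (h.post h')

theorem Runs.assign_seq (he : e.eval s ≤ B) (h : Runs B q (s.setReg x (e.eval s)) T Q) :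
    Runs B (.assign x e ;; q) s (e.cost + 1 + T) Q := .seq (.assign he h)

theorem Runs.store_seq (he : e.eval s ≤ B)
    (h : Runs B q (s.setArr a (i.eval s) (e.eval s)) T Q) :
    Runs B (.store a i e ;; q) s (i.cost + e.cost + 1 + T) Q := .seq (.store he h)

/-- Both branches are charged. The sum instead of the maximum costs only a constant factor and keeps
the time bounds free of case distinctions. -/
theorem Runs.cond (h₁ : b.eval s ≠ 0 → Runs B p s T₁ Q) (h₂ : b.eval s = 0 → Runs B q s T₂ Q) :
    Runs B (.cond b p q) s (b.cost + 1 + (T₁ + T₂)) Q := by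
  by_cases hb : b.eval s = 0
  · obtain ⟨T', s', h, h', h''⟩ := h₂ hb
    exact ⟨_, s', by omega, .cond_false hb h', h''⟩
  · obtain ⟨T', s', h, h', h''⟩ := h₁ hb
    exact ⟨_, s', by omega, .cond_true hb h', h''⟩

/-- The rule for loops: `I j` is the invariant at variant `j`, which decreases in each round. -/
theorem Runs.loop {c : ℕ} (I : ℕ → State → Prop) {j : ℕ} (h₀ : I j s)
    (hstep : ∀ j s', Agree p.regs p.arrs s s' → I j s' → b.eval s' ≠ 0 →
      Runs B p s' c fun s'' => ∃ j' < j, I j' s'') :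
    Runs B (.loop b p) s (j * (c + b.cost + 1) + (b.cost + 1)) fun s' =>
      (∃ j', I j' s') ∧ b.eval s' = 0 := by
  -- The induction restarts the loop in later states but keeps the comparison with the first state
  -- `s`, so that each round may use the frame condition relative to the start of the loop.
  suffices H : ∀ j s', Agree p.regs p.arrs s s' → I j s' →
      Runs B (.loop b p) s' (j * (c + b.cost + 1) + (b.cost + 1)) fun s' =>
        (∃ j', I j' s') ∧ b.eval s' = 0 from H j s (.refl _ _ _) h₀
  intro j
  induction j using Nat.strong_induction_on with
  | _ j ih =>
    intro s' hA hI
    by_cases hb : b.eval s' = 0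
    · exact ⟨_, s', by omega, .loop_false hb, ⟨j, hI⟩, hb⟩
    · obtain ⟨T₁, s₁, hT₁, hE₁, j', hj', hI'⟩ := hstep j s' hA hI hb
      obtain ⟨T₂, s₂, hT₂, hE₂, hQ⟩ := ih j' hj' s₁ (hA.trans hE₁.agree) hI'
      refine ⟨_, s₂, ?_, .loop_true hb hE₁ hE₂, hQ⟩
      have : (j' + 1) * (c + b.cost + 1) ≤ j * (c + b.cost + 1) := Nat.mul_le_mul_right _ hj'
      rw [Nat.add_mul] at this
      omega

/-- `for reg i := 0, …, reg y - 1 do p`. -/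
def forLoop (i y : ℕ) (p : Prog) : Prog :=
  .assign i (.const 0) ;; .loop (.lt (.reg i) (.reg y)) (p ;; .assign i (.reg i + .const 1))

theorem forLoop_regs (i y : ℕ) (p : Prog) : (forLoop i y p).regs = i :: (p.regs ++ [i]) := rfl

theorem forLoop_arrs (i y : ℕ) (p : Prog) : (forLoop i y p).arrs = p.arrs := by
  simp [forLoop, Prog.arrs]

/-- As the body writes neither the counter nor the bound, the number of rounds is fixed in advance.
Each round pays 4 for the test and 4 for the increment; the final 6 covers the initialization and
the last test. -/
theorem Runs.forLoop {i y N c : ℕ} (I : ℕ → State → Prop) (hN : s.reg y = N) (hB : N ≤ B)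
    (hi : i ∉ p.regs) (hy : y ∉ i :: p.regs) (h₀ : I 0 (s.setReg i 0))
    (hstep : ∀ j < N, ∀ s', Agree (forLoop i y p).regs p.arrs s s' → s'.reg i = j → I j s' →
      Runs B p s' c fun s'' => I (j + 1) (s''.setReg i (j + 1)))
    (hQ : ∀ s', Agree (forLoop i y p).regs p.arrs s s' → I N s' → Q s') :
    Runs B (forLoop i y p) s (N * (c + 8) + 6) Q := by
  simp only [List.mem_cons, not_or] at hy
  have hfr : ∀ {s s'}, Agree p.regs p.arrs s s' → Agree (RAM.forLoop i y p).regs p.arrs s s' :=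
    fun h => h.mono (by rw [forLoop_regs]; grind) (fun _ h => h)
  have hfi : ∀ s v, Agree (RAM.forLoop i y p).regs p.arrs s (s.setReg i v) := fun s v =>
    ⟨fun x hx => by rw [forLoop_regs] at hx; simp_all, fun _ _ => rfl⟩
  have hyN : ∀ {s'}, Agree (RAM.forLoop i y p).regs p.arrs s s' → s'.reg y = N := fun h => by
    rw [h.reg y (by rw [forLoop_regs]; simp [hy]), hN]
  refine Runs.le (T₁ := 2 + (N * ((c + 4) + 3 + 1) + (3 + 1))) ?_ (by ring_nf; omega)
  refine .assign_seq (by simp) ?_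
  refine (Runs.loop (c := c + 4) (fun r s' => Agree (RAM.forLoop i y p).regs p.arrs s s' ∧
    s'.reg i + r = N ∧ I (s'.reg i) s') (j := N) ?_ ?_).post ?_
  · exact ⟨hfi _ _, by simp, by simpa using h₀⟩
  · rintro r s' - ⟨hA, hr, hI⟩ hb
    have hy' := hyN hA
    simp only [Expr.eval_lt, Expr.eval_reg, hy', ne_eq, ite_eq_right_iff, one_ne_zero,
      imp_false, not_not] at hb
    refine (hstep _ hb s' hA rfl hI).andThen (T₂ := 4) fun s'' hA' hI' => ?_
    have h1 : s''.reg i = s'.reg i := hA'.reg i hi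
    refine .assign (by simp; omega) ⟨r - 1, by omega, (hA.trans (hfr hA')).trans (hfi _ _), ?_, ?_⟩
    · simp; omega
    · simpa [h1] using hI'
  · rintro s' - ⟨⟨r, hA, hr, hI⟩, hb⟩
    have hy' := hyN hA
    simp only [Expr.eval_lt, Expr.eval_reg, hy', ite_eq_right_iff, one_ne_zero,
      imp_false, not_lt] at hb
    have : s'.reg i = N := by omega
    exact hQ s' hA (this ▸ hI)

end Rules

end RAM

/-! ### The search tree -/

namespace TwoClub

/-- The size of a search tree in terms of the number of undecided vertices. -/
def treeSize : ℕ → ℕ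
  | 0 => 1
  | 1 => 2
  | m + 2 => treeSize (m + 1) + treeSize m + 1

theorem treeSize_pos (m : ℕ) : 0 < treeSize m := by
  match m with
  | 0 => simp [treeSize]
  | 1 => simp [treeSize]
  | m + 2 => simp [treeSize]

theorem treeSize_lt_succ (m : ℕ) : treeSize m < treeSize (m + 1) := by
  match m with
  | 0 => simp [treeSize]
  | m + 1 => rw [treeSize]; omega

theorem treeSize_mono : Monotone treeSize :=
  monotone_nat_of_le_succ fun m => (treeSize_lt_succ m).le

/-- Adding one turns the recurrence into that of the Fibonacci numbers, and `1.6181` lies just above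
the golden ratio, so `1.6181 + 1 ≤ 1.6181 ^ 2`. -/
theorem treeSize_le (m : ℕ) : (treeSize m : ℝ) + 1 ≤ 3 * (1.6181 : ℝ) ^ m := by
  induction m using Nat.twoStepInduction with
  | zero => norm_num [treeSize]
  | one => norm_num [treeSize]
  | more m h₁ h₂ =>
    have : (0 : ℝ) < 1.6181 ^ m := by positivity
    rw [treeSize]
    push_cast
    rw [pow_succ] at h₂
    rw [pow_succ, pow_succ]
    nlinarith

/-- The number of undecided vertices (status `0`) among `0, …, m - 1`. -/
def undecided (m : ℕ) (f : ℕ → ℕ) : ℕ := ((Finset.range m).filter fun i => f i = 0).card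

/-- The vertices that are not deleted (status `2`). -/
def alive (m : ℕ) (f : ℕ → ℕ) : Finset ℕ := (Finset.range m).filter fun i => f i ≠ 2

theorem alive_subset (m : ℕ) (f : ℕ → ℕ) : alive m f ⊆ Finset.range m := Finset.filter_subset _ _

theorem undecided_congr {m : ℕ} {f f' : ℕ → ℕ} (h : ∀ i < m, f i = f' i) :
    undecided m f = undecided m f' := by
  unfold undecided
  congr 1
  refine Finset.filter_congr fun i hi => ?_
  rw [h i (Finset.mem_range.1 hi)]

theorem undecided_le (m : ℕ) (f : ℕ → ℕ) : undecided m f ≤ m :=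
  (Finset.card_filter_le _ _).trans (by simp)

theorem undecided_update {m : ℕ} {f : ℕ → ℕ} {u c : ℕ} (hu : u < m) (hf : f u = 0) (hc : c ≠ 0) :
    undecided m (Function.update f u c) + 1 = undecided m f := by
  unfold undecided
  have : ((Finset.range m).filter fun i => Function.update f u c i = 0) =
      ((Finset.range m).filter fun i => f i = 0).erase u := by
    ext i
    by_cases h : i = u
    · subst h; simp [hc]
    · simp [h]
  rw [this, Finset.card_erase_add_one]
  simp [hu, hf]

theorem undecided_update_le {m : ℕ} {f : ℕ → ℕ} {u c : ℕ} (hc : c ≠ 0) :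
    undecided m (Function.update f u c) ≤ undecided m f := by
  unfold undecided
  refine Finset.card_le_card fun i => ?_
  by_cases h : i = u
  · subst h; simp [hc]
  · simp [h]

/-- No two vertices of `S` are in conflict. -/
def ConflictFree {V : Type*} (bad : Finset V → V → V → Prop) (S : Finset V) : Prop :=
  ∀ u ∈ S, ∀ w ∈ S, u ≠ w → ¬ bad S u w

/-- Conflicts persist in subsets. -/
def Hereditary {V : Type*} (bad : Finset V → V → V → Prop) : Prop :=
  ∀ ⦃S S' : Finset V⦄, S ⊆ S' → ∀ u ∈ S, ∀ w ∈ S, bad S' u w → bad S u w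

/-- There is a conflict-free set with at least `K` elements that respects the status `f`. -/
def Extendable (bad : Finset ℕ → ℕ → ℕ → Prop) (K m : ℕ) (f : ℕ → ℕ) : Prop :=
  ∃ S ⊆ Finset.range m, ConflictFree bad S ∧ K ≤ S.card ∧
    ∀ i < m, (f i = 2 → i ∉ S) ∧ (f i ≠ 0 → f i ≠ 2 → i ∈ S)

variable {bad : Finset ℕ → ℕ → ℕ → Prop} {K m : ℕ} {f f' : ℕ → ℕ}

theorem extendable_congr (h : ∀ i < m, f i = f' i) :
    Extendable bad K m f ↔ Extendable bad K m f' := by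
  unfold Extendable
  refine exists_congr fun S => and_congr_right fun _ => and_congr_right fun _ =>
    and_congr_right fun _ => forall₂_congr fun i hi => ?_
  rw [h i hi]

theorem extendable_zero :
    Extendable bad K m (fun _ => 0) ↔ ∃ S ⊆ Finset.range m, ConflictFree bad S ∧ K ≤ S.card := by
  simp [Extendable]

/-- This is a leaf of the search tree: every set that respects `f` lies inside `alive m f`, so if
the latter has no conflict it is the largest candidate. -/
theorem extendable_of_conflictFree (h : ConflictFree bad (alive m f)) :
    Extendable bad K m f ↔ K ≤ (alive m f).card := by
  constructor
  · rintro ⟨S, hS, -, hK, hf⟩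
    refine hK.trans (Finset.card_le_card fun i hi => ?_)
    have := Finset.mem_range.1 (hS hi)
    simp only [alive, Finset.mem_filter, hS hi, true_and]
    exact fun h => (hf i this).1 h hi
  · intro hK
    refine ⟨_, Finset.filter_subset _ _, h, hK, fun i hi => ⟨?_, ?_⟩⟩ <;>
      simp +contextual [hi]

/-- A solution is a subset of the alive vertices, so by heredity it cannot contain both `u` and `w`.
Splitting on whether it contains `u` allows the second branch to fix `u` as kept, which is what
makes that branch decide two vertices. The conditions `f u = 0` and `f w = 0` discard a branch that
would delete a vertex already kept. -/
theorem extendable_branch (hbad : Hereditary bad) {u w : ℕ} (hu : u ∈ alive m f)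
    (hw : w ∈ alive m f) (huw : u ≠ w) (h : bad (alive m f) u w) :
    Extendable bad K m f ↔
      (f u = 0 ∧ Extendable bad K m (Function.update f u 2)) ∨
      (f w = 0 ∧ Extendable bad K m (Function.update (Function.update f u 1) w 2)) := by
  simp only [alive, Finset.mem_filter, Finset.mem_range] at hu hw
  constructor
  · rintro ⟨S, hS, hc, hK, hf⟩
    have hSa : S ⊆ alive m f := fun i hi => by
      have := Finset.mem_range.1 (hS hi)
      simp only [alive, Finset.mem_filter, hS hi, true_and]
      exact fun h => (hf i this).1 h hi
    by_cases huS : u ∈ S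
    · have hwS : w ∉ S := fun hwS => hc u huS w hwS huw (hbad hSa u huS w hwS h)
      refine .inr ⟨?_, S, hS, hc, hK, fun i hi => ?_⟩
      · by_contra h0
        exact hwS ((hf w hw.1).2 h0 hw.2)
      · by_cases hiw : i = w
        · subst hiw; simp [hwS]
        · by_cases hiu : i = u
          · subst hiu; simp [hiw, huS]
          · simpa [hiw, hiu] using hf i hi
    · refine .inl ⟨?_, S, hS, hc, hK, fun i hi => ?_⟩
      · by_contra h0
        exact huS ((hf u hu.1).2 h0 hu.2)
      · by_cases hiu : i = u
        · subst hiu; simp [huS]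
        · simpa [hiu] using hf i hi
  · rintro (⟨h0, S, hS, hc, hK, hf⟩ | ⟨h0, S, hS, hc, hK, hf⟩)
    · refine ⟨S, hS, hc, hK, fun i hi => ?_⟩
      by_cases hiu : i = u
      · subst hiu; simp [h0]
      · simpa [hiu] using hf i hi
    · refine ⟨S, hS, hc, hK, fun i hi => ?_⟩
      by_cases hiw : i = w
      · subst hiw; simp [h0]
      · by_cases hiu : i = u
        · subst hiu
          have := hf i hi
          simp only [ne_eq, hiw, not_false_eq_true, Function.update_of_ne, Function.update_self,
            OfNat.one_ne_ofNat, IsEmpty.forall_iff, one_ne_zero, forall_const, true_and] at this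
          exact ⟨fun h => absurd h hu.2, fun _ _ => this⟩
        · simpa [hiw, hiu] using hf i hi

end TwoClub

/-! ### Listing the vertices at distance at most two -/

namespace TwoClub

open RAM RAM.Expr RAM.Prog

/-- Append `x` to a list unless it occurs already. -/
def insertEnd {α : Type*} [DecidableEq α] (l : List α) (x : α) : List α :=
  if x ∈ l then l else l ++ [x]

section InsertEnd

variable {α : Type*} [DecidableEq α] {l : List α} {x y : α}

theorem mem_insertEnd : y ∈ insertEnd l x ↔ y ∈ l ∨ y = x := by
  unfold insertEnd
  split_ifs with h
  · exact ⟨.inl, fun h' => h'.elim id fun h' => h' ▸ h⟩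
  · simp

theorem nodup_insertEnd (hl : l.Nodup) : (insertEnd l x).Nodup := by
  unfold insertEnd
  split_ifs with h
  · exact hl
  · refine List.nodup_append.2 ⟨hl, List.nodup_singleton x, fun a ha b hb hab => h ?_⟩
    rw [← List.mem_singleton.1 hb, ← hab]; exact ha

theorem mem_foldl_insertEnd (l' : List α) :
    ∀ l : List α, y ∈ l'.foldl insertEnd l ↔ y ∈ l ∨ y ∈ l' := by
  induction l' with
  | nil => simp
  | cons a l' ih => intro l; rw [List.foldl_cons, ih, mem_insertEnd, List.mem_cons, or_assoc]

theorem nodup_foldl_insertEnd (l' : List α) :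
    ∀ l : List α, l.Nodup → (l'.foldl insertEnd l).Nodup := by
  induction l' with
  | nil => simp
  | cons a l' ih => intro l hl; exact ih _ (nodup_insertEnd hl)

end InsertEnd

/-- Add `x` and its neighbors to a list. -/
def addNeighborhood {n : ℕ} (adj : Fin n → List (Fin n)) (l : List (Fin n)) (x : Fin n) :
    List (Fin n) := (adj x).foldl insertEnd (insertEnd l x)

/-- The vertices at distance at most two from `v`. -/
def ballList {n : ℕ} (adj : Fin n → List (Fin n)) (v : Fin n) : List (Fin n) :=
  (adj v).foldl (addNeighborhood adj) [v]

section Ball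

variable {n : ℕ} {adj : Fin n → List (Fin n)} {v y : Fin n}

theorem mem_foldl_addNeighborhood (l' : List (Fin n)) : ∀ l : List (Fin n),
    y ∈ l'.foldl (addNeighborhood adj) l ↔ y ∈ l ∨ ∃ x ∈ l', y = x ∨ y ∈ adj x := by
  induction l' with
  | nil => simp
  | cons a l' ih =>
    intro l
    rw [List.foldl_cons, ih, addNeighborhood, mem_foldl_insertEnd, mem_insertEnd]
    simp only [List.mem_cons, exists_eq_or_imp, or_assoc]

theorem nodup_foldl_addNeighborhood (l' : List (Fin n)) :
    ∀ l : List (Fin n), l.Nodup → (l'.foldl (addNeighborhood adj) l).Nodup := by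
  induction l' with
  | nil => simp
  | cons a l' ih => intro l hl; exact ih _ (nodup_foldl_insertEnd _ _ (nodup_insertEnd hl))

theorem mem_ballList : y ∈ ballList adj v ↔ y = v ∨ ∃ x ∈ adj v, y = x ∨ y ∈ adj x := by
  rw [ballList, mem_foldl_addNeighborhood, List.mem_singleton]

theorem nodup_ballList : (ballList adj v).Nodup :=
  nodup_foldl_addNeighborhood _ _ (List.nodup_singleton v)

theorem length_le_ballList {l : List (Fin n)} (hl : l.Nodup) (h : l ⊆ ballList adj v) :
    l.length ≤ (ballList adj v).length := by
  rw [← List.toFinset_card_of_nodup hl, ← List.toFinset_card_of_nodup nodup_ballList]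
  exact Finset.card_le_card fun x => by simpa using @h x

theorem length_ballList_le_card : (ballList adj v).length ≤ n := by
  simpa using (nodup_ballList (adj := adj) (v := v)).length_le_card

/-- The count is `1 + D + D * (D - 1)`: by symmetry each neighbor of `v` has `v` among its own
neighbors and so contributes at most `D - 1` further vertices. -/
theorem length_ballList_le {G : SimpleGraph (Fin n)} (hadj : IsAdjacencyList G adj) {D : ℕ}
    (hD : ∀ x, (adj x).length ≤ D) (v : Fin n) : (ballList adj v).length ≤ D ^ 2 + 1 := by
  classical
  have hsub : (ballList adj v).toFinset ⊆
      insert v ((adj v).toFinset ∪ (adj v).toFinset.biUnion fun x => (adj x).toFinset.erase v) := by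
    intro y
    simp only [List.mem_toFinset, mem_ballList, Finset.mem_insert, Finset.mem_union,
      Finset.mem_biUnion, Finset.mem_erase]
    rintro (h | ⟨x, hx, h | h⟩)
    · exact .inl h
    · exact .inr (.inl (h ▸ hx))
    · by_cases hy : y = v
      · exact .inl hy
      · exact .inr (.inr ⟨x, hx, hy, h⟩)
  have hcard : ∀ x, (adj x).toFinset.card ≤ D := fun x => (List.toFinset_card_le _).trans (hD x)
  have hbi : ((adj v).toFinset.biUnion fun x => (adj x).toFinset.erase v).card ≤
      (adj v).toFinset.card * (D - 1) := by
    refine Finset.card_biUnion_le_card_mul _ _ _ fun x hx => ?_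
    have hvx : v ∈ (adj x).toFinset := by
      have := ((hadj v).2 x).1 (List.mem_toFinset.1 hx)
      exact List.mem_toFinset.2 (((hadj x).2 v).2 this.symm)
    rw [Finset.card_erase_of_mem hvx]
    exact Nat.sub_le_sub_right (hcard x) 1
  rw [← List.toFinset_card_of_nodup nodup_ballList]
  refine (Finset.card_le_card hsub).trans ((Finset.card_insert_le _ _).trans ?_)
  have h1 := Finset.card_union_le (adj v).toFinset
    ((adj v).toFinset.biUnion fun x => (adj x).toFinset.erase v)
  have h2 := hcard v
  have h3 : (adj v).toFinset.card * (D - 1) ≤ D * (D - 1) := Nat.mul_le_mul_right _ h2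
  have h4 : D * (D - 1) + D = D ^ 2 := by
    cases D with
    | zero => rfl
    | succ d => simp only [Nat.add_sub_cancel]; ring
  omega

end Ball

/-- Arrays `0` and `1` hold the adjacency lists. -/
structure HoldsGraph {n : ℕ} (adj : Fin n → List (Fin n)) (s : State) : Prop where
  next : ∀ v : Fin n, s.arr 0 (v + 1) = s.arr 0 v + (adj v).length
  entry : ∀ (v : Fin n) (i : ℕ) (h : i < (adj v).length),
    s.arr 1 (s.arr 0 v + i) = ((adj v)[i] : ℕ)

theorem HoldsGraph.congr {n : ℕ} {adj : Fin n → List (Fin n)} {s s' : State}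
    (h : HoldsGraph adj s) (h₀ : s'.arr 0 = s.arr 0) (h₁ : s'.arr 1 = s.arr 1) :
    HoldsGraph adj s' :=
  ⟨by rw [h₀]; exact h.next, by rw [h₀, h₁]; exact h.entry⟩

/-- Array `2` holds the list `l`, and register `6` its length. -/
structure HoldsList {n : ℕ} (l : List (Fin n)) (s : State) : Prop where
  length : s.reg 6 = l.length
  entry : ∀ (i : ℕ) (h : i < l.length), s.arr 2 i = (l[i] : ℕ)

theorem HoldsList.congr {n : ℕ} {l : List (Fin n)} {s s' : State}
    (h : HoldsList l s) (h₀ : s'.reg 6 = s.reg 6) (h₁ : s'.arr 2 = s.arr 2) : HoldsList l s' :=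
  ⟨by rw [h₀]; exact h.length, by rw [h₁]; exact h.entry⟩

/-- Append the vertex in register `14` to the list in array `2`, unless it occurs there. -/
def addVertex : Prog :=
  assign 16 (const 0) ;;
  forLoop 15 6 (cond (.eq (arr 2 (reg 15)) (reg 14)) (assign 16 (const 1)) skip) ;;
  cond (reg 16) skip (store 2 (reg 6) (reg 14) ;; assign 6 (reg 6 + const 1))

/-- The time is stated in terms of a bound `M` on the length, so that one estimate serves all
insertions into the growing list. -/
theorem addVertex_runs {n B : ℕ} {l : List (Fin n)} {x : Fin n} {s : State} {M : ℕ}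
    (hl : HoldsList l s) (hx : s.reg 14 = x) (hM : l.length ≤ M) (hB : M + n + 1 ≤ B) :
    Runs B addVertex s (16 * M + 19) (HoldsList (insertEnd l x)) := by
  refine Runs.le (T₁ := 2 + ((l.length * ((5 + 1 + (2 + 1) - 1) + 8) + 6) + (2 + (1 + 7)))) ?_
    (by omega)
  unfold addVertex
  refine .assign_seq (by simp) (.seq ?_)
  refine Runs.forLoop (fun j s' => s'.reg 16 = if x ∈ l.take j then 1 else 0)
    (by simpa using hl.length) (by omega) (by decide) (by decide) (by simp) ?_ ?_
  · intro j hj s' hA hi hI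
    have h14 : s'.reg 14 = x := by rw [hA.reg _ (by decide)]; simpa using hx
    have h2 : s'.arr 2 j = (l[j] : ℕ) := by
      rw [hA.arr _ (by decide)]; simpa using hl.entry j hj
    have htake : x ∈ l.take (j + 1) ↔ x ∈ l.take j ∨ x = l[j] := by
      rw [List.take_succ_eq_append_getElem hj, List.mem_append, List.mem_singleton]
    refine .cond (fun h => .assign (by simp; omega) ?_) (fun h => .skip ?_)
    · simp only [eval_eq, eval_arr, eval_reg, hi, h2, h14] at h
      have : x = l[j] := by
        by_contra h'; exact h (if_neg fun h'' => h' (Fin.ext h''.symm))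
      simp [htake.2 (.inr this)]
    · simp only [eval_eq, eval_arr, eval_reg, hi, h2, h14] at h
      have : x ≠ l[j] := by rintro rfl; simp at h
      simpa [htake, this] using hI
  · intro s' hA hI
    have h14 : s'.reg 14 = x := by rw [hA.reg _ (by decide)]; simpa using hx
    have h6 : s'.reg 6 = l.length := by rw [hA.reg _ (by decide)]; simpa using hl.length
    have h2 : s'.arr 2 = s.arr 2 := by rw [hA.arr _ (by decide)]; simp
    rw [List.take_length] at hI
    have := x.2
    refine .cond (fun h => .skip ?_) (fun h => .store_seq (by simp; omega)
      (.assign (by simp; omega) ?_))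
    · have hm : x ∈ l := by by_contra h'; simp [hI, h'] at h
      rw [insertEnd, if_pos hm]
      exact ⟨h6, by rw [h2]; exact hl.entry⟩
    · have hm : x ∉ l := by intro h'; simp [hI, h'] at h
      rw [insertEnd, if_neg hm]
      refine ⟨by simp [h6], fun i hi => ?_⟩
      simp only [List.length_append, List.length_singleton] at hi
      simp only [eval_reg, State.setReg_arr, State.setArr_arr, if_true, h6, h14, h2]
      by_cases hil : i = l.length
      · subst hil; simp
      · rw [Function.update_of_ne hil, List.getElem_append_left (by omega)]
        exact hl.entry i (by omega)

/-- List the vertices at distance at most two from the vertex in register `5`. -/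
def ballProg : Prog :=
  store 2 (const 0) (reg 5) ;; assign 6 (const 1) ;;
  assign 9 (arr 0 (reg 5)) ;; assign 8 (arr 0 (reg 5 + const 1) - reg 9) ;;
  forLoop 7 8 (
    assign 10 (arr 1 (reg 9 + reg 7)) ;; assign 14 (reg 10) ;; addVertex ;;
    assign 13 (arr 0 (reg 10)) ;; assign 12 (arr 0 (reg 10 + const 1) - reg 13) ;;
    forLoop 11 12 (assign 14 (arr 1 (reg 13 + reg 11)) ;; addVertex))

theorem ballProg_runs {n B D : ℕ} {adj : Fin n → List (Fin n)} {v : Fin n} {s : State}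
    (hG : HoldsGraph adj s) (hv : s.reg 5 = v) (hD : ∀ x, (adj x).length ≤ D)
    (hoff : ∀ x : Fin n, s.arr 0 x ≤ B) (hB : 2 * n + D + 1 ≤ B) :
    Runs B ballProg s (D * ((16 * (ballList adj v).length + 19 + 20 +
        (D * ((5 + (16 * (ballList adj v).length + 19)) + 8) + 6)) + 8) + 30)
      (HoldsList (ballList adj v)) := by
  set M := (ballList adj v).length with hMdef
  have hMn : M ≤ n := length_ballList_le_card
  have hvn := v.2
  unfold ballProg
  refine Runs.le (T₁ := 3 + (2 + (3 + (7 + ((adj v).length * ((5 + (2 + ((16 * M + 19) +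
    (3 + (7 + (D * ((5 + (16 * M + 19)) + 8) + 6)))))) + 8) + 6))))) ?_ ?_
  · refine .store_seq (by simp; omega) (.assign_seq (by simp; omega)
      (.assign_seq (by simpa [hv] using hoff v) (.assign_seq ?_ ?_)))
    · have := hD v
      simp [hv, hG.next]; omega
    refine Runs.forLoop (fun j s' => HoldsList (((adj v).take j).foldl (addNeighborhood adj) [v]) s')
      (by simp [hv, hG.next]) (by have := hD v; omega) (by decide) (by decide) ?_ ?_ ?_
    · exact ⟨by simp, by simp [hv]⟩
    · intro j hj s' hA hi hI
      have hG' : HoldsGraph adj s' := hG.congr (by rw [hA.arr _ (by decide)]; simp)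
        (by rw [hA.arr _ (by decide)]; simp)
      have h9 : s'.reg 9 = s'.arr 0 v := by
        rw [hA.reg _ (by decide), hA.arr _ (by decide)]; simp [hv]
      have hoff' : ∀ x : Fin n, s'.arr 0 x ≤ B := by
        rw [hA.arr _ (by decide)]; simpa using hoff
      have hx : s'.arr 1 (s'.reg 9 + j) = ((adj v)[j] : ℕ) := by rw [h9]; exact hG'.entry v j hj
      generalize hxe : (adj v)[j] = x at hx
      have hxv : x ∈ adj v := hxe ▸ List.getElem_mem _
      have hxn := x.2
      have htake : ((adj v).take (j + 1)).foldl (addNeighborhood adj) [v] =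
          addNeighborhood adj (((adj v).take j).foldl (addNeighborhood adj) [v]) x := by
        rw [List.take_succ_eq_append_getElem hj, hxe, List.foldl_append]; rfl
      have hlnd := nodup_foldl_addNeighborhood (adj := adj) ((adj v).take j) [v]
        (List.nodup_singleton v)
      -- Partial lists are duplicate-free and stay inside the final ball, so the length of the ball
      -- bounds the cost of every insertion.
      have hlsub : ((adj v).take j).foldl (addNeighborhood adj) [v] ⊆ ballList adj v := by
        intro y hy
        rw [mem_foldl_addNeighborhood, List.mem_singleton] at hy
        rw [mem_ballList]
        exact hy.imp_right fun ⟨x, hx, h⟩ => ⟨x, List.mem_of_mem_take hx, h⟩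
      rw [htake]
      generalize ((adj v).take j).foldl (addNeighborhood adj) [v] = l at hI hlnd hlsub
      refine .assign_seq (by simp [hi, hx]; omega) (.assign_seq (by simp [hi, hx]; omega) ?_)
      refine (addVertex_runs (l := l) (x := x) (M := M) (hI.congr (by simp) (by simp))
        (by simp [hi, hx]) (length_le_ballList hlnd hlsub) (by omega)).andThen ?_
      intro s₁ hA₁ hl₁
      have hG₁ : HoldsGraph adj s₁ := hG'.congr (by rw [hA₁.arr _ (by decide)]; simp)
        (by rw [hA₁.arr _ (by decide)]; simp)
      have h10 : s₁.reg 10 = x := by rw [hA₁.reg _ (by decide)]; simp [hi, hx]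
      have hoff₁ : ∀ x : Fin n, s₁.arr 0 x ≤ B := by
        rw [hA₁.arr _ (by decide)]; simpa using hoff'
      have hDx := hD x
      refine .assign_seq (by simpa [h10] using hoff₁ x) (.assign_seq ?_ ?_)
      · simp [h10, hG₁.next]; omega
      refine Runs.le (T₁ := ((adj x).length * ((5 + (16 * M + 19)) + 8) + 6)) ?_ (by gcongr)
      refine Runs.forLoop (fun j s' => HoldsList (((adj x).take j).foldl insertEnd
        (insertEnd l x)) s') (by simp [h10, hG₁.next]) (by omega) (by decide) (by decide) ?_ ?_ ?_
      · exact hl₁.congr (by simp) (by simp)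
      · intro j' hj' s₂ hA₂ hi₂ hI₂
        have hG₂ : HoldsGraph adj s₂ := hG₁.congr (by rw [hA₂.arr _ (by decide)]; simp)
          (by rw [hA₂.arr _ (by decide)]; simp)
        have h13 : s₂.reg 13 = s₂.arr 0 x := by
          rw [hA₂.reg _ (by decide), hA₂.arr _ (by decide)]; simp [h10]
        have hy : s₂.arr 1 (s₂.reg 13 + j') = ((adj x)[j'] : ℕ) := by
          rw [h13]; exact hG₂.entry x j' hj'
        have hnd := nodup_foldl_insertEnd ((adj x).take j') _ (nodup_insertEnd (x := x) hlnd)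
        have hsub : ((adj x).take j').foldl insertEnd (insertEnd l x) ⊆ ballList adj v := by
          intro y hy
          rw [mem_foldl_insertEnd, mem_insertEnd] at hy
          rcases hy with (hy | hy) | hy
          · exact hlsub hy
          · exact mem_ballList.2 (.inr ⟨x, hxv, .inl hy⟩)
          · exact mem_ballList.2 (.inr ⟨x, hxv, .inr (List.mem_of_mem_take hy)⟩)
        have htake' : ((adj x).take (j' + 1)).foldl insertEnd (insertEnd l x) =
            insertEnd (((adj x).take j').foldl insertEnd (insertEnd l x)) (adj x)[j'] := by
          rw [List.take_succ_eq_append_getElem hj', List.foldl_append]; rfl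
        have := ((adj x)[j']).2
        refine .assign_seq (by simp [hi₂, hy]; omega) ?_
        refine (addVertex_runs (M := M) (hI₂.congr (by simp) (by simp)) (x := (adj x)[j'])
          (by simp [hi₂, hy]) (length_le_ballList hnd hsub) (by omega)).post ?_
        intro s₃ hA₃ h₃
        rw [htake']
        exact h₃.congr (by simp) (by simp)
      · intro s₂ hA₂ hI₂
        rw [List.take_length] at hI₂
        exact hI₂.congr (by simp) (by simp)
    · intro s' hA hI
      rwa [List.take_length] at hI
  · have := Nat.mul_le_mul_right ((5 + (2 + ((16 * M + 19) +
      (3 + (7 + (D * ((5 + (16 * M + 19)) + 8) + 6)))))) + 8) (hD v)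
    refine le_trans ?_ (le_trans (Nat.add_le_add_right this 21) ?_)
    · omega
    · ring_nf; omega

end TwoClub

/-! ### The local adjacency matrix -/

namespace TwoClub

open RAM RAM.Expr RAM.Prog

/-- Two-dimensional data (the adjacency matrix, the stack, the residual capacities) are stored row
by row; this says that distinct positions occupy distinct cells. -/
theorem mul_add_inj {m i j i' j' : ℕ} (hj : j < m) (hj' : j' < m) :
    i * m + j = i' * m + j' ↔ i = i' ∧ j = j' := by
  refine ⟨fun h => ?_, by rintro ⟨rfl, rfl⟩; rfl⟩
  have hm : 0 < m := by omega
  have h1 : i = i' := by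
    have := congrArg (· / m) h
    simpa [Nat.mul_comm _ m, Nat.mul_add_div hm, Nat.div_eq_of_lt hj, Nat.div_eq_of_lt hj']
      using this
  subst h1
  exact ⟨rfl, by omega⟩

theorem update_mul_add {m i j i' j' c : ℕ} (g : ℕ → ℕ) (hj : j < m) (hj' : j' < m) :
    Function.update g (i * m + j) c (i' * m + j') =
      if i' = i ∧ j' = j then c else g (i' * m + j') := by
  rw [Function.update_apply]
  simp only [mul_add_inj hj' hj]

/-- Write the adjacency matrix of the graph induced by the list in array `2` to array `3`. -/
def matrixProg : Prog :=
  forLoop 17 6 (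
    assign 19 (arr 0 (arr 2 (reg 17))) ;;
    assign 20 (arr 0 (arr 2 (reg 17) + const 1) - reg 19) ;;
    forLoop 18 6 (
      store 3 (reg 17 * reg 6 + reg 18) (const 0) ;;
      forLoop 21 20 (
        cond (.eq (arr 1 (reg 19 + reg 21)) (arr 2 (reg 18)))
          (store 3 (reg 17 * reg 6 + reg 18) (const 1)) skip)))

theorem matrixProg_runs {n B D : ℕ} {adj : Fin n → List (Fin n)} {l : List (Fin n)} {s : State}
    (hG : HoldsGraph adj s) (hl : HoldsList l s) (hD : ∀ x, (adj x).length ≤ D)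
    (hoff : ∀ x : Fin n, s.arr 0 x ≤ B) (hB : l.length + D + 1 ≤ B) :
    Runs B matrixProg s (l.length * (12 + (l.length * ((7 + (D * (17 + 8) + 6)) + 8) + 6) + 8) + 6)
      fun s' => ∀ (i j : ℕ) (hi : i < l.length) (hj : j < l.length),
        s'.arr 3 (i * l.length + j) = if l[j] ∈ adj l[i] then 1 else 0 := by
  unfold matrixProg
  refine Runs.forLoop (fun a s' => ∀ (i j : ℕ) (hi : i < l.length) (hj : j < l.length), i < a →
        s'.arr 3 (i * l.length + j) = if l[j] ∈ adj l[i] then 1 else 0)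
    hl.length (by omega) (by decide) (by decide) (by simp) ?_ ?_
  swap
  · exact fun s' _ h i j hi hj => h i j hi hj hi
  intro a ha s₁ hA₁ ha₁ hI₁
  have hG₁ : HoldsGraph adj s₁ := hG.congr (hA₁.arr _ (by decide)) (hA₁.arr _ (by decide))
  have hl₁ : HoldsList l s₁ := hl.congr (hA₁.reg _ (by decide)) (hA₁.arr _ (by decide))
  have hoff₁ : ∀ x : Fin n, s₁.arr 0 x ≤ B := by rw [hA₁.arr _ (by decide)]; exact hoff
  have hla := hl₁.entry a ha
  have hDa := hD l[a]
  refine Runs.le (T₁ := 4 + (8 + (l.length * ((7 + (D * (17 + 8) + 6)) + 8) + 6))) ?_ (by omega)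
  refine .assign_seq (by simpa [ha₁, hla] using hoff₁ l[a]) (.assign_seq ?_ ?_)
  · simp [ha₁, hla, hG₁.next]; omega
  refine Runs.forLoop (fun b s' => ∀ (i j : ℕ) (hi : i < l.length) (hj : j < l.length),
      (i < a ∨ i = a ∧ j < b) →
        s'.arr 3 (i * l.length + j) = if l[j] ∈ adj l[i] then 1 else 0)
    (by simpa using hl₁.length) (by omega) (by decide) (by decide) ?_ ?_ ?_
  · intro i j hi hj h
    exact hI₁ i j hi hj (by omega)
  swap
  · intro s' _ h i j hi hj hia
    exact h i j hi hj (by simp at hia; omega)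
  intro b hb s₂ hA₂ hb₂ hI₂
  have hG₂ : HoldsGraph adj s₂ := hG₁.congr (by rw [hA₂.arr _ (by decide)]; simp)
    (by rw [hA₂.arr _ (by decide)]; simp)
  have hl₂ : HoldsList l s₂ := hl₁.congr (by rw [hA₂.reg _ (by decide)]; simp)
    (by rw [hA₂.arr _ (by decide)]; simp)
  have h17 : s₂.reg 17 = a := by rw [hA₂.reg _ (by decide)]; simpa using ha₁
  have h6 := hl₂.length
  have h19 : s₂.reg 19 = s₂.arr 0 l[a] := by
    rw [hA₂.reg _ (by decide), hA₂.arr _ (by decide)]; simp [ha₁, hla]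
  have h20 : s₂.reg 20 = (adj l[a]).length := by
    rw [hA₂.reg _ (by decide)]; simp [ha₁, hla, hG₁.next]
  have hlb := hl₂.entry b hb
  -- The cell may hold an entry from an earlier ball, so it is cleared before the adjacency list is
  -- scanned.
  refine .store_seq (by simp) ?_
  refine Runs.le (T₁ := (adj l[a]).length * (17 + 8) + 6) ?_ (by simp; gcongr)
  -- Entries before `(a, b)` are final, and the entry `(a, b)` reports whether the vertex occurs
  -- among the first `c` list elements.
  refine Runs.forLoop (fun c s' => (∀ (i j : ℕ) (hi : i < l.length) (hj : j < l.length),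
      (i < a ∨ i = a ∧ j < b) →
        s'.arr 3 (i * l.length + j) = if l[j] ∈ adj l[i] then 1 else 0) ∧
      s'.arr 3 (a * l.length + b) = if l[b] ∈ (adj l[a]).take c then 1 else 0)
    (by simpa using h20) (by omega) (by decide) (by decide) ?_ ?_ ?_
  · refine ⟨fun i j hi hj h => ?_, ?_⟩
    · simp only [eval_add, eval_mul, eval_reg, h17, h6, hb₂, State.setReg_arr, State.setArr_arr,
        if_true]
      rw [update_mul_add _ hb hj, if_neg (by omega)]
      exact hI₂ i j hi hj h
    · simp [h17, h6, hb₂]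
  · rintro c hc s₃ hA₃ hc₃ ⟨hI₃, hI₃'⟩
    have h17' : s₃.reg 17 = a := by rw [hA₃.reg _ (by decide)]; simpa using h17
    have h18' : s₃.reg 18 = b := by rw [hA₃.reg _ (by decide)]; simpa using hb₂
    have h6' : s₃.reg 6 = l.length := by rw [hA₃.reg _ (by decide)]; simpa using h6
    have hy : s₃.arr 1 (s₃.reg 19 + c) = ((adj l[a])[c] : ℕ) := by
      rw [hA₃.arr _ (by decide), hA₃.reg _ (by decide)]
      simpa [h19] using hG₂.entry l[a] c hc
    have hb' : s₃.arr 2 b = (l[b] : ℕ) := by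
      rw [hA₃.arr _ (by decide)]; simpa using hlb
    have htake : l[b] ∈ (adj l[a]).take (c + 1) ↔ l[b] ∈ (adj l[a]).take c ∨ l[b] = (adj l[a])[c] := by
      rw [List.take_succ_eq_append_getElem hc, List.mem_append, List.mem_singleton]
    refine Runs.le (T₁ := 7 + 1 + (7 + 1)) ?_ (by omega)
    refine .cond (fun h => .store (by simp; omega) ?_) (fun h => .skip ?_)
    · simp only [eval_eq, eval_arr, eval_add, eval_reg, hc₃, hy, h18', hb'] at h
      have heq : l[b] = (adj l[a])[c] := by
        by_contra h'; exact h (if_neg fun h'' => h' (Fin.ext h''.symm))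
      refine ⟨fun i j hi hj h => ?_, ?_⟩
      · simp only [eval_add, eval_mul, eval_reg, h17', h6', h18', State.setReg_arr,
          State.setArr_arr, if_true]
        rw [update_mul_add _ hb hj, if_neg (by omega)]
        exact hI₃ i j hi hj h
      · simp [h17', h6', h18', htake.2 (.inr heq)]
    · simp only [eval_eq, eval_arr, eval_add, eval_reg, hc₃, hy, h18', hb'] at h
      have heq : l[b] ≠ (adj l[a])[c] := by intro h'; simp [h'] at h
      refine ⟨hI₃, ?_⟩
      simp only [htake, heq, or_false]
      exact hI₃'
  · rintro s₃ hA₃ ⟨hI₃, hI₃'⟩ i j hi hj h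
    rw [List.take_length] at hI₃'
    rcases (by omega : (i < a ∨ i = a ∧ j < b) ∨ i = a ∧ j = b) with h | ⟨rfl, rfl⟩
    · exact hI₃ i j hi hj h
    · exact hI₃'

end TwoClub

/-! ### The search program -/

namespace TwoClub

open RAM RAM.Expr RAM.Prog

/-- A stack of status vectors: entry `e` assigns to the vertex `i` the status `σ e i`. The potential
bounds the number of search tree nodes that are still to be visited. -/
def potential (m : ℕ) (σ : ℕ → ℕ → ℕ) (d : ℕ) : ℕ :=
  ∑ e ∈ Finset.range d, treeSize (undecided m (σ e))

/-- All entries are status vectors, and entries higher up have fewer undecided vertices. -/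
def StackOk (m : ℕ) (σ : ℕ → ℕ → ℕ) (d : ℕ) : Prop :=
  ∀ e < d, undecided m (σ e) + e ≤ m ∧ ∀ i < m, σ e i ≤ 2

/-- Some entry of the stack can be extended to a solution. -/
def StackExtendable (bad : Finset ℕ → ℕ → ℕ → Prop) (K m : ℕ) (σ : ℕ → ℕ → ℕ) (d : ℕ) : Prop :=
  ∃ e < d, Extendable bad K m (σ e)

section Stack

variable {bad : Finset ℕ → ℕ → ℕ → Prop} {K m d : ℕ} {σ σ' : ℕ → ℕ → ℕ}

theorem potential_congr (h : ∀ e < d, ∀ i < m, σ' e i = σ e i) :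
    potential m σ' d = potential m σ d :=
  Finset.sum_congr rfl fun e he => by rw [undecided_congr (h e (Finset.mem_range.1 he))]

theorem stackOk_congr (h : ∀ e < d, ∀ i < m, σ' e i = σ e i) (hσ : StackOk m σ d) :
    StackOk m σ' d := fun e he => by
  rw [undecided_congr (h e he)]
  exact ⟨(hσ e he).1, fun i hi => by rw [h e he i hi]; exact (hσ e he).2 i hi⟩

theorem stackExtendable_congr (h : ∀ e < d, ∀ i < m, σ' e i = σ e i) :
    StackExtendable bad K m σ' d ↔ StackExtendable bad K m σ d :=
  exists_congr fun e => and_congr_right fun he => extendable_congr (h e he)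

theorem potential_succ : potential m σ (d + 1) = potential m σ d + treeSize (undecided m (σ d)) :=
  Finset.sum_range_succ _ _

theorem stackOk_succ : StackOk m σ (d + 1) ↔
    StackOk m σ d ∧ undecided m (σ d) + d ≤ m ∧ ∀ i < m, σ d i ≤ 2 :=
  ⟨fun h => ⟨fun e he => h e (by omega), h d (by omega)⟩, fun h e he => by
    rcases (by omega : e < d ∨ e = d) with he | rfl
    exacts [h.1 e he, h.2]⟩

theorem stackExtendable_succ : StackExtendable bad K m σ (d + 1) ↔
    StackExtendable bad K m σ d ∨ Extendable bad K m (σ d) := by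
  constructor
  · rintro ⟨e, he, h⟩
    rcases (by omega : e < d ∨ e = d) with he | rfl
    exacts [.inl ⟨e, he, h⟩, .inr h]
  · rintro (⟨e, he, h⟩ | h)
    exacts [⟨e, by omega, h⟩, ⟨d, by omega, h⟩]

end Stack

/-- The stack in array `4`. -/
def stack (m : ℕ) (s : State) (e i : ℕ) : ℕ := s.arr 4 (e * m + i)

/-- Copy the stack entry at height `reg 22` to array `5`, and its alive vertices to array `6`. -/
def loadTop : Prog :=
  forLoop 23 6 (
    store 5 (reg 23) (arr 4 (reg 22 * reg 6 + reg 23)) ;;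
    store 6 (reg 23) (const 1 - .eq (arr 5 (reg 23)) (const 2)))

theorem loadTop_runs {B m d : ℕ} {s : State} (h6 : s.reg 6 = m) (h22 : s.reg 22 = d)
    (hs : ∀ i < m, stack m s d i ≤ 2) (hB : m + 2 ≤ B) :
    Runs B loadTop s (m * (25 + 8) + 6) fun s' =>
      (∀ i < m, s'.arr 5 i = stack m s d i) ∧
      ∀ i < m, s'.arr 6 i = if i ∈ alive m (stack m s d) then 1 else 0 := by
  refine Runs.forLoop (fun j s' => (∀ i < j, s'.arr 5 i = stack m s d i) ∧
      ∀ i < j, s'.arr 6 i = if i ∈ alive m (stack m s d) then 1 else 0) h6 (by omega) (by decide)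
      (by decide) (by simp) ?_ fun s' _ h => h
  rintro j hj s' hA hi ⟨hI₁, hI₂⟩
  have h6' : s'.reg 6 = m := by rw [hA.reg _ (by decide)]; exact h6
  have h22' : s'.reg 22 = d := by rw [hA.reg _ (by decide)]; exact h22
  have h4 : s'.arr 4 (d * m + j) = stack m s d j := by rw [hA.arr _ (by decide)]; rfl
  have hsj := hs j hj
  refine Runs.le (T₁ := 8 + 8) ?_ (by omega)
  refine .store_seq (by simp [h6', h22', hi, h4]; omega) (.store ?_ ⟨?_, ?_⟩)
  · simp only [eval_sub, eval_const]; omega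
  · intro i hij
    simp only [eval_sub, eval_reg, State.setReg_arr, State.setArr_arr, hi]
    simp only [eval_arr, eval_add, eval_mul, eval_reg, h22', h6', hi, h4]
    rcases (by omega : i < j ∨ i = j) with h | rfl
    · simp [h.ne, hI₁ i h]
    · simp
  · intro i hij
    simp only [eval_sub, eval_reg, State.setReg_arr, State.setArr_arr, hi, if_true]
    simp only [eval_arr, eval_add, eval_mul, eval_reg, eval_eq, eval_const, h22', h6', hi, h4,
      Function.update_apply, State.setArr_arr, State.setArr_reg]
    rcases (by omega : i < j ∨ i = j) with h | rfl
    · simp [h.ne, hI₂ i h]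
    · by_cases h2 : stack m s d i = 2 <;> simp [alive, hj, h2]

/-- Look for a conflict among the alive vertices, where `conf` decides whether the vertices in the
registers `24` and `25` are in conflict. -/
def findConflict (conf : Prog) : Prog :=
  assign 26 (const 0) ;;
  forLoop 24 6 (forLoop 25 6 (
    Prog.cond (arr 6 (reg 24) * arr 6 (reg 25) * (const 1 - Expr.eq (reg 24) (reg 25)))
      (conf ;; Prog.cond (reg 30) (assign 26 (const 1) ;; assign 27 (reg 24) ;; assign 28 (reg 25)) skip)
      skip))

/-- The program `conf` uses only registers and arrays that are free in the main program. -/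
structure Private (conf : Prog) : Prop where
  regs : ∀ x ∈ conf.regs, 30 ≤ x
  arrs : ∀ a ∈ conf.arrs, 7 ≤ a

/-- In all states with the same local graph as `s`, the program `conf` decides the conflicts. -/
def Decides (B : ℕ) (conf : Prog) (bad : Finset ℕ → ℕ → ℕ → Prop) (m Tc : ℕ) (s : State) : Prop :=
  ∀ s' : State, (∀ x, 0 < x → x < 22 → s'.reg x = s.reg x) → s'.arr 3 = s.arr 3 →
    ∀ S ⊆ Finset.range m, (∀ i < m, s'.arr 6 i = if i ∈ S then 1 else 0) →
      s'.reg 24 ∈ S → s'.reg 25 ∈ S → s'.reg 24 ≠ s'.reg 25 →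
      Runs B conf s' Tc fun s'' => (s''.reg 30 ≠ 0 ↔ bad S (s'.reg 24) (s'.reg 25))

theorem Decides.congr {B : ℕ} {conf : Prog} {bad : Finset ℕ → ℕ → ℕ → Prop} {m Tc : ℕ}
    {s s₁ : State} (h : Decides B conf bad m Tc s)
    (hr : ∀ x, 0 < x → x < 22 → s₁.reg x = s.reg x) (ha : s₁.arr 3 = s.arr 3) :
    Decides B conf bad m Tc s₁ := fun s' hr' ha' =>
  h s' (fun x h0 h1 => (hr' x h0 h1).trans (hr x h0 h1)) (ha'.trans ha)

theorem findConflict_regs {conf : Prog} (hp : Private conf) {x : ℕ} (hx : x < 24 ∨ x = 29) :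
    x ∉ (findConflict conf).regs := by
  have : x ∉ conf.regs := fun h => by have := hp.regs x h; omega
  simp [findConflict, Prog.regs, forLoop_regs, this]
  omega

theorem findConflict_arrs {conf : Prog} (hp : Private conf) {a : ℕ} (ha : a < 7) :
    a ∉ (findConflict conf).arrs := by
  have : a ∉ conf.arrs := fun h => by have := hp.arrs a h; omega
  simp [findConflict, Prog.arrs, forLoop_arrs, this]

/-- The loops never stop early, and a later conflict overwrites an earlier one. The invariant only
needs that a recorded pair is a genuine conflict, or that none has been found among the pairs
examined so far. -/
theorem findConflict_runs {B m Tc : ℕ} {conf : Prog} {bad : Finset ℕ → ℕ → ℕ → Prop} {s : State}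
    {S : Finset ℕ} (hp : Private conf) (hc : Decides B conf bad m Tc s) (h6 : s.reg 6 = m)
    (hB : m + 1 ≤ B) (hS : S ⊆ Finset.range m)
    (ha : ∀ i < m, s.arr 6 i = if i ∈ S then 1 else 0) :
    Runs B (findConflict conf) s (2 + (m * ((m * ((Tc + 22) + 8) + 6) + 8) + 6)) fun s' =>
      (s'.reg 26 = 0 ∧ ConflictFree bad S) ∨
      (s'.reg 26 = 1 ∧ s'.reg 27 ∈ S ∧ s'.reg 28 ∈ S ∧ s'.reg 27 ≠ s'.reg 28 ∧
        bad S (s'.reg 27) (s'.reg 28)) := by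
  have hr30 : ∀ x < 30, x ∉ conf.regs := fun x hx h => absurd (hp.regs x h) (by omega)
  have hr7 : ∀ x < 7, x ∉ conf.arrs := fun x hx h => absurd (hp.arrs x h) (by omega)
  let I : (ℕ → ℕ → Prop) → State → Prop := fun done s' =>
    (s'.reg 26 = 0 ∧ ∀ u ∈ S, ∀ w ∈ S, u ≠ w → done u w → ¬ bad S u w) ∨
      (s'.reg 26 = 1 ∧ s'.reg 27 ∈ S ∧ s'.reg 28 ∈ S ∧ s'.reg 27 ≠ s'.reg 28 ∧
        bad S (s'.reg 27) (s'.reg 28))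
  have hI : ∀ {done done' : ℕ → ℕ → Prop} {s₁ s₂ : State}, I done s₁ →
      (∀ u < m, ∀ w < m, done' u w → done u w) →
      s₂.reg 26 = s₁.reg 26 → s₂.reg 27 = s₁.reg 27 → s₂.reg 28 = s₁.reg 28 → I done' s₂ := by
    intro done done' s₁ s₂ h hd h1 h2 h3
    simp only [I, h1, h2, h3] at h ⊢
    exact h.imp_left fun h => ⟨h.1, fun u hu w hw huw hdw => h.2 u hu w hw huw
      (hd u (Finset.mem_range.1 (hS hu)) w (Finset.mem_range.1 (hS hw)) hdw)⟩
  unfold findConflict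
  refine .assign_seq (by simp) ?_
  refine Runs.forLoop (fun a s' => I (fun u _ => u < a) s') (by simpa using h6) (by omega)
    (by simp [Prog.regs, forLoop_regs, hr30]) (by simp [Prog.regs, forLoop_regs, hr30])
    (.inl ⟨by simp, by simp⟩) ?_ ?_
  · intro u hu s₁ hA₁ hu₁ hI₁
    have h6₁ : s₁.reg 6 = m := by
      rw [hA₁.reg 6 (by simp [Prog.regs, forLoop_regs, hr30])]; simpa using h6
    have ha₁ : s₁.arr 6 = s.arr 6 := by
      rw [hA₁.arr 6 (by simp [Prog.arrs, forLoop_arrs, hr7])]; simp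
    have hc₁ : Decides B conf bad m Tc s₁ := by
      refine hc.congr (fun x h0 h1 => ?_) ?_
      · rw [hA₁.reg _ ?_]
        · simp; omega
        · have := hr30 x (by omega)
          simp [Prog.regs, forLoop_regs, this]; omega
      · rw [hA₁.arr 3 (by simp [Prog.arrs, forLoop_arrs, hr7])]; simp
    clear hA₁
    refine Runs.forLoop (fun b s' => I (fun u' w => u' < u ∨ u' = u ∧ w < b) s') h6₁ (by omega)
      (by simp [Prog.regs, hr30]) (by simp [Prog.regs, hr30])
      (hI hI₁ (by omega) (by simp) (by simp) (by simp)) ?_ ?_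
    · intro w hw s₂ hA₂ hw₂ hI₂
      have h24 : s₂.reg 24 = u := by
        rw [hA₂.reg 24 (by simp [Prog.regs, forLoop_regs, hr30])]; exact hu₁
      have ha₂ : s₂.arr 6 = s.arr 6 := by
        rw [hA₂.arr 6 (by simp [Prog.arrs, hr7]), ha₁]
      have hc₂ : Decides B conf bad m Tc s₂ := by
        refine hc₁.congr (fun x h0 h1 => ?_) (hA₂.arr _ (by simp [Prog.arrs, hr7]))
        refine hA₂.reg _ ?_
        have := hr30 x (by omega)
        simp [Prog.regs, forLoop_regs, this]; omega
      have hdone : ∀ {s'}, I (fun u' w' => u' < u ∨ u' = u ∧ w' < w ∨ u' = u ∧ w' = w) s' →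
          I (fun u' w' => u' < u ∨ u' = u ∧ w' < w + 1) (s'.setReg 25 (w + 1)) := fun h =>
        hI h (by omega) (by simp) (by simp) (by simp)
      refine Runs.le (T₁ := 11 + 1 + ((Tc + (1 + 1 + ((2 + (2 + 2)) + 1))) + 1)) ?_ (by omega)
      refine .cond (fun h => ?_) (fun h => .skip (hdone ?_))
      · simp only [eval_mul, eval_arr, eval_reg, eval_sub, eval_const, eval_eq, h24, hw₂, ha₂,
          ne_eq, mul_eq_zero, not_or, ha u hu, ha w hw] at h
        have huS : u ∈ S := by by_contra h'; simp [h'] at h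
        have hwS : w ∈ S := by by_contra h'; simp [h'] at h
        have huw : u ≠ w := by intro h'; simp [h'] at h
        refine (hc₂ s₂ (fun _ _ _ => rfl) rfl S hS (by rw [ha₂]; exact ha) (h24 ▸ huS)
          (hw₂ ▸ hwS) (by rw [h24, hw₂]; exact huw)).andThen fun s₃ hA₃ h₃ => ?_
        rw [h24, hw₂] at h₃
        have h24' : s₃.reg 24 = u := (hA₃.reg _ (hr30 _ (by omega))).trans h24
        have h25' : s₃.reg 25 = w := (hA₃.reg _ (hr30 _ (by omega))).trans hw₂
        refine .cond (fun hb => ?_) (fun hb => .skip (hdone ?_))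
        · have hbad := h₃.1 hb
          refine .assign_seq (by simp; omega) (.assign_seq (by simp; omega)
            (.assign (by simp; omega) (.inr ?_)))
          simp [h24', h25', huS, hwS, huw, hbad]
        · have hbad : ¬ bad S u w := fun h => h₃.2 h hb
          have := hI hI₂ (s₂ := s₃) (fun _ _ _ _ h => h) (hA₃.reg _ (hr30 _ (by omega)))
            (hA₃.reg _ (hr30 _ (by omega))) (hA₃.reg _ (hr30 _ (by omega)))
          refine this.imp_left fun h => ⟨h.1, fun u' hu' w' hw' huw' hd => ?_⟩
          rcases hd with hd | hd | ⟨rfl, rfl⟩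
          · exact h.2 u' hu' w' hw' huw' (.inl hd)
          · exact h.2 u' hu' w' hw' huw' (.inr hd)
          · exact hbad
      · refine hI₂.imp_left fun h' => ⟨h'.1, fun u' hu' w' hw' huw' hd => ?_⟩
        rcases hd with hd | hd | ⟨rfl, rfl⟩
        · exact h'.2 u' hu' w' hw' huw' (.inl hd)
        · exact h'.2 u' hu' w' hw' huw' (.inr hd)
        · simp [h24, hw₂, ha₂, ha _ hu, ha _ hw, hu', hw', huw'] at h
    · intro s₂ _ h
      exact hI h (by omega) (by simp) (by simp) (by simp)
  · intro s₁ _ h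
    exact h.imp_left fun h => ⟨h.1, fun u hu w hw huw =>
      h.2 u hu w hw huw (Finset.mem_range.1 (hS hu))⟩

end TwoClub

/-! ### Branching: pushing status vectors and processing one stack entry -/

namespace TwoClub

open RAM RAM.Expr RAM.Prog

/-- Copy the status vector in array `5` to the top of the stack. -/
def copyTop : Prog := forLoop 23 6 (store 4 (reg 22 * reg 6 + reg 23) (arr 5 (reg 23)))

theorem copyTop_runs {B m d : ℕ} {s : State} (h6 : s.reg 6 = m) (h22 : s.reg 22 = d)
    (hs : ∀ i < m, s.arr 5 i ≤ 2) (hB : m + 2 ≤ B) :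
    Runs B copyTop s (m * (8 + 8) + 6) fun s' =>
      (∀ e < d, ∀ i < m, stack m s' e i = stack m s e i) ∧
      ∀ i < m, stack m s' d i = s.arr 5 i := by
  refine Runs.forLoop (fun j s' => (∀ e < d, ∀ i < m, stack m s' e i = stack m s e i) ∧
      ∀ i < j, stack m s' d i = s.arr 5 i) h6 (by omega) (by decide)
      (by decide) (by simp [stack]) ?_ fun s' _ h => h
  rintro j hj s' hA hi ⟨hI₁, hI₂⟩
  have h6' : s'.reg 6 = m := by rw [hA.reg _ (by decide)]; exact h6
  have h22' : s'.reg 22 = d := by rw [hA.reg _ (by decide)]; exact h22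
  have h5 : s'.arr 5 = s.arr 5 := by rw [hA.arr _ (by decide)]
  have hsj := hs j hj
  have key : ∀ e, ∀ i < m, stack m (((s'.setArr 4 (d * m + j) (s.arr 5 j))).setReg 23 (j + 1)) e i =
      if e = d ∧ i = j then s.arr 5 j else stack m s' e i := by
    intro e i hi
    simp only [stack, State.setReg_arr, State.setArr_arr, if_true]
    exact update_mul_add _ hj hi
  refine .store (by simp [hi, h5]; omega) ?_
  simp only [eval_arr, eval_add, eval_mul, eval_reg, h22', h6', hi, h5]
  refine ⟨fun e he i hi => ?_, fun i hij => ?_⟩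
  · rw [key e i hi, if_neg (by omega), hI₁ e he i hi]
  · rw [key d i (by omega)]
    split_ifs with h
    · rw [h.2]
    · exact hI₂ i (by omega)

/-- The effect of pushing the status vector `f` on a stack of height `d`. -/
structure Pushed (m d : ℕ) (f : ℕ → ℕ) (s s' : State) : Prop where
  height : s'.reg 22 = d + 1
  old : ∀ e < d, ∀ i < m, stack m s' e i = stack m s e i
  new : ∀ i < m, stack m s' d i = f i

/-- Push the current status vector with the vertex in register `27` deleted. -/
def pushDelete : Prog :=
  copyTop ;; store 4 (reg 22 * reg 6 + reg 27) (const 2) ;; assign 22 (reg 22 + const 1)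

theorem pushDelete_runs {B m d u : ℕ} {s : State} (h6 : s.reg 6 = m) (h22 : s.reg 22 = d)
    (h27 : s.reg 27 = u) (hu : u < m)
    (hs : ∀ i < m, s.arr 5 i ≤ 2) (hB : m + 2 ≤ B) (hd : d + 1 ≤ B) :
    Runs B pushDelete s (m * (8 + 8) + 6 + (7 + 4))
      (Pushed m d (Function.update (s.arr 5) u 2) s) := by
  refine (copyTop_runs h6 h22 hs hB).andThen fun s₁ hA₁ ⟨h₁, h₁'⟩ => ?_
  have h6' : s₁.reg 6 = m := by rw [hA₁.reg _ (by decide)]; exact h6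
  have h22' : s₁.reg 22 = d := by rw [hA₁.reg _ (by decide)]; exact h22
  have h27' : s₁.reg 27 = u := by rw [hA₁.reg _ (by decide)]; exact h27
  refine .store_seq (by simp; omega) (.assign (by simp; omega) ?_)
  simp only [eval_add, eval_mul, eval_reg, eval_const, h22', h6', h27', State.setArr_reg]
  have key : ∀ e, ∀ i < m, stack m ((s₁.setArr 4 (d * m + u) 2).setReg 22 (d + 1)) e i =
      if e = d ∧ i = u then 2 else stack m s₁ e i := by
    intro e i hi
    simp only [stack, State.setReg_arr, State.setArr_arr, if_true]
    exact update_mul_add _ hu hi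
  refine ⟨by simp, fun e he i hi => ?_, fun i hi => ?_⟩
  · rw [key e i hi, if_neg (by omega), h₁ e he i hi]
  · rw [key d i hi, Function.update_apply, h₁' i hi]
    simp

/-- Push the current status vector with the vertex in register `27` kept and the one in register
`28` deleted. -/
def pushKeep : Prog :=
  copyTop ;; store 4 (reg 22 * reg 6 + reg 27) (const 1) ;;
  store 4 (reg 22 * reg 6 + reg 28) (const 2) ;; assign 22 (reg 22 + const 1)

theorem pushKeep_runs {B m d u w : ℕ} {s : State} (h6 : s.reg 6 = m) (h22 : s.reg 22 = d)
    (h27 : s.reg 27 = u) (h28 : s.reg 28 = w) (hu : u < m) (hw : w < m)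
    (hs : ∀ i < m, s.arr 5 i ≤ 2) (hB : m + 2 ≤ B) (hd : d + 1 ≤ B) :
    Runs B pushKeep s (m * (8 + 8) + 6 + (7 + (7 + 4)))
      (Pushed m d (Function.update (Function.update (s.arr 5) u 1) w 2) s) := by
  refine (copyTop_runs h6 h22 hs hB).andThen fun s₁ hA₁ ⟨h₁, h₁'⟩ => ?_
  have h6' : s₁.reg 6 = m := by rw [hA₁.reg _ (by decide)]; exact h6
  have h22' : s₁.reg 22 = d := by rw [hA₁.reg _ (by decide)]; exact h22
  have h27' : s₁.reg 27 = u := by rw [hA₁.reg _ (by decide)]; exact h27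
  have h28' : s₁.reg 28 = w := by rw [hA₁.reg _ (by decide)]; exact h28
  refine .store_seq (by simp; omega) (.store_seq (by simp; omega) (.assign (by simp; omega) ?_))
  simp only [eval_add, eval_mul, eval_reg, eval_const, h22', h6', h27', h28', State.setArr_reg]
  have key : ∀ e, ∀ i < m,
      stack m (((s₁.setArr 4 (d * m + u) 1).setArr 4 (d * m + w) 2).setReg 22 (d + 1)) e i =
      if e = d ∧ i = w then 2 else if e = d ∧ i = u then 1 else stack m s₁ e i := by
    intro e i hi
    simp only [stack, State.setReg_arr, State.setArr_arr, if_true]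
    rw [update_mul_add _ hw hi, update_mul_add _ hu hi]
  refine ⟨by simp, fun e he i hi => ?_, fun i hi => ?_⟩
  · rw [key e i hi, if_neg (by omega), if_neg (by omega), h₁ e he i hi]
  · rw [key d i hi, Function.update_apply, Function.update_apply, h₁' i hi]
    simp

/-- Count the alive vertices in register `29`. -/
def countAlive : Prog :=
  assign 29 (const 0) ;; forLoop 23 6 (assign 29 (reg 29 + arr 6 (reg 23)))

theorem countAlive_runs {B m : ℕ} {s : State} {S : Finset ℕ} (h6 : s.reg 6 = m)
    (hS : S ⊆ Finset.range m) (ha : ∀ i < m, s.arr 6 i = if i ∈ S then 1 else 0) (hB : m ≤ B) :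
    Runs B countAlive s (2 + (m * (5 + 8) + 6)) fun s' => s'.reg 29 = S.card := by
  refine .assign_seq (by simp) ?_
  refine Runs.forLoop (fun j s' => s'.reg 29 = (S.filter (· < j)).card) (by simpa using h6) hB
    (by decide) (by decide) (by simp) ?_ ?_
  · intro j hj s' hA hi hI
    have h6' : s'.arr 6 j = if j ∈ S then 1 else 0 := by
      rw [hA.arr _ (by decide)]; simpa using ha j hj
    have hsucc : (S.filter (· < j + 1)).card =
        (S.filter (· < j)).card + if j ∈ S then 1 else 0 := by
      by_cases h : j ∈ S
      · have : S.filter (· < j + 1) = insert j (S.filter (· < j)) := by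
          ext x; simp only [Finset.mem_filter, Finset.mem_insert]; grind
        rw [this, Finset.card_insert_of_notMem (by simp)]
        simp [h]
      · have : S.filter (· < j + 1) = S.filter (· < j) := by
          ext x; simp only [Finset.mem_filter]; grind
        rw [this]; simp [h]
    have hle : (S.filter (· < j + 1)).card ≤ m :=
      (Finset.card_le_card ((Finset.filter_subset _ _).trans hS)).trans (by simp)
    refine .assign ?_ ?_
    · simp only [eval_add, eval_reg, eval_arr, hi, hI, h6']; omega
    · simp only [eval_add, eval_reg, eval_arr, hi, hI, h6', hsucc]; simp
  · intro s' _ hI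
    rw [hI, Finset.filter_true_of_mem fun x hx => Finset.mem_range.1 (hS hx)]

/-- Process the top entry of the stack. -/
def searchStep (conf : Prog) : Prog :=
  assign 22 (reg 22 - const 1) ;; loadTop ;; findConflict conf ;;
  Prog.cond (reg 26)
    (Prog.cond (Expr.eq (arr 5 (reg 27)) (const 0)) pushDelete skip ;;
      Prog.cond (Expr.eq (arr 5 (reg 28)) (const 0)) pushKeep skip)
    (countAlive ;; Prog.cond (Expr.lt (reg 29) (reg 4)) skip (assign 0 (const 1)))

/-- The invariant of the search: the potential is `P`, and `goal` holds if and only if the answer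
has been found or some stack entry leads to it. -/
structure SearchInv (bad : Finset ℕ → ℕ → ℕ → Prop) (K m : ℕ) (goal : Prop) (P : ℕ) (s : State) :
    Prop where
  ok : StackOk m (stack m s) (s.reg 22)
  pot : potential m (stack m s) (s.reg 22) = P
  ans : s.reg 0 = 0 ∨ s.reg 0 = 1
  goal_iff : goal ↔ s.reg 0 = 1 ∨ StackExtendable bad K m (stack m s) (s.reg 22)

theorem searchStep_regs {conf : Prog} (hp : Private conf) {x : ℕ} (hx : x < 22) (h0 : x ≠ 0) :
    x ∉ (searchStep conf).regs := by
  have h₁ := findConflict_regs hp (.inl (by omega : x < 24))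
  have h₂ : ∀ y ∈ loadTop.regs ++ pushDelete.regs ++ pushKeep.regs ++ countAlive.regs, 22 ≤ y := by
    decide
  have h₃ : x ∉ loadTop.regs ++ pushDelete.regs ++ pushKeep.regs ++ countAlive.regs := fun h =>
    absurd (h₂ x h) (by omega)
  simp only [List.mem_append, not_or] at h₃
  simp only [searchStep, Prog.regs, List.mem_append, not_or, h₁, h₃, List.mem_singleton,
    List.not_mem_nil]
  simp [h0]
  omega

theorem searchStep_arrs {conf : Prog} (hp : Private conf) {a : ℕ} (ha : a < 4) :
    a ∉ (searchStep conf).arrs := by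
  have h₁ := findConflict_arrs hp (by omega : a < 7)
  have h₂ : ∀ y ∈ loadTop.arrs ++ pushDelete.arrs ++ pushKeep.arrs ++ countAlive.arrs, 4 ≤ y := by
    decide
  have h₃ : a ∉ loadTop.arrs ++ pushDelete.arrs ++ pushKeep.arrs ++ countAlive.arrs := fun h =>
    absurd (h₂ a h) (by omega)
  simp only [List.mem_append, not_or] at h₃
  simp [searchStep, Prog.arrs, h₁, h₃]

/-- The tree size of the popped entry pays for the entries pushed in its place. With both vertices
undecided the recurrence of `treeSize` leaves exactly one unit over; with at most one push, strict
monotonicity suffices; at a leaf nothing is pushed, and the popped tree size is positive. -/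
theorem searchStep_runs {B K m P Tc : ℕ} {conf : Prog} {bad : Finset ℕ → ℕ → ℕ → Prop} {s : State}
    {goal : Prop} (hp : Private conf) (hbad : Hereditary bad) (hc : Decides B conf bad m Tc s)
    (h6 : s.reg 6 = m) (h4 : s.reg 4 = K) (hB : m + 2 ≤ B) (hI : SearchInv bad K m goal P s)
    (h22 : s.reg 22 ≠ 0) :
    Runs B (searchStep conf) s
      (m * (m * ((Tc + 22) + 8) + 14) + 100 * m + 100)
      fun s' => ∃ P' < P, SearchInv bad K m goal P' s' := by
  obtain ⟨d, hd⟩ : ∃ d, s.reg 22 = d + 1 := ⟨s.reg 22 - 1, by omega⟩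
  obtain ⟨hok, hpot, hans, hgoal⟩ := hI
  rw [hd] at hok hpot hgoal
  rw [stackOk_succ] at hok
  rw [potential_succ] at hpot
  rw [stackExtendable_succ] at hgoal
  set f := stack m s d with hf
  obtain ⟨hok, hund, hf2⟩ := hok
  refine Runs.le (T₁ := 4 + ((m * (25 + 8) + 6) + ((2 + (m * ((m * ((Tc + 22) + 8) + 6) + 8) + 6)) +
    (1 + 1 + (((4 + 1 + (m * (8 + 8) + 6 + (7 + 4) + 1)) +
      (4 + 1 + (m * (8 + 8) + 6 + (7 + (7 + 4)) + 1))) +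
      ((2 + (m * (5 + 8) + 6)) + (3 + 1 + (1 + 2)))))))) ?_ (by ring_nf; omega)
  refine .assign_seq (by simp; have := undecided_le m f; omega) ?_
  refine (loadTop_runs (d := d) (by simpa using h6) (by simp [hd]) (by exact hf2) hB).andThen ?_
  rintro s₁ hA₁ ⟨h5, ha⟩
  have h6₁ : s₁.reg 6 = m := by rw [hA₁.reg _ (by decide)]; simpa using h6
  have h4₁ : s₁.reg 4 = K := by rw [hA₁.reg _ (by decide)]; simpa using h4
  have h0₁ : s₁.reg 0 = s.reg 0 := by rw [hA₁.reg _ (by decide)]; simp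
  have h22₁ : s₁.reg 22 = d := by rw [hA₁.reg _ (by decide)]; simp [hd]
  have hst₁ : stack m s₁ = stack m s := by unfold stack; rw [hA₁.arr _ (by decide)]; simp
  have hc₁ : Decides B conf bad m Tc s₁ := by
    refine hc.congr (fun x h0 h1 => ?_) ?_
    · rw [hA₁.reg x ?_]
      · simp; omega
      · have : ∀ y ∈ loadTop.regs, 22 ≤ y := by decide
        exact fun h => absurd (this x h) (by omega)
    · rw [hA₁.arr _ (by decide)]; simp
  replace ha : ∀ i < m, s₁.arr 6 i = if i ∈ alive m f then 1 else 0 := ha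
  replace h5 : ∀ i < m, s₁.arr 5 i = f i := h5
  clear hA₁
  refine (findConflict_runs hp hc₁ h6₁ (by omega) (alive_subset m f) ha).andThen ?_
  intro s₂ hA₂ hcases
  have h6₂ : s₂.reg 6 = m := by rw [hA₂.reg 6 (findConflict_regs hp (by omega))]; exact h6₁
  have h4₂ : s₂.reg 4 = K := by rw [hA₂.reg 4 (findConflict_regs hp (by omega))]; exact h4₁
  have h0₂ : s₂.reg 0 = s.reg 0 := by
    rw [hA₂.reg 0 (findConflict_regs hp (by omega))]; exact h0₁
  have h22₂ : s₂.reg 22 = d := by rw [hA₂.reg 22 (findConflict_regs hp (by omega))]; exact h22₁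
  have hst₂ : stack m s₂ = stack m s := by
    rw [← hst₁]; unfold stack; rw [hA₂.arr 4 (findConflict_arrs hp (by omega))]
  have h5₂ : ∀ i < m, s₂.arr 5 i = f i := by
    rw [hA₂.arr 5 (findConflict_arrs hp (by omega))]; exact h5
  have ha₂ : ∀ i < m, s₂.arr 6 i = if i ∈ alive m f then 1 else 0 := by
    rw [hA₂.arr 6 (findConflict_arrs hp (by omega))]; exact ha
  clear hA₂ hst₁ h22₁ h0₁ h4₁ h6₁ hc₁ ha h5
  have hTpos := treeSize_pos (undecided m f)
  refine .cond (fun h => ?_) (fun h => ?_)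
  · simp only [eval_reg] at h
    obtain ⟨-, hu, hw, huw, hbuw⟩ := hcases.resolve_left fun h' => h h'.1
    generalize hu₂ : s₂.reg 27 = u at *
    generalize hw₂ : s₂.reg 28 = w at *
    have hum : u < m := Finset.mem_range.1 (alive_subset m f hu)
    have hwm : w < m := Finset.mem_range.1 (alive_subset m f hw)
    have hbr := extendable_branch (K := K) hbad hu hw huw hbuw
    have hund1 := fun h0 : f u = 0 => undecided_update (c := 2) hum h0 (by decide)
    have hund2 := fun h0 : f w = 0 => undecided_update (f := Function.update f u 1) (c := 2) hwm
      (by rw [Function.update_of_ne huw.symm]; exact h0) (by decide)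
    have hund3 := fun h0 : f u = 0 => undecided_update (c := 1) hum h0 (by decide)
    have hund4 : undecided m (Function.update f u 1) ≤ undecided m f :=
      undecided_update_le (by decide)
    have h5le : ∀ i < m, s₂.arr 5 i ≤ 2 := fun i hi => by rw [h5₂ i hi]; exact hf2 i hi
    have hcongr1 : ∀ i < m, Function.update (s₂.arr 5) u 2 i = Function.update f u 2 i := by
      intro i hi
      simp only [Function.update_apply, h5₂ i hi]
    have hle1 : ∀ i < m, Function.update f u 2 i ≤ 2 := by
      intro i hi
      rw [Function.update_apply]; split_ifs; exacts [le_rfl, hf2 i hi]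
    have hle2 : ∀ i < m, Function.update (Function.update f u 1) w 2 i ≤ 2 := by
      intro i hi
      rw [Function.update_apply, Function.update_apply]; split_ifs
      exacts [le_rfl, by decide, hf2 i hi]
    -- This assertion holds between the two optional pushes: the height and the potential depend on
    -- whether the branch deleting `u` was pushed.
    refine Runs.seq (Q := _) ((Runs.cond (Q := fun s₃ => s₃.reg 22 = (if f u = 0 then d + 1 else d) ∧
      StackOk m (stack m s₃) (s₃.reg 22) ∧
      potential m (stack m s₃) (s₃.reg 22) = potential m (stack m s) d +
        (if f u = 0 then treeSize (undecided m (Function.update f u 2)) else 0) ∧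
      (StackExtendable bad K m (stack m s₃) (s₃.reg 22) ↔
        StackExtendable bad K m (stack m s) d ∨
        (f u = 0 ∧ Extendable bad K m (Function.update f u 2)))) ?_ ?_).post ?_)
    · intro hb
      have hfu : f u = 0 := by
        by_contra h'; simp [hu₂, h5₂ u hum, h'] at hb
      refine (pushDelete_runs h6₂ h22₂ hu₂ hum h5le hB (by omega)).post ?_
      rintro s₃ - ⟨hh, hold, hnew⟩
      replace hnew : ∀ i < m, stack m s₃ d i = Function.update f u 2 i := fun i hi =>
        (hnew i hi).trans (hcongr1 i hi)
      rw [hst₂] at hold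
      have := hund1 hfu
      rw [hh, stackOk_succ, potential_succ, stackExtendable_succ, potential_congr hold,
        stackExtendable_congr hold, undecided_congr hnew, extendable_congr hnew]
      simp only [hfu, if_true, true_and]
      refine ⟨⟨stackOk_congr hold hok, by omega, fun i hi => ?_⟩, trivial⟩
      rw [hnew i hi]; exact hle1 i hi
    · intro hb
      have hfu : f u ≠ 0 := by
        intro h'; simp [hu₂, h5₂ u hum, h'] at hb
      refine .skip ?_
      simp [h22₂, hst₂, hok, hfu]
    · rintro s₃ hA₃ ⟨hd₃, hok₃, hpot₃, hext₃⟩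
      have hcr : ∀ x ∈ [0, 6, 27, 28], x ∉ pushDelete.regs ++ skip.regs := by decide
      have h6₃ : s₃.reg 6 = m := (hA₃.reg 6 (hcr _ (by decide))).trans h6₂
      have h0₃ : s₃.reg 0 = s.reg 0 := (hA₃.reg 0 (hcr _ (by decide))).trans h0₂
      have hu₃ : s₃.reg 27 = u := (hA₃.reg 27 (hcr _ (by decide))).trans hu₂
      have hw₃ : s₃.reg 28 = w := (hA₃.reg 28 (hcr _ (by decide))).trans hw₂
      have hst5 : s₃.arr 5 = s₂.arr 5 := hA₃.arr 5 (by decide)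
      have h5₃ : ∀ i < m, s₃.arr 5 i = f i := by rw [hst5]; exact h5₂
      have h5le₃ : ∀ i < m, s₃.arr 5 i ≤ 2 := by rw [hst5]; exact h5le
      clear hA₃
      generalize hd₃' : s₃.reg 22 = d₃ at *
      have hcongr2 : ∀ i < m, Function.update (Function.update (s₃.arr 5) u 1) w 2 i =
          Function.update (Function.update f u 1) w 2 i := by
        intro i hi
        simp only [Function.update_apply, h5₃ i hi]
      -- If both branches are pushed, the second sits one level higher but has two undecided
      -- vertices fewer. Thus height plus undecided vertices never exceeds `m`, which keeps the
      -- stack pointer within a machine word.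
      have hbound : f w = 0 →
          undecided m (Function.update (Function.update f u 1) w 2) + d₃ ≤ m := fun hfw => by
        have := hund2 hfw
        by_cases hfu : f u = 0
        · have := hund3 hfu
          rw [if_pos hfu] at hd₃; omega
        · rw [if_neg hfu] at hd₃; omega
      have hd₃m : d₃ ≤ d + 1 := by rw [hd₃]; split_ifs <;> omega
      have hdm : d ≤ m := by omega
      refine .cond (fun hb => ?_) (fun hb => .skip ⟨_, ?_, ?_, rfl, ?_, ?_⟩)
      · have hfw : f w = 0 := by
          by_contra h'; simp [hw₃, h5₃ w hwm, h'] at hb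
        refine (pushKeep_runs h6₃ hd₃' hu₃ hw₃ hum hwm h5le₃ hB (by omega)).post ?_
        rintro s₄ hA₄ ⟨hh, hold, hnew⟩
        have h0₄ : s₄.reg 0 = s.reg 0 := by rw [hA₄.reg 0 (by decide)]; exact h0₃
        replace hnew := fun i hi => (hnew i hi).trans (hcongr2 i hi)
        refine ⟨_, ?_, ?_, rfl, ?_, ?_⟩
        · rw [hh, potential_succ, potential_congr hold, hpot₃, undecided_congr hnew, ← hpot]
          have h2 := hund2 hfw
          by_cases hfu : f u = 0
          · have h1 := hund1 hfu
            have h3 := hund3 hfu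
            rw [if_pos hfu]
            -- Both `u` and `w` are undecided here, so the recurrence applies with children of sizes
            -- `μ + 1` and `μ`.
            obtain ⟨μ, hμ⟩ : ∃ μ, undecided m f = μ + 2 := ⟨undecided m f - 2, by omega⟩
            rw [(by omega : undecided m (Function.update (Function.update f u 1) w 2) = μ),
              (by omega : undecided m (Function.update f u 2) = μ + 1), hμ, treeSize]
            omega
          · rw [if_neg hfu]
            have := treeSize_mono (by omega :
              undecided m (Function.update (Function.update f u 1) w 2) + 1 ≤ undecided m f)
            have := treeSize_lt_succ (undecided m (Function.update (Function.update f u 1) w 2))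
            omega
        · rw [hh, stackOk_succ, undecided_congr hnew]
          refine ⟨stackOk_congr hold hok₃, hbound hfw, fun i hi => ?_⟩
          rw [hnew i hi]; exact hle2 i hi
        · rw [h0₄]; exact hans
        · rw [hgoal, hbr, h0₄, hh, stackExtendable_succ, stackExtendable_congr hold, hext₃,
            extendable_congr hnew]
          simp only [hfw, true_and, or_assoc]
      · rw [hd₃', hpot₃, ← hpot]
        by_cases hfu : f u = 0
        · have h1 := hund1 hfu
          rw [if_pos hfu, ← h1]
          have := treeSize_lt_succ (undecided m (Function.update f u 2))
          omega
        · rw [if_neg hfu]; omega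
      · rw [hd₃']; exact hok₃
      · rw [h0₃]; exact hans
      · have hfw : f w ≠ 0 := by
          intro h'; simp [hw₃, h5₃ w hwm, h'] at hb
        rw [hgoal, hbr, h0₃, hd₃', hext₃]
        simp only [hfw, false_and, or_false]
  · simp only [eval_reg] at h
    obtain ⟨-, hcf⟩ := hcases.resolve_right fun h' => by omega
    have hex := extendable_of_conflictFree (K := K) hcf
    refine (countAlive_runs h6₂ (alive_subset m f) ha₂ (by omega)).andThen ?_
    intro s₃ hA₃ h29
    have h4₃ : s₃.reg 4 = K := (hA₃.reg 4 (by decide)).trans h4₂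
    have h0₃ : s₃.reg 0 = s.reg 0 := (hA₃.reg 0 (by decide)).trans h0₂
    have h22₃ : s₃.reg 22 = d := (hA₃.reg 22 (by decide)).trans h22₂
    have hst₃ : stack m s₃ = stack m s := by
      rw [← hst₂]; unfold stack; rw [hA₃.arr 4 (by decide)]
    refine .cond (fun hb => .skip ⟨_, ?_, ?_, rfl, ?_, ?_⟩)
      (fun hb => .assign (by simp; omega) ⟨_, ?_, ?_, rfl, .inr (by simp), ?_⟩)
    · rw [h22₃, hst₃]; omega
    · rw [h22₃, hst₃]; exact hok
    · rw [h0₃]; exact hans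
    · have : ¬ K ≤ (alive m f).card := by
        intro h'; simp [h4₃, h29] at hb; omega
      rw [hgoal, hex, h0₃, h22₃, hst₃]
      simp only [this, or_false]
    · have : stack m (s₃.setReg 0 ((const 1).eval s₃)) = stack m s := by rw [← hst₃]; rfl
      rw [this]
      simp only [State.setReg_reg, h22₃]
      simp; omega
    · have : stack m (s₃.setReg 0 ((const 1).eval s₃)) = stack m s := by rw [← hst₃]; rfl
      rw [this]
      simpa [h22₃] using hok
    · have : K ≤ (alive m f).card := by
        by_contra h'; simp [h4₃, h29] at hb; omega
      rw [hgoal, hex]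
      simp [this]

end TwoClub

/-! ### The complete search in one ball and over all balls -/

namespace TwoClub

open RAM RAM.Expr RAM.Prog

/-- Search for a large conflict-free set of vertices of the local graph. -/
def searchProg (conf : Prog) : Prog :=
  assign 22 (const 1) ;; forLoop 23 6 (store 4 (reg 23) (const 0)) ;;
  Prog.loop (reg 22) (searchStep conf)

theorem searchProg_regs {conf : Prog} (hp : Private conf) {x : ℕ} (hx : x < 22) (h0 : x ≠ 0) :
    x ∉ (searchProg conf).regs := by
  have := searchStep_regs hp hx h0
  simp [searchProg, Prog.regs, forLoop_regs, this]
  omega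

theorem searchProg_arrs {conf : Prog} (hp : Private conf) {a : ℕ} (ha : a < 4) :
    a ∉ (searchProg conf).arrs := by
  have := searchStep_arrs hp ha
  simp [searchProg, Prog.arrs, forLoop_arrs, this]
  omega

/-- The time for processing one stack entry. -/
def stepTime (Tc m : ℕ) : ℕ := m * (m * ((Tc + 22) + 8) + 14) + 100 * m + 100

/-- The time for the search in a local graph. -/
def searchTime (Tc m : ℕ) : ℕ :=
  2 + (m * (3 + 8) + 6 + (treeSize m * (stepTime Tc m + 1 + 1) + (1 + 1)))

/-- The stack starts with one fully undecided entry, so `treeSize m` bounds the number of rounds; on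
the empty stack the invariant leaves register `0` as the only witness. That register is only ever
set to `1`, so answers accumulate over successive balls. -/
theorem searchProg_runs {B K m Tc : ℕ} {conf : Prog} {bad : Finset ℕ → ℕ → ℕ → Prop} {s : State}
    (hp : Private conf) (hbad : Hereditary bad) (hc : Decides B conf bad m Tc s)
    (h6 : s.reg 6 = m) (h4 : s.reg 4 = K) (hB : m + 2 ≤ B) (h0 : s.reg 0 = 0 ∨ s.reg 0 = 1) :
    Runs B (searchProg conf) s (searchTime Tc m) fun s' => (s'.reg 0 = 0 ∨ s'.reg 0 = 1) ∧
      (s'.reg 0 = 1 ↔ s.reg 0 = 1 ∨ ∃ S ⊆ Finset.range m, ConflictFree bad S ∧ K ≤ S.card) := by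
  refine .assign_seq (by simp; omega) (.seq ?_)
  refine Runs.forLoop (fun j s' => ∀ i < j, s'.arr 4 i = 0) (by simpa using h6) (by omega)
    (by decide) (by decide) (by simp) ?_ ?_
  · intro j hj s₁ hA hi hI
    refine .store (by simp) fun i hij => ?_
    simp only [eval_reg, eval_const, hi, State.setReg_arr, State.setArr_arr, if_true,
      Function.update_apply]
    split_ifs with h
    · rfl
    · exact hI i (by omega)
  · intro s₁ hA hI
    have h6₁ : s₁.reg 6 = m := by rw [hA.reg 6 (by decide)]; simpa using h6
    have h4₁ : s₁.reg 4 = K := by rw [hA.reg 4 (by decide)]; simpa using h4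
    have h0₁ : s₁.reg 0 = s.reg 0 := by rw [hA.reg 0 (by decide)]; simp
    have h22₁ : s₁.reg 22 = 1 := by rw [hA.reg 22 (by decide)]; simp
    have hc₁ : Decides B conf bad m Tc s₁ := by
      refine hc.congr (fun x h0 h1 => ?_) ?_
      · rw [hA.reg x (by rw [forLoop_regs]; simp [Prog.regs]; omega)]
        simp; omega
      · rw [hA.arr 3 (by decide)]; simp
    have hst : ∀ i < m, stack m s₁ 0 i = 0 := fun i hi => by simpa [stack] using hI i hi
    have hund : undecided m (stack m s₁ 0) = m := by
      rw [undecided_congr (f' := fun _ => 0) hst]; simp [undecided]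
    clear hA hc
    refine (Runs.loop (c := stepTime Tc m) (j := treeSize m)
      (SearchInv bad K m (s.reg 0 = 1 ∨ ∃ S ⊆ Finset.range m, ConflictFree bad S ∧ K ≤ S.card))
      ⟨?_, ?_, ?_, ?_⟩ ?_).post ?_
    · rw [h22₁]
      intro e he
      obtain rfl : e = 0 := by omega
      exact ⟨hund.le, fun i hi => by rw [hst i hi]; omega⟩
    · simp [h22₁, potential, hund]
    · rw [h0₁]; exact h0
    · rw [h0₁, h22₁, ← extendable_zero (m := m)]
      simp [StackExtendable, extendable_congr (bad := bad) (K := K) (f' := fun _ => 0) hst]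
    · intro j s₂ hA₂ hI₂ hb
      refine searchStep_runs hp hbad (hc₁.congr (fun x h0 h1 => hA₂.reg x
        (searchStep_regs hp h1 (by omega))) (hA₂.arr 3 (searchStep_arrs hp (by omega)))) ?_ ?_ hB
        hI₂ hb
      · rw [hA₂.reg 6 (searchStep_regs hp (by omega) (by omega))]; exact h6₁
      · rw [hA₂.reg 4 (searchStep_regs hp (by omega) (by omega))]; exact h4₁
    · rintro s₂ - ⟨⟨P, hI⟩, hb⟩
      refine ⟨hI.ans, ?_⟩
      rw [hI.goal_iff]
      simp only [eval_reg] at hb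
      simp [hb, StackExtendable]

open Classical in
/-- The program `conf` decides, in time `Tc m` on local graphs with `m` vertices, whether the
vertices in registers `24` and `25` are in conflict. -/
def DecidesConflict (conf : Prog) (Tc : ℕ → ℕ)
    (bad : ∀ n : ℕ, SimpleGraph (Fin n) → ℕ → Finset (Fin n) → Fin n → Fin n → Prop) : Prop :=
  ∀ (n : ℕ) (G : SimpleGraph (Fin n)) (t B m : ℕ) (f : ℕ → Fin n) (s : State) (S : Finset ℕ),
    Set.InjOn f (Finset.range m) → 2 * m + t + 4 ≤ B → s.reg 6 = m → s.reg 2 = t →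
    (∀ i < m, ∀ j < m, s.arr 3 (i * m + j) = if G.Adj (f i) (f j) then 1 else 0) →
    S ⊆ Finset.range m → (∀ i < m, s.arr 6 i = if i ∈ S then 1 else 0) →
    s.reg 24 ∈ S → s.reg 25 ∈ S → s.reg 24 ≠ s.reg 25 →
    Runs B conf s (Tc m) fun s' =>
      (s'.reg 30 ≠ 0 ↔ bad n G t (S.image f) (f (s.reg 24)) (f (s.reg 25)))

/-- Search all balls of radius two for a large conflict-free set. -/
def mainProg (conf : Prog) : Prog := forLoop 5 1 (ballProg ;; matrixProg ;; searchProg conf)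

/-- The time for searching one ball, where `D` bounds the degrees and `m` the size of the ball. -/
def vertexTime (Tc : ℕ → ℕ) (D m : ℕ) : ℕ :=
  (D * ((16 * m + 19 + 20 + (D * ((5 + (16 * m + 19)) + 8) + 6)) + 8) + 30) +
    ((m * (12 + (m * ((7 + (D * (17 + 8) + 6)) + 8) + 6) + 8) + 6) + searchTime (Tc m) m)

theorem vertexTime_mono {Tc : ℕ → ℕ} (hTc : Monotone Tc) (D : ℕ) : Monotone (vertexTime Tc D) := by
  intro m m' h
  have h1 := hTc h
  have h2 := treeSize_mono h
  unfold vertexTime searchTime stepTime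
  gcongr

/-- The search works with positions in the list of the ball. As the list has no duplicates, images
and preimages under the position map transport conflict-free sets in both directions and preserve
their size. -/
theorem mainProg_runs {n B D t K : ℕ} {G : SimpleGraph (Fin n)} {adj : Fin n → List (Fin n)}
    {conf : Prog} {Tc : ℕ → ℕ}
    {bad : ∀ n : ℕ, SimpleGraph (Fin n) → ℕ → Finset (Fin n) → Fin n → Fin n → Prop} {s : State}
    (hp : Private conf) (hTc : Monotone Tc) (hc : DecidesConflict conf Tc bad)
    (hbad : Hereditary (bad n G t)) (hadj : IsAdjacencyList G adj)
    (hD : ∀ x, (adj x).length ≤ D) (hG : HoldsGraph adj s) (hoff : ∀ x : Fin n, s.arr 0 x ≤ B)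
    (h0 : s.reg 0 = 0) (h1 : s.reg 1 = n) (h2 : s.reg 2 = t) (h4 : s.reg 4 = K)
    (hB : 2 * n + D + t + 4 ≤ B) :
    Runs B (mainProg conf) s (n * (vertexTime Tc D (D ^ 2 + 1) + 8) + 6) fun s' =>
      (s'.reg 0 = 0 ∨ s'.reg 0 = 1) ∧ (s'.reg 0 = 1 ↔
        ∃ v, ∃ S ⊆ (ballList adj v).toFinset, ConflictFree (bad n G t) S ∧ K ≤ S.card) := by
  classical
  have hbr : ∀ y ∈ ballProg.regs ++ matrixProg.regs, 6 ≤ y ∧ y < 22 := by decide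
  have hba : ∀ y ∈ ballProg.arrs ++ matrixProg.arrs, y = 2 ∨ y = 3 := by decide
  have hreg : ∀ x ∈ [1, 2, 4, 5], x ∉ (ballProg ;; matrixProg ;; searchProg conf).regs := by
    intro x hx h
    simp only [List.mem_cons, List.not_mem_nil, or_false] at hx
    simp only [Prog.regs, ← List.append_assoc] at h
    rcases List.mem_append.1 h with h | h
    · have := hbr x h; omega
    · exact searchProg_regs hp (by omega) (by omega) h
  have harr : ∀ x < 2, x ∉ (ballProg ;; matrixProg ;; searchProg conf).arrs := by
    intro x hx h
    simp only [Prog.arrs, ← List.append_assoc] at h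
    rcases List.mem_append.1 h with h | h
    · have := hba x h; omega
    · exact searchProg_arrs hp (by omega) h
  refine Runs.forLoop (fun j s' => (s'.reg 0 = 0 ∨ s'.reg 0 = 1) ∧ (s'.reg 0 = 1 ↔
      ∃ v : Fin n, v < j ∧ ∃ S ⊆ (ballList adj v).toFinset,
        ConflictFree (bad n G t) S ∧ K ≤ S.card)) h1 (by omega) (hreg 5 (by simp))
    ?_ (by simp [h0]) ?_ ?_
  · simpa using hreg 1 (by simp)
  swap
  · rintro s' - ⟨h, h'⟩
    exact ⟨h, h'.trans (by simp)⟩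
  rintro j hj s₁ hA₁ hj₁ ⟨hans, hI⟩
  have hreg' : ∀ x ∈ [1, 2, 4],
      x ∉ (forLoop 5 1 (ballProg ;; matrixProg ;; searchProg conf)).regs := by
    intro x hx
    have := hreg x (by simp at hx ⊢; omega)
    rw [forLoop_regs]
    simp only [List.mem_cons, List.mem_append, List.not_mem_nil, or_false, this, false_or] at hx ⊢
    omega
  have h2₁ : s₁.reg 2 = t := (hA₁.reg 2 (hreg' 2 (by simp))).trans h2
  have h4₁ : s₁.reg 4 = K := (hA₁.reg 4 (hreg' 4 (by simp))).trans h4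
  have hG₁ : HoldsGraph adj s₁ := hG.congr (hA₁.arr 0 (harr 0 (by omega)))
    (hA₁.arr 1 (harr 1 (by omega)))
  have hoff₁ : ∀ x : Fin n, s₁.arr 0 x ≤ B := by rw [hA₁.arr 0 (harr 0 (by omega))]; exact hoff
  clear hA₁
  obtain ⟨v, rfl⟩ : ∃ v : Fin n, (v : ℕ) = j := ⟨⟨j, hj⟩, rfl⟩
  set m := (ballList adj v).length with hm
  have hmn : m ≤ n := length_ballList_le_card
  refine Runs.le (T₁ := vertexTime Tc D m) ?_ (vertexTime_mono hTc D (length_ballList_le hadj hD v))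
  refine (ballProg_runs hG₁ hj₁ hD hoff₁ (by omega)).andThen fun s₂ hA₂ hl₂ => ?_
  have h0₂ : s₂.reg 0 = s₁.reg 0 := hA₂.reg 0 (by decide)
  have h2₂ : s₂.reg 2 = t := (hA₂.reg 2 (by decide)).trans h2₁
  have h4₂ : s₂.reg 4 = K := (hA₂.reg 4 (by decide)).trans h4₁
  have hG₂ : HoldsGraph adj s₂ := hG₁.congr (hA₂.arr 0 (by decide)) (hA₂.arr 1 (by decide))
  have hoff₂ : ∀ x : Fin n, s₂.arr 0 x ≤ B := by rw [hA₂.arr 0 (by decide)]; exact hoff₁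
  clear hA₂
  refine (matrixProg_runs hG₂ hl₂ hD hoff₂ (by omega)).andThen fun s₃ hA₃ hM₃ => ?_
  have h0₃ : s₃.reg 0 = s₁.reg 0 := (hA₃.reg 0 (by decide)).trans h0₂
  have h2₃ : s₃.reg 2 = t := (hA₃.reg 2 (by decide)).trans h2₂
  have h4₃ : s₃.reg 4 = K := (hA₃.reg 4 (by decide)).trans h4₂
  have h6₃ : s₃.reg 6 = m := (hA₃.reg 6 (by decide)).trans hl₂.length
  clear hA₃
  -- The default value `v` is immaterial: `f` is only evaluated at positions below `m`.
  let f : ℕ → Fin n := fun i => (ballList adj v).getD i v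
  have hf : ∀ i (hi : i < m), f i = (ballList adj v)[i] := fun i hi =>
    List.getD_eq_getElem _ _ hi
  have hinj : Set.InjOn f (Finset.range m) := by
    intro i hi i' hi' h
    simp only [Finset.coe_range, Set.mem_Iio] at hi hi'
    rw [hf i hi, hf i' hi'] at h
    exact (nodup_ballList.getElem_inj_iff).1 h
  have hdec : Decides B conf (fun S u w => bad n G t (S.image f) (f u) (f w)) m (Tc m) s₃ := by
    intro s' hr ha S hS hal hu hw huw
    refine hc n G t B m f s' S hinj (by omega) ((hr 6 (by omega) (by omega)).trans h6₃)
      ((hr 2 (by omega) (by omega)).trans h2₃) (fun i hi k hk => ?_) hS hal hu hw huw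
    rw [ha, hM₃ i k hi hk, hf i hi, hf k hk]
    simp only [(hadj _).2]
  have hher : Hereditary fun (S : Finset ℕ) u w => bad n G t (S.image f) (f u) (f w) :=
    fun S S' hSS u hu w hw h => hbad (Finset.image_subset_image hSS) _
      (Finset.mem_image_of_mem f hu) _ (Finset.mem_image_of_mem f hw) h
  refine (searchProg_runs hp hher hdec h6₃ h4₃ (by omega) (h0₃ ▸ hans)).post ?_
  rintro s₄ - ⟨ha₄, hs₄⟩
  have hloc : (∃ S ⊆ Finset.range m, ConflictFree (fun (S : Finset ℕ) u w =>
      bad n G t (S.image f) (f u) (f w)) S ∧ K ≤ S.card) ↔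
      ∃ S ⊆ (ballList adj v).toFinset, ConflictFree (bad n G t) S ∧ K ≤ S.card := by
    constructor
    · rintro ⟨S, hS, hcf, hK⟩
      refine ⟨S.image f, ?_, ?_, ?_⟩
      · intro x hx
        obtain ⟨i, hi, rfl⟩ := Finset.mem_image.1 hx
        rw [List.mem_toFinset, hf i (Finset.mem_range.1 (hS hi))]
        exact List.getElem_mem _
      · intro x hx y hy hxy
        obtain ⟨i, hi, rfl⟩ := Finset.mem_image.1 hx
        obtain ⟨k, hk, rfl⟩ := Finset.mem_image.1 hy
        exact hcf i hi k hk fun h => hxy (by rw [h])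
      · rwa [Finset.card_image_of_injOn (hinj.mono (by exact_mod_cast hS))]
    · rintro ⟨S, hS, hcf, hK⟩
      have himg : ((Finset.range m).filter fun i => f i ∈ S).image f = S := by
        ext x
        simp only [Finset.mem_image, Finset.mem_filter, Finset.mem_range]
        constructor
        · rintro ⟨i, ⟨-, h⟩, rfl⟩; exact h
        · intro hx
          obtain ⟨i, hi, rfl⟩ := List.getElem_of_mem (List.mem_toFinset.1 (hS hx))
          exact ⟨i, ⟨hi, by rwa [hf i hi]⟩, hf i hi⟩
      refine ⟨(Finset.range m).filter fun i => f i ∈ S, Finset.filter_subset _ _, ?_, ?_⟩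
      · intro u hu w hw huw
        beta_reduce
        rw [himg]
        refine hcf _ (Finset.mem_filter.1 hu).2 _ (Finset.mem_filter.1 hw).2 fun h => huw ?_
        exact hinj (by exact_mod_cast (Finset.mem_filter.1 hu).1)
          (by exact_mod_cast (Finset.mem_filter.1 hw).1) h
      · refine hK.trans ?_
        conv_lhs => rw [← himg]
        exact Finset.card_image_le
  refine ⟨by simpa using ha₄, ?_⟩
  rw [hloc, h0₃, hI] at hs₄
  simp only [State.setReg_reg, if_neg (by decide : (0 : ℕ) ≠ 5), hs₄]
  constructor
  · rintro (⟨x, hx, h⟩ | h)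
    · exact ⟨x, by omega, h⟩
    · exact ⟨v, by omega, h⟩
  · rintro ⟨x, hx, h⟩
    rcases (by omega : (x : ℕ) < v ∨ (x : ℕ) = v) with hxv | hxv
    · exact .inl ⟨x, hxv, h⟩
    · rw [Fin.ext hxv] at h; exact .inr h

end TwoClub

/-! ### Running time -/

namespace TwoClub

open RAM RAM.Expr RAM.Prog

/-- The function is bounded by a polynomial. -/
def PolyBounded (g : ℕ → ℕ) : Prop := ∃ c a : ℕ, ∀ x, g x ≤ c * (x + 1) ^ a

section PolyBounded

variable {g h : ℕ → ℕ}

theorem PolyBounded.const (c : ℕ) : PolyBounded fun _ => c := ⟨c, 0, by simp⟩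

theorem PolyBounded.id : PolyBounded fun x => x := ⟨1, 1, by simp⟩

theorem PolyBounded.add (hg : PolyBounded g) (hh : PolyBounded h) :
    PolyBounded fun x => g x + h x := by
  obtain ⟨c, a, hg⟩ := hg
  obtain ⟨c', a', hh⟩ := hh
  refine ⟨c + c', a + a', fun x => ?_⟩
  have h1 : (x + 1) ^ a ≤ (x + 1) ^ (a + a') := Nat.pow_le_pow_right (by omega) (by omega)
  have h2 : (x + 1) ^ a' ≤ (x + 1) ^ (a + a') := Nat.pow_le_pow_right (by omega) (by omega)
  rw [Nat.add_mul]
  exact Nat.add_le_add ((hg x).trans (Nat.mul_le_mul_left _ h1))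
    ((hh x).trans (Nat.mul_le_mul_left _ h2))

theorem PolyBounded.mul (hg : PolyBounded g) (hh : PolyBounded h) :
    PolyBounded fun x => g x * h x := by
  obtain ⟨c, a, hg⟩ := hg
  obtain ⟨c', a', hh⟩ := hh
  refine ⟨c * c', a + a', fun x => (Nat.mul_le_mul (hg x) (hh x)).trans (le_of_eq ?_)⟩
  ring

theorem PolyBounded.comp (hg : PolyBounded g) (hh : PolyBounded h) :
    PolyBounded fun x => g (h x) := by
  obtain ⟨c, a, hg⟩ := hg
  have h1 : PolyBounded fun x => h x + 1 := hh.add (.const 1)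
  obtain ⟨c', a', h1⟩ := h1
  refine ⟨c * c' ^ a, a' * a, fun x => (hg _).trans ?_⟩
  refine (Nat.mul_le_mul_left c (Nat.pow_le_pow_left (h1 x) a)).trans (le_of_eq ?_)
  rw [mul_pow, pow_mul, mul_assoc]

end PolyBounded

/-- The time for one ball is at most the tree size times a polynomial in `D`. Since `1.6181 / 1.62 <
1`, a polynomial in `x` times the `x`-th power of this ratio stays bounded. -/
theorem exists_vertexTime_le {Tc : ℕ → ℕ} (hTc : PolyBounded Tc) :
    ∃ C : ℝ, 0 ≤ C ∧ ∀ D : ℕ, (vertexTime Tc D (D ^ 2 + 1) : ℝ) ≤ C * 1.62 ^ (D ^ 2) := by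
  have hid := PolyBounded.id
  have hk := PolyBounded.const
  have hM : PolyBounded fun D => D ^ 2 + 1 := by
    simp only [sq]; exact (hid.mul hid).add (hk 1)
  have hTM : PolyBounded fun D => Tc (D ^ 2 + 1) := hTc.comp hM
  obtain ⟨c, a, hP⟩ : PolyBounded fun D =>
      (D * ((16 * (D ^ 2 + 1) + 19 + 20 + (D * ((5 + (16 * (D ^ 2 + 1) + 19)) + 8) + 6)) + 8) + 30) +
      (((D ^ 2 + 1) * (12 + ((D ^ 2 + 1) * ((7 + (D * (17 + 8) + 6)) + 8) + 6) + 8) + 6) +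
      (2 + ((D ^ 2 + 1) * (3 + 8) + 6 + ((((D ^ 2 + 1) * ((D ^ 2 + 1) *
        ((Tc (D ^ 2 + 1) + 22) + 8) + 14) + 100 * (D ^ 2 + 1) + 100) + 1 + 1) + (1 + 1))))) := by
    have h16 := (hk 16).mul hM
    refine ((hid.mul ((((h16.add (hk _)).add (hk _)).add ((hid.mul (((hk _).add
      (h16.add (hk _))).add (hk _))).add (hk _))).add (hk _))).add (hk _)).add
      (((hM.mul (((hk _).add ((hM.mul (((hk _).add ((hid.mul (hk _)).add (hk _))).add (hk _))).add
      (hk _))).add (hk _))).add (hk _)).add ((hk _).add (((hM.mul (hk _)).add (hk _)).add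
      (((((hM.mul ((hM.mul ((hTM.add (hk _)).add (hk _))).add (hk _))).add
      ((hk _).mul hM)).add (hk _)).add (hk _)).add (hk _) |>.add (hk _)))))
  have hW : ∀ D, vertexTime Tc D (D ^ 2 + 1) ≤ treeSize (D ^ 2 + 1) * (c * (D + 1) ^ a) := by
    intro D
    refine le_trans ?_ (Nat.mul_le_mul_left _ (hP D))
    have h1 := treeSize_pos (D ^ 2 + 1)
    unfold vertexTime searchTime stepTime
    generalize treeSize (D ^ 2 + 1) = τ at h1
    have hle : ∀ y : ℕ, y ≤ τ * y := fun y => Nat.le_mul_of_pos_left y h1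
    -- Only `W`, the cost of one search step, is multiplied by the tree size; as `τ ≥ 1`, the factor
    -- may be extended to the other terms.
    have key : ∀ X Y Z W : ℕ, X + (Y + (2 + (Z + (τ * W + (1 + 1))))) ≤
        τ * (X + (Y + (2 + (Z + (W + (1 + 1)))))) := fun X Y Z W => by
      have := hle X
      have := hle Y
      have := hle Z
      simp only [Nat.mul_add]
      omega
    exact key _ _ _ _
  -- The sequence is used shifted by 2, so that its term at `D ^ 2` contains `(D ^ 2 + 2) ^ a`,
  -- which dominates `(D + 1) ^ a`.
  have hlim := tendsto_pow_const_mul_const_pow_of_abs_lt_one (r := (1.6181 / 1.62 : ℝ)) a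
    (by rw [abs_of_pos] <;> norm_num)
  obtain ⟨b, hb⟩ := (hlim.comp (Filter.tendsto_add_atTop_nat 2)).bddAbove_range
  have hr : (0 : ℝ) < 1.6181 / 1.62 := by norm_num
  have hb0 : 0 ≤ b := by
    refine le_trans ?_ (hb ⟨0, rfl⟩)
    simp only [Function.comp]
    positivity
  -- The factor `3` comes from `treeSize_le`, `c` from the polynomial, `1.6181` from the exponent `D
  -- ^ 2 + 1`, and the squared ratio undoes the shift by 2.
  refine ⟨3 * c * b * 1.6181 * (1.62 / 1.6181) ^ 2, by positivity, fun D => ?_⟩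
  have h1 := treeSize_le (D ^ 2 + 1)
  have h2 : ((D : ℝ) + 1) ^ a ≤ ((D ^ 2 + 2 : ℕ) : ℝ) ^ a := by
    have : D + 1 ≤ D ^ 2 + 2 := by nlinarith
    gcongr
    exact_mod_cast this
  have h3 : ((D ^ 2 + 2 : ℕ) : ℝ) ^ a * (1.6181 / 1.62) ^ (D ^ 2 + 2) ≤ b := hb ⟨D ^ 2, rfl⟩
  calc (vertexTime Tc D (D ^ 2 + 1) : ℝ)
      ≤ ((treeSize (D ^ 2 + 1) * (c * (D + 1) ^ a) : ℕ) : ℝ) := by exact_mod_cast hW D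
    _ = (treeSize (D ^ 2 + 1) : ℝ) * (c * (D + 1) ^ a) := by push_cast; ring
    _ ≤ (3 * 1.6181 ^ (D ^ 2 + 1)) * (c * ((D ^ 2 + 2 : ℕ) : ℝ) ^ a) := by
        gcongr
        linarith
    _ = 3 * c * 1.6181 * (1.62 / 1.6181) ^ 2 * 1.62 ^ (D ^ 2) *
        (((D ^ 2 + 2 : ℕ) : ℝ) ^ a * (1.6181 / 1.62) ^ (D ^ 2 + 2)) := by
        rw [div_pow, div_pow, pow_add (1.62 : ℝ), pow_add (1.6181 : ℝ), pow_add (1.6181 : ℝ)]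
        have e1 : (1.62 : ℝ) ^ D ^ 2 ≠ 0 := by positivity
        field_simp
    _ ≤ 3 * c * 1.6181 * (1.62 / 1.6181) ^ 2 * 1.62 ^ (D ^ 2) * b := by gcongr
    _ = _ := by ring

/-! ### The input -/

theorem getD_flatMap {α β : Type*} (L : List α) (g : α → List β) (d : β) (v i : ℕ)
    (hv : v < L.length) (hi : i < (g L[v]).length) :
    (L.flatMap g).getD (((L.take v).map fun x => (g x).length).sum + i) d = (g L[v])[i] := by
  have hL : L.flatMap g = (L.take v).flatMap g ++ (g L[v] ++ (L.drop (v + 1)).flatMap g) := by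
    conv_lhs => rw [← List.take_append_drop v L, List.drop_eq_getElem_cons hv]
    rw [List.flatMap_append, List.flatMap_cons]
  have hlen : ((L.take v).map fun x => (g x).length).sum = ((L.take v).flatMap g).length := by
    simp [List.length_flatMap]
  rw [hL, hlen, List.getD_append_right _ _ _ _ (by omega), Nat.add_sub_cancel_left,
    List.getD_append _ _ _ _ hi, List.getD_eq_getElem _ _ hi]

theorem holdsGraph_inputState {n : ℕ} (adj : Fin n → List (Fin n)) (t k : ℕ) :
    HoldsGraph adj (inputState adj t k) := by
  constructor
  · intro v
    have hv : (v : ℕ) < (List.finRange n).length := by simp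
    simp only [inputState, if_true, if_pos v.2.le, if_pos (by omega : (v : ℕ) + 1 ≤ n)]
    rw [List.take_succ_eq_append_getElem hv]
    simp
  · intro v i hi
    have hv : (v : ℕ) < (List.finRange n).length := by simp
    have hLv : (List.finRange n)[(v : ℕ)] = v := by simp
    have := getD_flatMap (List.finRange n) (fun x => (adj x).map Fin.val) 0 v i hv
      (by simpa [hLv] using hi)
    simp only [inputState, if_true, if_pos v.2.le, if_neg (by decide : (1 : ℕ) ≠ 0),
      List.map_flatMap]
    simp only [List.length_map, List.getElem_map, hLv] at this
    exact this

/-- The program copies offsets into registers, so they must fit into a machine word. This quadratic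
bound is the reason for the exponent 2 in the word size. -/
theorem inputState_offset_le {n : ℕ} {adj : Fin n → List (Fin n)} (hadj : ∀ v, (adj v).Nodup)
    (t k : ℕ) (v : Fin n) : (inputState adj t k).arr 0 v ≤ n * n := by
  simp only [inputState, if_true, if_pos v.2.le]
  refine (List.sum_le_card_nsmul _ n ?_).trans ?_
  · intro x hx
    obtain ⟨y, -, rfl⟩ := List.mem_map.1 hx
    simpa using (hadj y).length_le_card
  · simp only [List.length_map, List.length_take, List.length_finRange, smul_eq_mul]
    exact Nat.mul_le_mul_right n (min_le_right _ _)

/-! ### Reduction to the recognition of conflicts -/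

/-- Vertices at distance more than two are in conflict. -/
def IsLocal {V : Type*} (G : SimpleGraph V) (bad : Finset V → V → V → Prop) : Prop :=
  ∀ (S : Finset V), ∀ u ∈ S, ∀ w ∈ S, u ≠ w → ¬ G.Adj u w →
    (∀ y ∈ S, ¬ (G.Adj u y ∧ G.Adj w y)) → bad S u w

/-- Take any `v` in the solution: a member outside the ball of `v` would be in conflict with `v` by
locality. The empty solution lies in every ball, and `0 < n` provides one. -/
theorem exists_subset_ballList_iff {n K : ℕ} (hn : 0 < n) {G : SimpleGraph (Fin n)}
    {adj : Fin n → List (Fin n)} (hadj : IsAdjacencyList G adj)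
    {bad : Finset (Fin n) → Fin n → Fin n → Prop} (hloc : IsLocal G bad) :
    (∃ v, ∃ S ⊆ (ballList adj v).toFinset, ConflictFree bad S ∧ K ≤ S.card) ↔
      ∃ S, ConflictFree bad S ∧ K ≤ S.card := by
  constructor
  · rintro ⟨v, S, -, h⟩
    exact ⟨S, h⟩
  · rintro ⟨S, hS, hK⟩
    rcases S.eq_empty_or_nonempty with rfl | ⟨v, hv⟩
    · exact ⟨⟨0, hn⟩, ∅, Finset.empty_subset _, hS, hK⟩
    · refine ⟨v, S, fun x hx => ?_, hS, hK⟩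
      simp only [List.mem_toFinset, mem_ballList, (hadj _).2]
      by_contra h
      push Not at h
      refine hS v hv x hx (Ne.symm h.1) (hloc S v hv x hx (Ne.symm h.1) (fun h' => ?_) ?_)
      · exact (h.2 x h').1 rfl
      · rintro y - ⟨h1, h2⟩
        exact (h.2 y h1).2 h2.symm

/-- This reduces each problem to a polynomial-time conflict test. The expression `e` computes the
target size, and locality is required only for the input at hand because it fails for robust 2-clubs
with `t = 0`. -/
theorem exists_exec_of_decidesConflict {conf : Prog} {Tc : ℕ → ℕ}
    {bad : ∀ n : ℕ, SimpleGraph (Fin n) → ℕ → Finset (Fin n) → Fin n → Fin n → Prop}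
    (hp : Private conf) (hTc : Monotone Tc) (hpoly : PolyBounded Tc)
    (hc : DecidesConflict conf Tc bad) (hbad : ∀ n G t, Hereditary (bad n G t))
    (e : Expr) (K : ℕ → ℕ → ℕ) (he : ∀ s : State, e.eval s = K (s.reg 2) (s.reg 3))
    (hK : ∀ t k, K t k ≤ t + k + 1) :
    ∃ C : ℝ, 0 ≤ C ∧ ∀ n, 0 < n → ∀ (G : SimpleGraph (Fin n)) (adj : Fin n → List (Fin n)),
      IsAdjacencyList G adj → ∀ t k, IsLocal G (bad n G t) → ∃ (T : ℕ) (s : State),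
        Exec ((n + t + k + 2) ^ 2) (assign 4 e ;; mainProg conf) (inputState adj t k) T s ∧
        (T : ℝ) ≤ C * maxDegreeBound n G ∧ (s.reg 0 = 0 ∨ s.reg 0 = 1) ∧
        (s.reg 0 = 1 ↔ ∃ S, ConflictFree (bad n G t) S ∧ K t k ≤ S.card) := by
  classical
  obtain ⟨C, hC, hW⟩ := exists_vertexTime_le hpoly
  refine ⟨C + 8 + 6 + (e.cost + 1), by positivity, fun n hn G adj hadj t k hloc => ?_⟩
  set D := G.maxDegree with hD
  have hdeg : ∀ x, (adj x).length ≤ D := fun x => by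
    have : (adj x).toFinset = G.neighborFinset x := by
      ext w; simp [(hadj x).2 w]
    rw [← List.toFinset_card_of_nodup (hadj x).1, this, G.card_neighborFinset_eq_degree]
    exact G.degree_le_maxDegree x
  have hDn : D ≤ n := by
    have := G.maxDegree_le_of_forall_degree_le n fun v => by
      simpa using (G.degree_lt_card_verts v).le
    exact this
  have hB : n * n + 3 * n + t + k + 4 ≤ (n + t + k + 2) ^ 2 := by nlinarith
  have hKtk := hK t k
  obtain ⟨T, s, hT, hE, hans, hiff⟩ : Runs ((n + t + k + 2) ^ 2) (assign 4 e ;; mainProg conf)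
      (inputState adj t k) (e.cost + 1 + (n * (vertexTime Tc D (D ^ 2 + 1) + 8) + 6)) _ :=
    .assign_seq (by rw [he]; simp only [inputState]; simp; omega)
      (mainProg_runs (K := K t k) hp hTc hc (hbad n G t) hadj hdeg
        ((holdsGraph_inputState adj t k).congr (by simp) (by simp))
        (fun x => by
          have := inputState_offset_le (fun v => (hadj v).1) t k x
          simp only [State.setReg_arr]; omega)
        (by simp [inputState]) (by simp [inputState]) (by simp [inputState])
        (by simp [he, inputState]) (by omega))
  refine ⟨T, s, hE, ?_, hans, hiff.trans (exists_subset_ballList_iff hn hadj hloc)⟩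
  have h1 : (1 : ℝ) ≤ 1.62 ^ (D ^ 2) := one_le_pow₀ (by norm_num)
  have h2 : (1 : ℝ) ≤ n := by exact_mod_cast hn
  have h3 := hW D
  have h4 : (T : ℝ) ≤ e.cost + 1 + (n * (vertexTime Tc D (D ^ 2 + 1) + 8) + 6) := by
    exact_mod_cast hT
  have h5 : maxDegreeBound n G = 1.62 ^ (D ^ 2) * n := rfl
  have h6 : (1 : ℝ) ≤ 1.62 ^ (D ^ 2) * n := one_le_mul_of_one_le_of_one_le h1 h2
  rw [h5]
  have h7 : (n : ℝ) * vertexTime Tc D (D ^ 2 + 1) ≤ n * (C * 1.62 ^ (D ^ 2)) := by gcongr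
  have h8 : (n : ℝ) ≤ 1.62 ^ (D ^ 2) * n := le_mul_of_one_le_left (by positivity) h1
  have h9 : ((e.cost : ℝ) + 1) * 1 ≤ (e.cost + 1) * (1.62 ^ (D ^ 2) * n) := by gcongr
  linarith

end TwoClub

/-! ### Conflicts given by common neighbors -/

namespace TwoClub

open RAM RAM.Expr RAM.Prog

open Classical in
/-- The common neighbors of `u` and `w` in `S`. -/
noncomputable def commonNeighbors {V : Type*} (G : SimpleGraph V) (S : Finset V) (u w : V) :
    Finset V := S.filter fun z => G.Adj u z ∧ G.Adj w z

theorem mem_commonNeighbors {V : Type*} {G : SimpleGraph V} {S : Finset V} {u w z : V} :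
    z ∈ commonNeighbors G S u w ↔ z ∈ S ∧ G.Adj u z ∧ G.Adj w z := by
  simp [commonNeighbors]

theorem commonNeighbors_mono {V : Type*} {G : SimpleGraph V} {S S' : Finset V} (h : S ⊆ S')
    (u w : V) : commonNeighbors G S u w ⊆ commonNeighbors G S' u w := fun z => by
  simp only [mem_commonNeighbors]
  exact fun hz => ⟨h hz.1, hz.2⟩

/-- Count the common neighbors of the vertices in registers `24` and `25` in register `31`. -/
def countCommon : Prog :=
  assign 31 (const 0) ;;
  forLoop 32 6 (assign 31 (reg 31 + arr 6 (reg 32) *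
    (arr 3 (reg 24 * reg 6 + reg 32) * arr 3 (reg 25 * reg 6 + reg 32))))

open Classical in
/-- The state `s` holds the subset `S` of a local graph, whose vertex `i` is the vertex `f i` of the
graph `G`. -/
structure HoldsLocal {n : ℕ} (G : SimpleGraph (Fin n)) (t m : ℕ) (f : ℕ → Fin n) (S : Finset ℕ)
    (s : State) : Prop where
  injOn : Set.InjOn f (Finset.range m)
  size : s.reg 6 = m
  param : s.reg 2 = t
  matrix : ∀ i < m, ∀ j < m, s.arr 3 (i * m + j) = if G.Adj (f i) (f j) then 1 else 0
  subset : S ⊆ Finset.range m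
  alive : ∀ i < m, s.arr 6 i = if i ∈ S then 1 else 0
  mem_left : s.reg 24 ∈ S
  mem_right : s.reg 25 ∈ S
  ne : s.reg 24 ≠ s.reg 25

theorem HoldsLocal.congr {n : ℕ} {G : SimpleGraph (Fin n)} {t m : ℕ} {f : ℕ → Fin n}
    {S : Finset ℕ} {s s' : State} (h : HoldsLocal G t m f S s)
    (hr : ∀ x < 30, s'.reg x = s.reg x) (ha : ∀ a < 7, s'.arr a = s.arr a) :
    HoldsLocal G t m f S s' where
  injOn := h.injOn
  size := by rw [hr 6 (by omega), h.size]
  param := by rw [hr 2 (by omega), h.param]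
  matrix := by rw [ha 3 (by omega)]; exact h.matrix
  subset := h.subset
  alive := by rw [ha 6 (by omega)]; exact h.alive
  mem_left := by rw [hr 24 (by omega)]; exact h.mem_left
  mem_right := by rw [hr 25 (by omega)]; exact h.mem_right
  ne := by rw [hr 24 (by omega), hr 25 (by omega)]; exact h.ne

theorem countCommon_runs {n : ℕ} {G : SimpleGraph (Fin n)} {t m B : ℕ} {f : ℕ → Fin n}
    {S : Finset ℕ} {s : State} (h : HoldsLocal G t m f S s) (hB : m ≤ B) :
    Runs B countCommon s (2 + (m * (19 + 8) + 6)) fun s' =>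
      s'.reg 31 = (commonNeighbors G (S.image f) (f (s.reg 24)) (f (s.reg 25))).card := by
  classical
  generalize hu : s.reg 24 = u
  generalize hw : s.reg 25 = w
  have hum : u < m := Finset.mem_range.1 (h.subset (hu ▸ h.mem_left))
  have hwm : w < m := Finset.mem_range.1 (h.subset (hw ▸ h.mem_right))
  -- `A j` collects the common neighbors among the first `j` positions; its size is the counter
  -- after `j` rounds.
  let A : ℕ → Finset ℕ := fun j => S.filter fun i => i < j ∧ G.Adj (f u) (f i) ∧ G.Adj (f w) (f i)
  have hA : ∀ j, (A j).card ≤ m := fun j =>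
    (Finset.card_le_card ((Finset.filter_subset _ _).trans h.subset)).trans (by simp)
  have hsucc : ∀ j, (A (j + 1)).card = (A j).card +
      if j ∈ S ∧ G.Adj (f u) (f j) ∧ G.Adj (f w) (f j) then 1 else 0 := by
    intro j
    by_cases hj : j ∈ S ∧ G.Adj (f u) (f j) ∧ G.Adj (f w) (f j)
    · have : A (j + 1) = insert j (A j) := by
        ext x; simp only [A, Finset.mem_filter, Finset.mem_insert]; grind
      rw [this, Finset.card_insert_of_notMem (by simp [A]), if_pos hj]
    · have : A (j + 1) = A j := by
        ext x; simp only [A, Finset.mem_filter]; grind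
      rw [this, if_neg hj, Nat.add_zero]
  refine .assign_seq (by simp) ?_
  refine Runs.forLoop (fun j s' => s'.reg 31 = (A j).card) (by simpa using h.size) hB
    (by decide) (by decide) (by simp [A]) ?_ ?_
  · intro j hj s' hA' hi hI
    have h3 : s'.arr 3 = s.arr 3 := by rw [hA'.arr 3 (by decide)]; simp
    have h6 : s'.arr 6 = s.arr 6 := by rw [hA'.arr 6 (by decide)]; simp
    have hm : s'.reg 6 = m := by rw [hA'.reg 6 (by decide)]; simpa using h.size
    have hu' : s'.reg 24 = u := by rw [hA'.reg 24 (by decide)]; simpa using hu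
    have hw' : s'.reg 25 = w := by rw [hA'.reg 25 (by decide)]; simpa using hw
    have hval : s'.reg 31 + s'.arr 6 j * (s'.arr 3 (u * m + j) * s'.arr 3 (w * m + j)) =
        (A (j + 1)).card := by
      rw [hsucc, hI, h3, h6, h.alive j hj, h.matrix u hum j hj, h.matrix w hwm j hj]
      congr 1
      by_cases h1 : j ∈ S <;> by_cases h2 : G.Adj (f u) (f j) <;>
        by_cases h3 : G.Adj (f w) (f j) <;> simp [h1, h2, h3]
    refine Runs.assign ?_ ?_
    · simp only [eval_add, eval_mul, eval_arr, eval_reg, hi, hm, hu', hw', hval]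
      exact (hA _).trans hB
    · simp only [eval_add, eval_mul, eval_arr, eval_reg, hi, hm, hu', hw', hval]
      simp
  · intro s' _ hI
    have himg : commonNeighbors G (S.image f) (f u) (f w) = (A m).image f := by
      ext x
      simp only [mem_commonNeighbors, A, Finset.mem_image, Finset.mem_filter]
      constructor
      · rintro ⟨⟨i, hi, rfl⟩, hx⟩
        exact ⟨i, ⟨hi, Finset.mem_range.1 (h.subset hi), hx⟩, rfl⟩
      · rintro ⟨i, ⟨hi, -, hx⟩, rfl⟩
        exact ⟨⟨i, hi, rfl⟩, hx⟩
    rw [hI, himg, Finset.card_image_of_injOn]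
    refine h.injOn.mono ?_
    exact_mod_cast (Finset.filter_subset _ _).trans h.subset

theorem decidesConflict_of_holdsLocal {conf : Prog} {Tc : ℕ → ℕ}
    {bad : ∀ n : ℕ, SimpleGraph (Fin n) → ℕ → Finset (Fin n) → Fin n → Fin n → Prop}
    (H : ∀ (n : ℕ) (G : SimpleGraph (Fin n)) (t B m : ℕ) (f : ℕ → Fin n) (s : State)
      (S : Finset ℕ), HoldsLocal G t m f S s → 2 * m + t + 4 ≤ B →
      Runs B conf s (Tc m) fun s' =>
        (s'.reg 30 ≠ 0 ↔ bad n G t (S.image f) (f (s.reg 24)) (f (s.reg 25)))) :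
    DecidesConflict conf Tc bad :=
  fun n G t B m f s S h₁ h₂ h₃ h₄ h₅ h₆ h₇ h₈ h₉ h₁₀ =>
    H n G t B m f s S ⟨h₁, h₃, h₄, h₅, h₆, h₇, h₈, h₉, h₁₀⟩ h₂

open Classical in
/-- There are fewer than `t` internally disjoint paths of length at most two. -/
def RobustConflict {V : Type*} (G : SimpleGraph V) (t : ℕ) (S : Finset V) (u w : V) : Prop :=
  (commonNeighbors G S u w).card + (if G.Adj u w then 1 else 0) < t

/-- The vertices are not adjacent and have at most `t` common neighbors. -/
def HereditaryConflict {V : Type*} (G : SimpleGraph V) (t : ℕ) (S : Finset V) (u w : V) : Prop :=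
  ¬ G.Adj u w ∧ (commonNeighbors G S u w).card < t + 1

/-- Decide whether two vertices are in conflict for robust 2-clubs. -/
def robustConf : Prog :=
  countCommon ;; assign 30 (Expr.lt (reg 31 + arr 3 (reg 24 * reg 6 + reg 25)) (reg 2))

/-- Decide whether two vertices are in conflict for hereditary 2-clubs. -/
def hereditaryConf : Prog :=
  countCommon ;; assign 30 ((const 1 - arr 3 (reg 24 * reg 6 + reg 25)) *
    Expr.lt (reg 31) (reg 2 + const 1))

theorem countCommon_holdsLocal {n : ℕ} {G : SimpleGraph (Fin n)} {t m : ℕ} {f : ℕ → Fin n}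
    {S : Finset ℕ} {s s' : State} (h : HoldsLocal G t m f S s)
    (hA : Agree countCommon.regs countCommon.arrs s s') : HoldsLocal G t m f S s' := by
  have h1 : ∀ y ∈ countCommon.regs, 30 ≤ y := by decide
  have h2 : ∀ y ∈ countCommon.arrs, 7 ≤ y := by decide
  exact h.congr (fun x hx => hA.reg x fun h => absurd (h1 x h) (by omega))
    (fun a ha => hA.arr a fun h => absurd (h2 a h) (by omega))

theorem HoldsLocal.adj_eval {n : ℕ} {G : SimpleGraph (Fin n)} {t m : ℕ} {f : ℕ → Fin n}
    {S : Finset ℕ} {s : State} (h : HoldsLocal G t m f S s)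
    [Decidable (G.Adj (f (s.reg 24)) (f (s.reg 25)))] :
    s.arr 3 (s.reg 24 * s.reg 6 + s.reg 25) =
      if G.Adj (f (s.reg 24)) (f (s.reg 25)) then 1 else 0 := by
  rw [h.size, h.matrix _ (Finset.mem_range.1 (h.subset h.mem_left)) _
    (Finset.mem_range.1 (h.subset h.mem_right))]
  congr

theorem robustConf_decides :
    DecidesConflict robustConf (fun m => 2 + (m * (19 + 8) + 6) + 11) fun _ => RobustConflict := by
  classical
  refine decidesConflict_of_holdsLocal fun n G t B m f s S h hB => ?_
  refine (countCommon_runs h (by omega)).andThen fun s' hA hcount => ?_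
  have h' := countCommon_holdsLocal h hA
  have hu : s'.reg 24 = s.reg 24 := hA.reg 24 (by decide)
  have hw : s'.reg 25 = s.reg 25 := hA.reg 25 (by decide)
  have hval := h'.adj_eval
  rw [hu, hw] at hval
  refine .assign ?_ ?_
  · simp only [eval_lt]; split_ifs <;> omega
  · simp only [eval_lt, eval_add, eval_mul, eval_arr, eval_reg, hval, h'.param, hcount, hu,
      hw, State.setReg_reg, if_true, RobustConflict]
    simp

theorem hereditaryConf_decides :
    DecidesConflict hereditaryConf (fun m => 2 + (m * (19 + 8) + 6) + 15)
      fun _ => HereditaryConflict := by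
  classical
  refine decidesConflict_of_holdsLocal fun n G t B m f s S h hB => ?_
  refine (countCommon_runs h (by omega)).andThen fun s' hA hcount => ?_
  have h' := countCommon_holdsLocal h hA
  have hu : s'.reg 24 = s.reg 24 := hA.reg 24 (by decide)
  have hw : s'.reg 25 = s.reg 25 := hA.reg 25 (by decide)
  have hval := h'.adj_eval
  rw [hu, hw] at hval
  refine .assign ?_ ?_
  · simp only [eval_lt, eval_mul, eval_sub, eval_const]
    refine (Nat.mul_le_mul (Nat.sub_le _ _) (?_ : _ ≤ 1)).trans (by omega)
    split_ifs <;> omega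
  · simp only [eval_lt, eval_add, eval_sub, eval_const, eval_mul, eval_arr, eval_reg, hval,
      h'.param, hcount, hu, hw, State.setReg_reg, if_true, HereditaryConflict]
    by_cases hadj : G.Adj (f (s.reg 24)) (f (s.reg 25)) <;> simp [hadj]

theorem robustConf_private : Private robustConf := ⟨by decide, by decide⟩

theorem hereditaryConf_private : Private hereditaryConf := ⟨by decide, by decide⟩

/-- Passing to a subset can only lose common neighbors, and adjacency does not change. -/
theorem hereditary_robustConflict {V : Type*} (G : SimpleGraph V) (t : ℕ) :
    Hereditary (RobustConflict G t) := fun S S' hS u _ w _ h => by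
  have := Finset.card_le_card (commonNeighbors_mono (G := G) hS u w)
  unfold RobustConflict at h ⊢
  omega

theorem hereditary_hereditaryConflict {V : Type*} (G : SimpleGraph V) (t : ℕ) :
    Hereditary (HereditaryConflict G t) := fun S S' hS u _ w _ h => by
  have := Finset.card_le_card (commonNeighbors_mono (G := G) hS u w)
  exact ⟨h.1, by have := h.2; omega⟩

theorem commonNeighbors_eq_empty {V : Type*} {G : SimpleGraph V} {S : Finset V} {u w : V}
    (h : ∀ y ∈ S, ¬ (G.Adj u y ∧ G.Adj w y)) : commonNeighbors G S u w = ∅ :=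
  Finset.eq_empty_of_forall_notMem fun z hz => by
    rw [mem_commonNeighbors] at hz
    exact h z hz.1 hz.2

/-- Distant vertices have no path of length at most two, which is fewer than `t` exactly because `t`
is positive. -/
theorem isLocal_robustConflict {V : Type*} (G : SimpleGraph V) {t : ℕ} (ht : t ≠ 0) :
    IsLocal G (RobustConflict G t) := fun S u _ w _ _ hadj h => by
  rw [RobustConflict, commonNeighbors_eq_empty h, if_neg hadj]
  simpa using Nat.pos_of_ne_zero ht

theorem isLocal_hereditaryConflict {V : Type*} (G : SimpleGraph V) (t : ℕ) :
    IsLocal G (HereditaryConflict G t) := fun S u _ w _ _ hadj h => by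
  rw [HereditaryConflict, commonNeighbors_eq_empty h]
  exact ⟨hadj, by simp⟩

end TwoClub

/-! ### Characterizations by conflicts -/

namespace TwoClub

variable {V : Type*} {G : SimpleGraph V}

theorem isTwoClub_iff {A : Set V} : IsTwoClub G A ↔
    ∀ u ∈ A, ∀ w ∈ A, u ≠ w → G.Adj u w ∨ ∃ z ∈ A, G.Adj u z ∧ G.Adj w z := by
  unfold IsTwoClub
  rw [SimpleGraph.ediam_le_iff]
  have key : ∀ u w : A, (G.induce A).edist u w ≤ 2 ↔
      (u ≠ w → G.Adj u w ∨ ∃ z ∈ A, G.Adj u z ∧ G.Adj w z) := by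
    intro u w
    rw [← not_lt, SimpleGraph.two_lt_edist_iff, Set.eq_empty_iff_forall_notMem]
    simp only [SimpleGraph.mem_commonNeighbors, SimpleGraph.comap_adj,
      Function.Embedding.subtype_apply, Subtype.forall, ne_eq, not_and, not_forall, not_not]
    constructor
    · intro h hne
      by_cases hadj : G.Adj u w
      · exact .inl hadj
      · obtain ⟨z, hz, h1, h2⟩ := h hne hadj
        exact .inr ⟨z, hz, h1, h2⟩
    · intro h hne hadj
      obtain ⟨z, hz, h1, h2⟩ := (h hne).resolve_left hadj
      exact ⟨z, hz, h1, h2⟩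
  simp only [key]
  constructor
  · exact fun h u hu w hw hne => h ⟨u, hu⟩ ⟨w, hw⟩ fun h => hne (congrArg Subtype.val h)
  · exact fun h u w hne => h u u.2 w w.2 fun h => hne (Subtype.ext h)

/-- To destroy all paths of length two between nonadjacent vertices one must remove precisely their
common neighbors. Hence the common neighborhood itself is the set `U` to test, and any other `U`
that works contains it. -/
theorem isHereditaryTwoClub_iff {t : ℕ} {S : Finset V} :
    IsHereditaryTwoClub G t S ↔ ConflictFree (HereditaryConflict G t) S := by
  classical
  unfold IsHereditaryTwoClub
  simp only [isTwoClub_iff]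
  constructor
  · rintro h u hu w hw hne ⟨hadj, hcard⟩
    have hsub : commonNeighbors G S u w ⊆ S := fun z hz => (mem_commonNeighbors.1 hz).1
    have hu' : u ∉ commonNeighbors G S u w := fun hz => (mem_commonNeighbors.1 hz).2.1.ne rfl
    have hw' : w ∉ commonNeighbors G S u w := fun hz => (mem_commonNeighbors.1 hz).2.2.ne rfl
    rcases h _ ⟨hsub, fun h => hu' (h hu)⟩ (by omega) u ⟨hu, by simpa using hu'⟩ w
      ⟨hw, by simpa using hw'⟩ hne with h | ⟨z, ⟨hz, hz'⟩, h⟩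
    · exact hadj h
    · exact hz' (mem_commonNeighbors.2 ⟨hz, h⟩)
  · intro h U hU hcard u hu w hw hne
    by_contra hcon
    push Not at hcon
    refine h u hu.1 w hw.1 hne ⟨hcon.1, ?_⟩
    have : commonNeighbors G S u w ⊆ U := fun z hz => by
      by_contra hzU
      rw [mem_commonNeighbors] at hz
      exact hcon.2 z ⟨hz.1, hzU⟩ hz.2.1 hz.2.2
    have := Finset.card_le_card this
    omega

section Robust

open Classical in
/-- The possible second vertices of a path of length at most two from `u` to `w` in `S`. -/
noncomputable def secondVertices (G : SimpleGraph V) (S : Finset V) (u w : V) : Finset V :=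
  commonNeighbors G S u w ∪ if G.Adj u w then {w} else ∅

open Classical in
theorem card_secondVertices {S : Finset V} {u w : V} : (secondVertices G S u w).card =
    (commonNeighbors G S u w).card + if G.Adj u w then 1 else 0 := by
  unfold secondVertices
  rw [Finset.card_union_of_disjoint]
  · split_ifs <;> simp
  · split_ifs
    · simpa using fun h => (mem_commonNeighbors.1 h).2.2.ne rfl
    · simp

theorem exists_path_of_mem_secondVertices {S : Finset V} {u w : (S : Set V)} (hne : u ≠ w) {z : V}
    (hz : z ∈ secondVertices G S u w) :
    ∃ P : (G.induce (S : Set V)).Path u w, (P : (G.induce (S : Set V)).Walk u w).length ≤ 2 ∧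
      ((P : (G.induce (S : Set V)).Walk u w).getVert 1 : V) = z ∧
      ∀ x ∈ (P : (G.induce (S : Set V)).Walk u w).support, x = u ∨ x = w ∨ (x : V) = z := by
  classical
  simp only [secondVertices, Finset.mem_union, mem_commonNeighbors] at hz
  rcases hz with ⟨hzS, huz, hwz⟩ | hz
  · let z' : (S : Set V) := ⟨z, hzS⟩
    have h1 : (G.induce (S : Set V)).Adj u z' := huz
    have h2 : (G.induce (S : Set V)).Adj z' w := hwz.symm
    refine ⟨⟨.cons h1 (.cons h2 .nil), ?_⟩, by simp, by simp [z'], ?_⟩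
    · simp [SimpleGraph.Walk.isPath_def, h1.ne, h2.ne, hne]
    · intro x hx
      simp only [SimpleGraph.Walk.support_cons, SimpleGraph.Walk.support_nil, List.mem_cons,
        List.not_mem_nil, or_false] at hx
      rcases hx with rfl | rfl | rfl
      exacts [.inl rfl, .inr (.inr rfl), .inr (.inl rfl)]
  · split_ifs at hz with hadj
    · rw [Finset.mem_singleton] at hz
      have h1 : (G.induce (S : Set V)).Adj u w := hadj
      refine ⟨⟨.cons h1 .nil, ?_⟩, by simp, by simp [hz], ?_⟩
      · simp [SimpleGraph.Walk.isPath_def, hne]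
      · intro x hx
        simp only [SimpleGraph.Walk.support_cons, SimpleGraph.Walk.support_nil, List.mem_cons,
          List.not_mem_nil, or_false] at hx
        exact hx.imp_right .inl
    · simp at hz

/-- A path of length at most two between distinct vertices is determined by its second vertex, so
admissible families of paths correspond to sets of second vertices. A shared inner vertex
contradicts disjointness; if the shared second vertex is `w`, both paths are the edge and
injectivity is violated. -/
theorem isRobustTwoClub_iff {t : ℕ} {S : Finset V} :
    IsRobustTwoClub G t S ↔ ConflictFree (RobustConflict G t) S := by
  classical
  have hconf : ConflictFree (RobustConflict G t) S ↔
      ∀ u w : (S : Set V), u ≠ w → t ≤ (secondVertices G S u w).card := by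
    simp only [ConflictFree, RobustConflict, card_secondVertices, not_lt]
    constructor
    · exact fun h u w hne => h u u.2 w w.2 fun h => hne (Subtype.ext h)
    · exact fun h u hu w hw hne => h ⟨u, hu⟩ ⟨w, hw⟩ fun h => hne (congrArg Subtype.val h)
  rw [hconf]
  refine forall₃_congr fun u w hne => ⟨?_, ?_⟩
  · rintro ⟨P, hinj, hlen, hdisj⟩
    have hpos : ∀ i, 0 < (P i : (G.induce (S : Set V)).Walk u w).length := fun i =>
      Nat.pos_of_ne_zero fun h => hne (SimpleGraph.Walk.eq_of_length_eq_zero h)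
    have hadj1 : ∀ i, (G.induce (S : Set V)).Adj u
        ((P i : (G.induce (S : Set V)).Walk u w).getVert 1) := fun i => by
      have := (P i : (G.induce (S : Set V)).Walk u w).adj_getVert_succ (i := 0) (hpos i)
      simpa using this
    -- A path visits `w` only at its end, so reaching `w` after one step forces length one.
    have hlast : ∀ i, (P i : (G.induce (S : Set V)).Walk u w).getVert 1 = w →
        (P i : (G.induce (S : Set V)).Walk u w).length = 1 := fun i h => by
      have := (P i).2.getVert_injOn (x₁ := 1)
        (x₂ := (P i : (G.induce (S : Set V)).Walk u w).length) (by
          have := hpos i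
          simp only [Set.mem_ofPred_eq]; omega) (by simp)
      rw [SimpleGraph.Walk.getVert_length] at this
      exact (this h).symm
    have hmem : ∀ i ∈ (Finset.univ : Finset (Fin t)),
        ((P i : (G.induce (S : Set V)).Walk u w).getVert 1 : V) ∈ secondVertices G S u w := by
      intro i _
      have h1 := hadj1 i
      simp only [secondVertices, Finset.mem_union, mem_commonNeighbors]
      rcases (by have := hpos i; have := hlen i; omega :
        (P i : (G.induce (S : Set V)).Walk u w).length = 1 ∨
        (P i : (G.induce (S : Set V)).Walk u w).length = 2) with h | h
      · have h2 : (P i : (G.induce (S : Set V)).Walk u w).getVert 1 = w := by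
          rw [← h]; exact SimpleGraph.Walk.getVert_length _
        rw [h2] at h1 ⊢
        right
        rw [if_pos (show G.Adj u w from h1)]
        simp
      · have h2 := (P i : (G.induce (S : Set V)).Walk u w).adj_getVert_succ (i := 1) (by omega)
        have h3 : (P i : (G.induce (S : Set V)).Walk u w).getVert (1 + 1) = w := by
          rw [show 1 + 1 = (P i : (G.induce (S : Set V)).Walk u w).length by omega]
          exact SimpleGraph.Walk.getVert_length _
        rw [h3] at h2
        exact .inl ⟨Subtype.coe_prop _, h1, h2.symm⟩
    have hcard := Finset.card_le_card_of_injOn _ hmem ?_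
    · simpa using hcard
    · intro i _ j _ hij
      by_contra hne'
      have hij' := Subtype.ext hij
      have hx := hdisj i j hne' ((P i : (G.induce (S : Set V)).Walk u w).getVert 1)
        (SimpleGraph.Walk.getVert_mem_support _ _)
        (by rw [hij']; exact SimpleGraph.Walk.getVert_mem_support _ _)
      rcases hx with hx | hx
      · exact (hadj1 i).ne hx.symm
      · have hi := hlast i hx
        have hj := hlast j (hij' ▸ hx)
        refine hne' (hinj (Subtype.ext ?_))
        refine SimpleGraph.Walk.ext_getVert_le_length (by rw [hi, hj]) fun k hk => ?_
        rcases (by omega : k = 0 ∨ k = 1) with rfl | rfl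
        · simp
        · exact hij'
  · intro hcard
    obtain ⟨e⟩ : Nonempty (Fin t ↪ (secondVertices G S (u : V) w)) := by
      rw [Function.Embedding.nonempty_iff_card_le]
      simpa using hcard
    choose P hlen hget hsupp using fun i =>
      exists_path_of_mem_secondVertices (G := G) hne (e i).2
    refine ⟨P, fun i j hij => ?_, hlen, fun i j hij x hxi hxj => ?_⟩
    · apply e.injective
      apply Subtype.ext
      rw [← hget i, ← hget j, hij]
    · rcases hsupp i x hxi with h | h | h
      · exact .inl h
      · exact .inr h
      · rcases hsupp j x hxj with h' | h' | h'
        · exact .inl h'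
        · exact .inr h'
        · exact absurd (e.injective (Subtype.ext (h.symm.trans h'))) hij

end Robust

/-- The set `U` separates `u` from `w` in `G[S]`: the set `R` contains `u` but not `w`, and it is
closed under adjacency in `G[S \ U]`. -/
def Separates (G : SimpleGraph V) (S U : Finset V) (R : Set V) (u w : V) : Prop :=
  u ∉ U ∧ w ∉ U ∧ u ∈ R ∧ w ∉ R ∧
    ∀ a ∈ R, a ∈ S → a ∉ U → ∀ b ∈ S, b ∉ U → G.Adj a b → b ∈ R

/-- The vertices are not adjacent, and they have no common neighbor or can be separated by fewer
than `t` vertices. -/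
def ConnectedConflict (G : SimpleGraph V) (t : ℕ) (S : Finset V) (u w : V) : Prop :=
  ¬ G.Adj u w ∧ ((commonNeighbors G S u w).card = 0 ∨
    ∃ U ⊆ S, U.card < t ∧ ∃ R, Separates G S U R u w)

/-- A separator in the larger set, intersected with the smaller one, still separates with the same
side `R`. -/
theorem hereditary_connectedConflict (G : SimpleGraph V) (t : ℕ) :
    Hereditary (ConnectedConflict G t) := by
  classical
  rintro S S' hS u hu w hw ⟨hadj, h⟩
  refine ⟨hadj, ?_⟩
  rcases h with h | ⟨U, hU, hcard, R, huU, hwU, huR, hwR, hcl⟩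
  · left
    have := Finset.card_le_card (commonNeighbors_mono (G := G) hS u w)
    omega
  · refine .inr ⟨U ∩ S, Finset.inter_subset_right, (Finset.card_le_card
      Finset.inter_subset_left).trans_lt hcard, R, ?_, ?_, huR, hwR, ?_⟩
    · simp [huU]
    · simp [hwU]
    · intro a haR haS haU b hbS hbU hab
      refine hcl a haR (hS haS) (fun h => haU ?_) b (hS hbS) (fun h => hbU ?_) hab
      · simp [h, haS]
      · simp [h, hbS]

theorem isLocal_connectedConflict (G : SimpleGraph V) (t : ℕ) :
    IsLocal G (ConnectedConflict G t) := fun S u _ w _ _ hadj h => by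
  rw [ConnectedConflict, commonNeighbors_eq_empty h]
  exact ⟨hadj, .inl rfl⟩

/-- The missing common neighbor accounts for the 2-club condition and the separator for connectivity
after deletions. Given a disconnected `G[S \ U]`, the side `R` is the component of `u`; conversely a
walk starting in `R` cannot leave it. -/
theorem isConnectedTwoClub_iff {t : ℕ} {S : Finset V} :
    IsConnectedTwoClub G t S ↔ t < S.card ∧ ConflictFree (ConnectedConflict G t) S := by
  classical
  unfold IsConnectedTwoClub
  rw [isTwoClub_iff]
  constructor
  · rintro ⟨h2, hcard, hconn⟩
    refine ⟨hcard, ?_⟩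
    rintro u hu w hw hne ⟨hadj, h | ⟨U, hU, hUc, R, huU, hwU, huR, hwR, hcl⟩⟩
    · obtain ⟨z, hz, h1, h2⟩ := (h2 u hu w hw hne).resolve_left hadj
      rw [Finset.card_eq_zero] at h
      have : z ∈ commonNeighbors G S u w := mem_commonNeighbors.2 ⟨hz, h1, h2⟩
      simp [h] at this
    · have hr := (hconn U hU hUc).preconnected ⟨u, hu, huU⟩ ⟨w, hw, hwU⟩
      obtain ⟨p⟩ := hr
      have key : ∀ (x y : ((S : Set V) \ (U : Set V) : Set V)),
          (G.induce ((S : Set V) \ (U : Set V))).Walk x y → (x : V) ∈ R → (y : V) ∈ R := by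
        intro x y p
        induction p with
        | nil => exact id
        | @cons a b c hab _ ih => exact fun ha => ih (hcl a ha a.2.1 a.2.2 b b.2.1 b.2.2 hab)
      exact hwR (key _ _ p huR)
  · rintro ⟨hcard, hcf⟩
    refine ⟨fun u hu w hw hne => ?_, hcard, fun U hU hUc => ?_⟩
    · by_contra h
      push Not at h
      refine hcf u hu w hw hne ⟨h.1, .inl ?_⟩
      rw [commonNeighbors_eq_empty fun y hy hadj => h.2 y hy hadj.1 hadj.2, Finset.card_empty]
    -- Connectedness includes nonemptiness, which follows from `|U| < t < |S|`.
    · obtain ⟨x, hx, hxU⟩ : ∃ x ∈ S, x ∉ U :=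
        Finset.exists_mem_notMem_of_card_lt_card (by omega)
      have : Nonempty ((S : Set V) \ (U : Set V) : Set V) := ⟨⟨x, hx, hxU⟩⟩
      refine ⟨fun u w => ?_⟩
      by_contra hreach
      have hadj : ¬ G.Adj u w := fun h => hreach (SimpleGraph.Adj.reachable (by exact h))
      refine hcf u u.2.1 w w.2.1 (fun h => hreach ?_) ⟨hadj, .inr ⟨U, hU, hUc,
        {y | ∃ h : y ∈ (S : Set V) \ (U : Set V),
          (G.induce ((S : Set V) \ (U : Set V))).Reachable u ⟨y, h⟩},
        u.2.2, w.2.2, ⟨u.2, .refl _⟩, fun ⟨_, h⟩ => hreach h, ?_⟩⟩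
      · rw [Subtype.ext h]
      · rintro a ⟨ha, har⟩ - - b hbS hbU hab
        refine ⟨⟨hbS, hbU⟩, har.trans (SimpleGraph.Adj.reachable ?_)⟩
        exact hab

end TwoClub

/-! ### Flows and cuts -/

namespace TwoClub

/-- The flow out of the node `a`, where `c` are the capacities and `r` the residual capacities. -/
def netFlow (N : ℕ) (c r : ℕ → ℕ → ℕ) (a : ℕ) : ℤ :=
  ∑ b ∈ Finset.range N, ((c a b : ℤ) - r a b)

/-- The numbers `r` are the residual capacities of a flow of value `val` from `src` to `dst`. -/
structure IsResidual (N : ℕ) (c : ℕ → ℕ → ℕ) (src dst val : ℕ) (r : ℕ → ℕ → ℕ) : Prop where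
  pair : ∀ a < N, ∀ b < N, r a b + r b a = c a b + c b a
  conserve : ∀ a < N, a ≠ src → a ≠ dst → netFlow N c r a = 0
  value : netFlow N c r src = val

section Flow

variable {N src dst val : ℕ} {c r r' : ℕ → ℕ → ℕ}

theorem netFlow_congr (h : ∀ a < N, ∀ b < N, r' a b = r a b) {a : ℕ} (ha : a < N) :
    netFlow N c r' a = netFlow N c r a :=
  Finset.sum_congr rfl fun b hb => by rw [h a ha b (Finset.mem_range.1 hb)]

theorem IsResidual.congr (h : IsResidual N c src dst val r) (hsrc : src < N)
    (hr : ∀ a < N, ∀ b < N, r' a b = r a b) : IsResidual N c src dst val r' where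
  pair a ha b hb := by rw [hr a ha b hb, hr b hb a ha, h.pair a ha b hb]
  conserve a ha h1 h2 := by rw [netFlow_congr hr ha, h.conserve a ha h1 h2]
  value := by rw [netFlow_congr hr hsrc, h.value]

theorem isResidual_zero : IsResidual N c src dst 0 c :=
  ⟨fun _ _ _ _ => rfl, fun _ _ _ _ => by simp [netFlow], by simp [netFlow]⟩

/-- Summing the net outflow over `R` leaves only the source. Arcs inside `R` cancel, because `pair`
makes the flow antisymmetric and the inner sum equal to its own negative. -/
theorem IsResidual.value_eq_cut (h : IsResidual N c src dst val r) {R : Finset ℕ}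
    (hR : R ⊆ Finset.range N) (hs : src ∈ R) (hd : dst ∉ R) :
    (val : ℤ) = ∑ a ∈ R, ∑ b ∈ Finset.range N \ R, ((c a b : ℤ) - r a b) := by
  have h1 : ∑ a ∈ R, netFlow N c r a = val := by
    rw [Finset.sum_eq_single_of_mem src hs, h.value]
    intro a ha hne
    exact h.conserve a (Finset.mem_range.1 (hR ha)) hne fun h' => hd (h' ▸ ha)
  have h2 : ∑ a ∈ R, ∑ b ∈ R, ((c a b : ℤ) - r a b) = 0 := by
    have h3 : ∑ a ∈ R, ∑ b ∈ R, ((c a b : ℤ) - r a b) =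
        - ∑ a ∈ R, ∑ b ∈ R, ((c a b : ℤ) - r a b) := by
      conv_rhs => rw [Finset.sum_comm]
      rw [← Finset.sum_neg_distrib]
      refine Finset.sum_congr rfl fun a ha => ?_
      rw [← Finset.sum_neg_distrib]
      refine Finset.sum_congr rfl fun b hb => ?_
      have := h.pair a (Finset.mem_range.1 (hR ha)) b (Finset.mem_range.1 (hR hb))
      omega
    omega
  rw [← h1, ← zero_add (∑ a ∈ R, ∑ b ∈ Finset.range N \ R, ((c a b : ℤ) - r a b)), ← h2,
    ← Finset.sum_add_distrib]
  refine Finset.sum_congr rfl fun a _ => ?_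
  rw [add_comm, netFlow, Finset.sum_sdiff hR]

theorem IsResidual.value_le_cut (h : IsResidual N c src dst val r) {R : Finset ℕ}
    (hR : R ⊆ Finset.range N) (hs : src ∈ R) (hd : dst ∉ R) :
    val ≤ ∑ a ∈ R, ∑ b ∈ Finset.range N \ R, c a b := by
  have := h.value_eq_cut hR hs hd
  zify
  rw [this]
  refine Finset.sum_le_sum fun a _ => Finset.sum_le_sum fun b _ => ?_
  omega

theorem IsResidual.value_eq_of_closed (h : IsResidual N c src dst val r) {R : Finset ℕ}
    (hR : R ⊆ Finset.range N) (hs : src ∈ R) (hd : dst ∉ R)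
    (hcl : ∀ a ∈ R, ∀ b < N, b ∉ R → r a b = 0) :
    val = ∑ a ∈ R, ∑ b ∈ Finset.range N \ R, c a b := by
  have := h.value_eq_cut hR hs hd
  zify
  rw [this]
  refine Finset.sum_congr rfl fun a ha => Finset.sum_congr rfl fun b hb => ?_
  rw [Finset.mem_sdiff, Finset.mem_range] at hb
  rw [hcl a ha b hb.1 hb.2]
  simp

/-- Send one unit of flow along the arc from `p` to `q`. -/
def push (r : ℕ → ℕ → ℕ) (p q a b : ℕ) : ℕ :=
  if a = p ∧ b = q then r a b - 1 else if a = q ∧ b = p then r a b + 1 else r a b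

theorem push_pair {p q : ℕ} (hpq : p ≠ q) (hr : 0 < r p q) (a b : ℕ) :
    push r p q a b + push r p q b a = r a b + r b a := by
  unfold push
  by_cases h1 : a = p ∧ b = q
  · obtain ⟨rfl, rfl⟩ := h1
    simp [hpq, hpq.symm]
    omega
  · by_cases h2 : a = q ∧ b = p
    · obtain ⟨rfl, rfl⟩ := h2
      simp [hpq, hpq.symm]
      omega
    · rw [if_neg h1, if_neg h2, if_neg (by tauto), if_neg (by tauto)]

theorem netFlow_push {p q : ℕ} (hp : p < N) (hq : q < N) (hpq : p ≠ q) (hr : 0 < r p q) (a : ℕ) :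
    netFlow N c (push r p q) a =
      netFlow N c r a + (if a = p then 1 else 0) - (if a = q then 1 else 0) := by
  have key : ∀ b, ((c a b : ℤ) - push r p q a b) = ((c a b : ℤ) - r a b) +
      ((if b = q then if a = p then 1 else 0 else 0) -
        if b = p then if a = q then 1 else 0 else 0) := by
    intro b
    unfold push
    by_cases h1 : a = p ∧ b = q
    · obtain ⟨rfl, rfl⟩ := h1
      simp [hpq]
      omega
    · by_cases h2 : a = q ∧ b = p
      · obtain ⟨rfl, rfl⟩ := h2
        simp [hpq.symm]
        omega
      · rw [if_neg h1, if_neg h2]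
        have h3 : (if b = q then if a = p then (1 : ℤ) else 0 else 0) = 0 := by grind
        have h4 : (if b = p then if a = q then (1 : ℤ) else 0 else 0) = 0 := by grind
        rw [h3, h4]; ring
  unfold netFlow
  simp only [key]
  rw [Finset.sum_add_distrib, Finset.sum_sub_distrib]
  simp [hp, hq]
  ring

/-- The capacities `r'` arise from `r` by sending a unit of flow from `cur` to `dst`. -/
structure PartlyAugmented (N : ℕ) (c r : ℕ → ℕ → ℕ) (dst cur : ℕ) (r' : ℕ → ℕ → ℕ) : Prop where
  pair : ∀ a < N, ∀ b < N, r' a b + r' b a = r a b + r b a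
  net : ∀ a < N, netFlow N c r' a =
    netFlow N c r a + (if a = cur then 1 else 0) - (if a = dst then 1 else 0)

theorem partlyAugmented_refl : PartlyAugmented N c r dst dst r :=
  ⟨fun _ _ _ _ => rfl, fun _ _ => by ring⟩

/-- An augmenting path is traversed backwards from the sink; pushing along the arc into `cur` moves
the surplus from `cur` to its predecessor `p`. -/
theorem PartlyAugmented.push {cur p : ℕ} (h : PartlyAugmented N c r dst cur r') (hp : p < N)
    (hcur : cur < N) (hne : p ≠ cur) (hr : 0 < r' p cur) :
    PartlyAugmented N c r dst p (push r' p cur) where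
  pair a ha b hb := by rw [push_pair hne hr, h.pair a ha b hb]
  net a ha := by
    rw [netFlow_push hp hcur hne hr, h.net a ha]
    ring

theorem PartlyAugmented.congr {cur : ℕ} {r'' : ℕ → ℕ → ℕ} (h : PartlyAugmented N c r dst cur r')
    (hr : ∀ a < N, ∀ b < N, r'' a b = r' a b) : PartlyAugmented N c r dst cur r'' where
  pair a ha b hb := by rw [hr a ha b hb, hr b hb a ha, h.pair a ha b hb]
  net a ha := by rw [netFlow_congr hr ha, h.net a ha]

theorem IsResidual.augment (h : IsResidual N c src dst val r) (hs : src < N) (hne : src ≠ dst)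
    (h' : PartlyAugmented N c r dst src r') : IsResidual N c src dst (val + 1) r' where
  pair a ha b hb := by rw [h'.pair a ha b hb, h.pair a ha b hb]
  conserve a ha h1 h2 := by rw [h'.net a ha, h.conserve a ha h1 h2]; simp [h1, h2]
  value := by rw [h'.net src hs, h.value]; simp [hne]

end Flow

/-! ### Flows and separators -/

open Classical in
/-- The capacities of the split graph of `H[S]`: the vertex `x < m` has an incoming node `x` and an
outgoing node `m + x`. The source is the outgoing node of `u`, the sink the incoming node of `w`. -/
noncomputable def capacity (H : SimpleGraph ℕ) (m : ℕ) (S : Finset ℕ) (u w a b : ℕ) : ℕ :=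
  if a < m ∧ b = m + a ∧ a ∈ S ∧ a ≠ u ∧ a ≠ w then 1
  else if m ≤ a ∧ b < m ∧ a - m ∈ S ∧ b ∈ S ∧ H.Adj (a - m) b ∧ a - m ≠ w ∧ b ≠ u then 1
  else 0

section Separator

variable {H : SimpleGraph ℕ} {m u w val t : ℕ} {S : Finset ℕ} {r : ℕ → ℕ → ℕ}

theorem capacity_le_one (a b : ℕ) : capacity H m S u w a b ≤ 1 := by
  unfold capacity
  split_ifs <;> omega

/-- Weak duality: the separator defines a node set `Q` whose outgoing arcs of positive capacity all
join the two nodes of a vertex of `U`. -/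
theorem value_le_of_separates (h : IsResidual (2 * m) (capacity H m S u w) (m + u) w val r)
    (hS : S ⊆ Finset.range m) (hu : u ∈ S) (hw : w ∈ S) {U : Finset ℕ} {R : Set ℕ}
    (hsep : Separates H S U R u w) : val ≤ U.card := by
  classical
  obtain ⟨huU, hwU, huR, hwR, hcl⟩ := hsep
  have hm : ∀ x ∈ S, x < m := fun x hx => Finset.mem_range.1 (hS hx)
  have hwm := hm w hw
  have hum := hm u hu
  -- Incoming nodes belong to `Q` for vertices of `U` and of `S ∩ R`, outgoing nodes only for
  -- vertices of `S ∩ R` outside `U`. So the cut passes through the vertices of `U`.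
  let Q : Finset ℕ := (Finset.range (2 * m)).filter fun a =>
    (a < m ∧ (a ∈ U ∨ a ∈ S ∧ a ∈ R)) ∨ (m ≤ a ∧ a - m ∈ S ∧ a - m ∉ U ∧ a - m ∈ R)
  have hsQ : m + u ∈ Q := by
    simp only [Q, Finset.mem_filter, Finset.mem_range, Nat.add_sub_cancel_left]
    exact ⟨by omega, .inr ⟨by omega, hu, huU, huR⟩⟩
  have hdQ : w ∉ Q := by
    simp only [Q, Finset.mem_filter, Finset.mem_range, not_and]
    rintro - (⟨-, h | h⟩ | h)
    · exact hwU h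
    · exact hwR h.2
    · omega
  refine (h.value_le_cut (Finset.filter_subset _ _) hsQ hdQ).trans ?_
  have hcut : ∀ a ∈ Q, ∀ b ∈ Finset.range (2 * m) \ Q, capacity H m S u w a b ≤
      if b = m + a then if a ∈ U then 1 else 0 else 0 := by
    intro a ha b hb
    rw [Finset.mem_sdiff, Finset.mem_range] at hb
    obtain ⟨hb2, hbQ⟩ := hb
    simp only [Q, Finset.mem_filter, Finset.mem_range] at ha hbQ
    unfold capacity
    split_ifs with h1 h2 h3 h4
    · exact le_rfl
    · exfalso
      obtain ⟨h5, rfl, h6, -⟩ := h1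
      refine hbQ ⟨hb2, .inr ⟨by omega, ?_⟩⟩
      rw [Nat.add_sub_cancel_left]
      refine ⟨h6, h3, ?_⟩
      rcases ha.2 with ha | ha
      · exact (ha.2.resolve_left h3).2
      · omega
    · omega
    · omega
    · omega
    · exfalso
      obtain ⟨h5, h6, h7, h8, h9, -⟩ := h4
      refine hbQ ⟨hb2, .inl ⟨h6, ?_⟩⟩
      by_cases hbU : b ∈ U
      · exact .inl hbU
      · rcases ha.2 with ha | ha
        · omega
        · exact .inr ⟨h8, hcl _ ha.2.2.2 h7 ha.2.2.1 b h8 hbU h9⟩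
    all_goals exact Nat.zero_le _
  calc ∑ a ∈ Q, ∑ b ∈ Finset.range (2 * m) \ Q, capacity H m S u w a b
      ≤ ∑ a ∈ Q, ∑ b ∈ Finset.range (2 * m) \ Q,
          if b = m + a then if a ∈ U then 1 else 0 else 0 :=
        Finset.sum_le_sum fun a ha => Finset.sum_le_sum fun b hb => hcut a ha b hb
    _ ≤ ∑ a ∈ Q, if a ∈ U then 1 else 0 := by
        refine Finset.sum_le_sum fun a _ => ?_
        rw [Finset.sum_ite_eq']
        split_ifs <;> omega
    _ ≤ U.card := by
        rw [← Finset.sum_filter, Finset.sum_const, smul_eq_mul, mul_one]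
        exact Finset.card_le_card fun x hx => (Finset.mem_filter.1 hx).2

/-- Removing everything except `u` and `w` separates them with side `{u}`. The resulting bound
limits the number of augmentations. -/
theorem value_lt_of_not_adj (h : IsResidual (2 * m) (capacity H m S u w) (m + u) w val r)
    (hS : S ⊆ Finset.range m) (hu : u ∈ S) (hw : w ∈ S) (huw : u ≠ w) (hadj : ¬ H.Adj u w) :
    val < m := by
  have hle := value_le_of_separates h hS hu hw (U := (S.erase u).erase w) (R := {u})
    ⟨by simp, by simp, rfl, huw.symm, by
      rintro a rfl - - b hb hbU hab
      simp only [Finset.mem_erase, not_and] at hbU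
      by_contra hba
      by_cases hbw : b = w
      · exact hadj (hbw ▸ hab)
      · exact hbU hbw hba hb⟩
  have h1 : ((S.erase u).erase w).card < S.card :=
    Finset.card_lt_card ⟨(Finset.erase_subset _ _).trans (Finset.erase_subset _ _),
      fun h => by simpa using h hu⟩
  have h2 := Finset.card_le_card hS
  rw [Finset.card_range] at h2
  omega

/-- The flow saturates the cut around `Q`, so `val` counts the cut arcs. Choosing one vertex per cut
arc gives a separator of at most that size. -/
theorem exists_separates_of_closed (h : IsResidual (2 * m) (capacity H m S u w) (m + u) w val r)
    (hS : S ⊆ Finset.range m) (hu : u ∈ S) (hw : w ∈ S) (huw : u ≠ w) (hadj : ¬ H.Adj u w)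
    {Q : Finset ℕ} (hQ : Q ⊆ Finset.range (2 * m)) (hs : m + u ∈ Q) (hd : w ∉ Q)
    (hcl : ∀ a ∈ Q, ∀ b < 2 * m, b ∉ Q → r a b = 0) :
    ∃ U ⊆ S, U.card ≤ val ∧ ∃ R, Separates H S U R u w := by
  classical
  have hm : ∀ x ∈ S, x < m := fun x hx => Finset.mem_range.1 (hS hx)
  let cut : Finset (ℕ × ℕ) := (Q ×ˢ (Finset.range (2 * m) \ Q)).filter fun x =>
    capacity H m S u w x.1 x.2 = 1
  -- An arc inside a vertex yields that vertex and an edge arc yields its head, or its tail when the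
  -- head is `w`. Since `u` and `w` are not adjacent, neither of them is ever chosen.
  let φ : ℕ × ℕ → ℕ := fun x => if x.1 < m then x.1 else if x.2 = w then x.1 - m else x.2
  have hcut : cut.card = val := by
    rw [h.value_eq_of_closed hQ hs hd hcl, ← Finset.sum_product', Finset.card_filter]
    refine Finset.sum_congr rfl fun x _ => ?_
    have := capacity_le_one (H := H) (m := m) (S := S) (u := u) (w := w) x.1 x.2
    split_ifs with h <;> omega
  have hin : ∀ b, b ∈ S → b ≠ u → b ≠ w → b ∈ Q → m + b ∉ Q → b ∈ cut.image φ := by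
    intro b hb hbu hbw hbQ hbQ'
    have hbm := hm b hb
    refine Finset.mem_image.2 ⟨(b, m + b), ?_, by simp [φ, hbm]⟩
    simp only [cut, Finset.mem_filter, Finset.mem_product, Finset.mem_sdiff, Finset.mem_range]
    refine ⟨⟨hbQ, by omega, hbQ'⟩, ?_⟩
    rw [capacity, if_pos ⟨hbm, rfl, hb, hbu, hbw⟩]
  have hout : ∀ a b, a ∈ S → b ∈ S → H.Adj a b → a ≠ w → b ≠ u → m + a ∈ Q → b ∉ Q →
      (if b = w then a else b) ∈ cut.image φ := by
    intro a b ha hb hab haw hbu haQ hbQ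
    have ham := hm a ha
    have hbm := hm b hb
    refine Finset.mem_image.2 ⟨(m + a, b), ?_, by simp [φ]⟩
    simp only [cut, Finset.mem_filter, Finset.mem_product, Finset.mem_sdiff, Finset.mem_range]
    refine ⟨⟨haQ, by omega, hbQ⟩, ?_⟩
    rw [capacity, if_neg (by omega), if_pos]
    rw [Nat.add_sub_cancel_left]
    exact ⟨by omega, hbm, ha, hb, hab, haw, hbu⟩
  have hφ : ∀ x ∈ cut, φ x ∈ S ∧ φ x ≠ u ∧ φ x ≠ w := by
    rintro ⟨a, b⟩ hx
    have hc := (Finset.mem_filter.1 hx).2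
    simp only [capacity] at hc
    simp only [φ]
    split_ifs at hc with h1 h2
    · rw [if_pos h1.1]
      exact h1.2.2
    · obtain ⟨h3, h4, h5, h6, h7, h8, h9⟩ := h2
      rw [if_neg (by omega)]
      split_ifs with h10
      · refine ⟨h5, fun h => hadj ?_, h8⟩
        rwa [h, h10] at h7
      · exact ⟨h6, h9, h10⟩
  -- The vertex `w` is excluded explicitly, because nothing prevents `Q` from containing its
  -- outgoing node.
  refine ⟨cut.image φ, ?_, Finset.card_image_le.trans hcut.le, {x | m + x ∈ Q ∧ x ≠ w}, ?_, ?_,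
    ⟨hs, huw⟩, fun h => h.2 rfl, ?_⟩
  · intro x hx
    obtain ⟨y, hy, rfl⟩ := Finset.mem_image.1 hx
    exact (hφ y hy).1
  · intro hx
    obtain ⟨y, hy, hyu⟩ := Finset.mem_image.1 hx
    exact (hφ y hy).2.1 hyu
  · intro hx
    obtain ⟨y, hy, hyw⟩ := Finset.mem_image.1 hx
    exact (hφ y hy).2.2 hyw
  · rintro a ⟨haQ, haw⟩ haS haU b hbS hbU hab
    by_cases hbu : b = u
    · subst hbu; exact ⟨hs, huw⟩
    · have h1 := hout a b haS hbS hab haw hbu haQ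
      by_cases hbw : b = w
      · exfalso
        subst hbw
        exact haU (by simpa using h1 hd)
      · rw [if_neg hbw] at h1
        have hbQ : b ∈ Q := by
          by_contra hbQ; exact hbU (h1 hbQ)
        refine ⟨?_, hbw⟩
        by_contra hbQ'
        exact hbU (hin b hbS hbu hbw hbQ hbQ')

theorem exists_separates_image_iff {n : ℕ} {G : SimpleGraph (Fin n)} {f : ℕ → Fin n}
    (hf : Set.InjOn f S) (hu : u ∈ S) (hw : w ∈ S) :
    (∃ U ⊆ S.image f, U.card < t ∧ ∃ R, Separates G (S.image f) U R (f u) (f w)) ↔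
      ∃ U ⊆ S, U.card < t ∧ ∃ R, Separates (G.comap f) S U R u w := by
  classical
  have hmem : ∀ {U : Finset ℕ}, U ⊆ S → ∀ x ∈ S, f x ∈ U.image f ↔ x ∈ U := by
    intro U hU x hx
    refine ⟨fun h => ?_, Finset.mem_image_of_mem f⟩
    obtain ⟨y, hy, hyx⟩ := Finset.mem_image.1 h
    exact hf (hU hy) hx hyx ▸ hy
  constructor
  · rintro ⟨U, hU, hcard, R, huU, hwU, huR, hwR, hcl⟩
    refine ⟨S.filter fun x => f x ∈ U, Finset.filter_subset _ _, ?_, f ⁻¹' R, ?_, ?_, huR, hwR, ?_⟩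
    · refine lt_of_le_of_lt ?_ hcard
      refine Finset.card_le_card_of_injOn f (fun x hx => (Finset.mem_filter.1 hx).2) ?_
      exact hf.mono (by exact_mod_cast Finset.filter_subset _ _)
    · exact fun h => huU (Finset.mem_filter.1 h).2
    · exact fun h => hwU (Finset.mem_filter.1 h).2
    · intro a haR haS haU b hbS hbU hab
      exact hcl (f a) haR (Finset.mem_image_of_mem f haS)
        (fun h => haU (Finset.mem_filter.2 ⟨haS, h⟩)) (f b) (Finset.mem_image_of_mem f hbS)
        (fun h => hbU (Finset.mem_filter.2 ⟨hbS, h⟩)) hab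
  · rintro ⟨U, hU, hcard, R, huU, hwU, huR, hwR, hcl⟩
    -- The side is cut down to `S` before taking the image, since `f` is injective only there.
    refine ⟨U.image f, Finset.image_subset_image hU, Finset.card_image_le.trans_lt hcard,
      f '' (R ∩ S), ?_, ?_, ⟨u, ⟨huR, hu⟩, rfl⟩, ?_, ?_⟩
    · rwa [hmem hU u hu]
    · rwa [hmem hU w hw]
    · rintro ⟨x, ⟨hxR, hxS⟩, hxw⟩
      exact hwR (hf hxS hw hxw ▸ hxR)
    · rintro _ ⟨a, ⟨haR, haS⟩, rfl⟩ - haU _ hb hbU hab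
      obtain ⟨b, hbS, rfl⟩ := Finset.mem_image.1 hb
      rw [hmem hU a haS] at haU
      rw [hmem hU b hbS] at hbU
      exact ⟨b, ⟨hcl a haR haS haU b hbS hbU hab, hbS⟩, rfl⟩

end Separator

end TwoClub

/-! ### Computing a maximum flow -/

namespace TwoClub

open RAM RAM.Expr RAM.Prog

/-- The residual capacities in array `7`. -/
def residual (N : ℕ) (s : State) (a b : ℕ) : ℕ := s.arr 7 (a * N + b)

theorem residual_setReg {N : ℕ} (s : State) (x v : ℕ) :
    residual N (s.setReg x v) = residual N s := rfl

theorem residual_setArr {N : ℕ} (s : State) {p q v a b : ℕ} (hq : q < N) (hb : b < N) :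
    residual N (s.setArr 7 (p * N + q) v) a b =
      if a = p ∧ b = q then v else residual N s a b := by
  simp only [residual, State.setArr_arr, if_true]
  exact update_mul_add _ hq hb

theorem ite_mul_ite (p q : Prop) [Decidable p] [Decidable q] :
    (if p then 1 else 0) * (if q then 1 else 0) = if p ∧ q then 1 else 0 := by
  by_cases hp : p <;> by_cases hq : q <;> simp [hp, hq]

theorem one_sub_ite (p : Prop) [Decidable p] :
    (1 - if p then 1 else 0) = if ¬ p then 1 else 0 := by
  by_cases hp : p <;> simp [hp]

/-- Write the capacities of the arcs between the nodes of the vertices in registers `44` and `45`. -/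
def initEntry : Prog :=
  store 7 (reg 44 * reg 33 + reg 45) (const 0) ;;
  store 7 ((reg 6 + reg 44) * reg 33 + (reg 6 + reg 45)) (const 0) ;;
  store 7 (reg 44 * reg 33 + (reg 6 + reg 45))
    (Expr.eq (reg 44) (reg 45) * (arr 6 (reg 44) *
      ((const 1 - Expr.eq (reg 44) (reg 24)) * (const 1 - Expr.eq (reg 44) (reg 25))))) ;;
  store 7 ((reg 6 + reg 44) * reg 33 + reg 45)
    (arr 6 (reg 44) * (arr 6 (reg 45) * (arr 3 (reg 44 * reg 6 + reg 45) *
      ((const 1 - Expr.eq (reg 44) (reg 25)) * (const 1 - Expr.eq (reg 45) (reg 24))))))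

/-- Initialize the residual capacities. -/
def initFlow : Prog :=
  assign 33 (reg 6 + reg 6) ;; assign 34 (reg 6 + reg 24) ;;
  forLoop 44 6 (forLoop 45 6 initEntry)

theorem capacity_in_in {H : SimpleGraph ℕ} {m u w x y : ℕ} {S : Finset ℕ} (hx : x < m)
    (hy : y < m) : capacity H m S u w x y = 0 := by
  rw [capacity, if_neg (by omega), if_neg (by omega)]

theorem capacity_out_out {H : SimpleGraph ℕ} {m u w x y : ℕ} {S : Finset ℕ} :
    capacity H m S u w (m + x) (m + y) = 0 := by
  rw [capacity, if_neg (by omega), if_neg (by omega)]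

open Classical in
theorem capacity_in_out {H : SimpleGraph ℕ} {m u w x y : ℕ} {S : Finset ℕ} (hx : x < m) :
    capacity H m S u w x (m + y) = if x = y ∧ x ∈ S ∧ x ≠ u ∧ x ≠ w then 1 else 0 := by
  rw [capacity]
  by_cases h : x = y ∧ x ∈ S ∧ x ≠ u ∧ x ≠ w
  · rw [if_pos h, if_pos ⟨hx, by omega, h.2⟩]
  · rw [if_neg h, if_neg (fun h' => h ⟨by omega, h'.2.2⟩), if_neg (by omega)]

open Classical in
theorem capacity_out_in {H : SimpleGraph ℕ} {m u w x y : ℕ} {S : Finset ℕ} (hy : y < m) :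
    capacity H m S u w (m + x) y =
      if x ∈ S ∧ y ∈ S ∧ H.Adj x y ∧ x ≠ w ∧ y ≠ u then 1 else 0 := by
  rw [capacity, if_neg (by omega), Nat.add_sub_cancel_left]
  simp [hy]

theorem initFlow_runs {n : ℕ} {G : SimpleGraph (Fin n)} {t m B : ℕ} {f : ℕ → Fin n}
    {S : Finset ℕ} {s : State} (h : HoldsLocal G t m f S s) (hB : 2 * m + 4 ≤ B) :
    Runs B initFlow s (4 + (4 + (m * ((m * (100 + 8) + 6) + 8) + 6))) fun s' =>
      s'.reg 33 = 2 * m ∧ s'.reg 34 = m + s.reg 24 ∧ ∀ a < 2 * m, ∀ b < 2 * m,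
        residual (2 * m) s' a b = capacity (G.comap f) m S (s.reg 24) (s.reg 25) a b := by
  classical
  generalize hu : s.reg 24 = u
  generalize hw : s.reg 25 = w
  have hum : u < m := Finset.mem_range.1 (h.subset (hu ▸ h.mem_left))
  set c := capacity (G.comap f) m S u w with hc
  -- Each pair of vertices stands for four matrix cells, one for each choice of incoming or outgoing
  -- node at either end.
  let I : (ℕ → ℕ → Prop) → State → Prop := fun done s' => ∀ x < m, ∀ y < m, done x y →
    residual (2 * m) s' x y = c x y ∧ residual (2 * m) s' (m + x) (m + y) = c (m + x) (m + y) ∧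
    residual (2 * m) s' x (m + y) = c x (m + y) ∧ residual (2 * m) s' (m + x) y = c (m + x) y
  refine .assign_seq (by simp [h.size]; omega) (.assign_seq (by simp [h.size, hu]; omega) ?_)
  refine Runs.forLoop (fun i s' => I (fun x _ => x < i) s') (by simpa using h.size) (by omega)
    (by decide) (by decide) (fun x _ y _ h => absurd h (by omega)) ?_ ?_
  · intro i hi s₁ hA₁ hi₁ hI₁
    have hL : HoldsLocal G t m f S s₁ := by
      refine h.congr (fun x hx => ?_) (fun a ha => ?_)
      · rw [hA₁.reg x (by simp [forLoop_regs, initEntry, Prog.regs]; omega)]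
        simp [show x ≠ 34 by omega, show x ≠ 33 by omega]
      · rw [hA₁.arr a (by simp [forLoop_arrs, initEntry, Prog.arrs]; omega)]; simp
    have hu₁ : s₁.reg 24 = u := by rw [hA₁.reg 24 (by decide)]; simpa using hu
    have hw₁ : s₁.reg 25 = w := by rw [hA₁.reg 25 (by decide)]; simpa using hw
    have h33₁ : s₁.reg 33 = 2 * m := by
      rw [hA₁.reg 33 (by decide)]; simp [h.size]; omega
    clear hA₁
    refine Runs.forLoop (fun j s' => I (fun x y => x < i ∨ x = i ∧ y < j) s') hL.size (by omega)
      (by decide) (by decide) (fun x hx y hy h => hI₁ x hx y hy (by omega)) ?_ ?_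
    · intro j hj s₂ hA₂ hj₂ hI₂
      have h6 : s₂.reg 6 = m := by rw [hA₂.reg 6 (by decide)]; exact hL.size
      have hi₂ : s₂.reg 44 = i := by rw [hA₂.reg 44 (by decide)]; exact hi₁
      have hu₂ : s₂.reg 24 = u := by rw [hA₂.reg 24 (by decide)]; exact hu₁
      have hw₂ : s₂.reg 25 = w := by rw [hA₂.reg 25 (by decide)]; exact hw₁
      have h33₂ : s₂.reg 33 = 2 * m := by rw [hA₂.reg 33 (by decide)]; exact h33₁
      have ha3 : s₂.arr 3 (i * m + j) = if (G.comap f).Adj i j then 1 else 0 := by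
        rw [hA₂.arr 3 (by decide)]; exact hL.matrix i hi j hj
      have ha6 : ∀ x < m, s₂.arr 6 x = if x ∈ S then 1 else 0 := by
        rw [hA₂.arr 6 (by decide)]; exact hL.alive
      have hv1 : (if i = j then 1 else 0) * (s₂.arr 6 i * ((1 - if i = u then 1 else 0) *
          (1 - if i = w then 1 else 0))) = c i (m + j) := by
        rw [hc, capacity_in_out hi, ha6 i hi]
        simp only [one_sub_ite, ite_mul_ite]
      have hv2 : s₂.arr 6 i * (s₂.arr 6 j * (s₂.arr 3 (i * m + j) *
          ((1 - if i = w then 1 else 0) * (1 - if j = u then 1 else 0)))) = c (m + i) j := by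
        rw [hc, capacity_out_in hj, ha6 i hi, ha6 j hj, ha3]
        simp only [one_sub_ite, ite_mul_ite]
        rfl
      have hc1 : ∀ a b, c a b ≤ B := fun a b => (capacity_le_one a b).trans (by omega)
      refine Runs.le (T₁ := 7 + (11 + (26 + 32))) ?_ (by omega)
      refine .store_seq (by simp) (.store_seq (by simp) (.store_seq ?_ (.store ?_ ?_)))
      · simp only [eval_mul, eval_eq, eval_reg, eval_sub, eval_const, eval_arr, State.setArr_reg,
          State.setArr_arr, hi₂, hj₂, hu₂, hw₂]
        exact hv1.trans_le (hc1 _ _)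
      · simp only [eval_mul, eval_add, eval_eq, eval_reg, eval_sub, eval_const, eval_arr,
          State.setArr_reg, State.setArr_arr, hi₂, hj₂, hu₂, hw₂, h6]
        exact hv2.trans_le (hc1 _ _)
      · simp only [eval_mul, eval_add, eval_eq, eval_reg, eval_sub, eval_const, eval_arr,
          State.setArr_reg, hi₂, hj₂, hu₂, hw₂, h6, h33₂]
        simp only [State.setArr_arr, if_neg (by decide : (6 : ℕ) ≠ 7),
          if_neg (by decide : (3 : ℕ) ≠ 7), hv1, hv2]
        have key : ∀ a b, b < 2 * m → residual (2 * m) (((((s₂.setArr 7 (i * (2 * m) + j) 0).setArr 7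
            ((m + i) * (2 * m) + (m + j)) 0).setArr 7 (i * (2 * m) + (m + j)) (c i (m + j))).setArr 7
            ((m + i) * (2 * m) + j) (c (m + i) j)).setReg 45 (j + 1)) a b =
            if a = m + i ∧ b = j then c (m + i) j else if a = i ∧ b = m + j then c i (m + j)
            else if a = m + i ∧ b = m + j then 0 else if a = i ∧ b = j then 0
            else residual (2 * m) s₂ a b := by
          intro a b hb
          rw [residual_setReg, residual_setArr _ (by omega) hb, residual_setArr _ (by omega) hb,
            residual_setArr _ (by omega) hb, residual_setArr _ (by omega) hb]
        intro x hx y hy hxy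
        rw [key _ _ (by omega), key _ _ (by omega), key _ _ (by omega), key _ _ (by omega)]
        by_cases hxy' : x = i ∧ y = j
        · obtain ⟨rfl, rfl⟩ := hxy'
          rw [if_neg (by omega), if_neg (by omega), if_neg (by omega), if_pos ⟨rfl, rfl⟩,
            if_neg (by omega), if_neg (by omega), if_pos ⟨rfl, rfl⟩,
            if_neg (by omega), if_pos ⟨rfl, rfl⟩, if_pos ⟨rfl, rfl⟩]
          exact ⟨(capacity_in_in hx hy).symm, capacity_out_out.symm, rfl, rfl⟩
        · rw [if_neg (by omega), if_neg (by omega), if_neg (by omega), if_neg (by omega),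
            if_neg (by omega), if_neg (by omega), if_neg (by omega), if_neg (by omega),
            if_neg (by omega), if_neg (by omega), if_neg (by omega), if_neg (by omega),
            if_neg (by omega), if_neg (by omega), if_neg (by omega), if_neg (by omega)]
          exact hI₂ x hx y hy (by omega)
    · intro s₂ _ hI₂ x hx y hy hxi
      exact hI₂ x hx y hy (by omega)
  · intro s₁ hA₁ hI₁
    refine ⟨?_, ?_, fun a ha b hb => ?_⟩
    · rw [hA₁.reg 33 (by decide)]; simp [h.size]; omega
    · rw [hA₁.reg 34 (by decide)]; simp [h.size, hu]
    · by_cases ham : a < m <;> by_cases hbm : b < m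
      · exact (hI₁ a ham b hbm ham).1
      · have := (hI₁ a ham (b - m) (by omega) ham).2.2.1
        rwa [Nat.add_sub_cancel' (by omega)] at this
      · have := (hI₁ (a - m) (by omega) b hbm (by omega)).2.2.2
        rwa [Nat.add_sub_cancel' (by omega)] at this
      · have := (hI₁ (a - m) (by omega) (b - m) (by omega) (by omega)).2.1
        rwa [Nat.add_sub_cancel' (by omega), Nat.add_sub_cancel' (by omega)] at this

end TwoClub

/-! ### Breadth-first search and augmentation along a path -/

namespace TwoClub

open RAM RAM.Expr RAM.Prog

/-- Array `9` is a queue of `reg 37` nodes that are reachable from `src` by arcs with positive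
residual capacity. Array `8` holds their positions in the queue, counted from one, and array `10`
their predecessors. -/
structure Visited (N src : ℕ) (s : State) : Prop where
  start : s.arr 8 src ≠ 0
  queue : ∀ i < s.reg 37, s.arr 9 i < N ∧ s.arr 8 (s.arr 9 i) = i + 1
  mark : ∀ b < N, s.arr 8 b ≠ 0 → s.arr 8 b ≤ s.reg 37 ∧ s.arr 9 (s.arr 8 b - 1) = b
  pred : ∀ b < N, s.arr 8 b ≠ 0 → b ≠ src → s.arr 10 b < N ∧ s.arr 8 (s.arr 10 b) ≠ 0 ∧
    s.arr 8 (s.arr 10 b) < s.arr 8 b ∧ 0 < residual N s (s.arr 10 b) b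

theorem Visited.congr {N src : ℕ} {s s' : State} (h : Visited N src s)
    (h37 : s'.reg 37 = s.reg 37) (ha : s'.arr = s.arr) : Visited N src s' := by
  have hres : residual N s' = residual N s := by unfold residual; rw [ha]
  constructor
  · rw [ha]; exact h.start
  · rw [ha, h37]; exact h.queue
  · rw [ha, h37]; exact h.mark
  · rw [ha, hres]; exact h.pred

/-- Queue entries are distinct nodes, as array `8` recovers the position of each. -/
theorem Visited.length_le {N src : ℕ} {s : State} (h : Visited N src s) : s.reg 37 ≤ N := by
  have := Finset.card_le_card_of_injOn (s := Finset.range (s.reg 37)) (t := Finset.range N)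
    (s.arr 9) (fun i hi => by simpa using (h.queue i (by simpa using hi)).1) (by
      intro i hi j hj hij
      have h1 := (h.queue i (by simpa using hi)).2
      have h2 := (h.queue j (by simpa using hj)).2
      have : s.arr 9 i = s.arr 9 j := hij
      rw [this] at h1
      omega)
  simpa using this

/-- Append the node in register `39` to the queue, with the node in register `40` as predecessor. -/
def visit : Prog :=
  store 9 (reg 37) (reg 39) ;; assign 37 (reg 37 + const 1) ;;
  store 8 (reg 39) (reg 37) ;; store 10 (reg 39) (reg 40)

theorem visit_runs {N src B a b : ℕ} {s : State} (h : Visited N src s) (ha : a < N) (hb : b < N)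
    (h39 : s.reg 39 = b) (h40 : s.reg 40 = a) (hma : s.arr 8 a ≠ 0) (hmb : s.arr 8 b = 0)
    (hr : 0 < residual N s a b) (hB : N + 1 ≤ B) :
    Runs B visit s (3 + (4 + (3 + 3))) fun s' => Visited N src s' ∧ s.reg 37 ≤ s'.reg 37 ∧
      s'.arr 8 = Function.update (s.arr 8) b (s.reg 37 + 1) ∧
      ∀ i < s.reg 37, s'.arr 9 i = s.arr 9 i := by
  have hlen := h.length_le
  have hab : a ≠ b := by rintro rfl; exact hma hmb
  refine .store_seq (by simp; omega) (.assign_seq (by simp; omega) (.store_seq (by simp; omega)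
    (.store (by simp; omega) ?_)))
  set s' := ((((s.setArr 9 (eval s (reg 37)) (eval s (reg 39))).setReg 37 _).setArr 8 _ _).setArr
    10 _ _) with hs'
  have h37 : s'.reg 37 = s.reg 37 + 1 := by simp [hs']
  have h8 : s'.arr 8 = Function.update (s.arr 8) b (s.reg 37 + 1) := by simp [hs', h39]
  have h9 : s'.arr 9 = Function.update (s.arr 9) (s.reg 37) b := by simp [hs', h39]
  have h10 : s'.arr 10 = Function.update (s.arr 10) b a := by simp [hs', h39, h40]
  have hres : residual N s' = residual N s := by unfold residual; simp [hs']
  clear_value s'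
  have hne : ∀ x, s.arr 8 x ≠ 0 → x ≠ b := fun x hx hxb => hx (hxb ▸ hmb)
  refine ⟨⟨?_, ?_, ?_, ?_⟩, by omega, h8, fun i hi => ?_⟩
  · rw [h8, Function.update_of_ne (hne _ h.start)]; exact h.start
  · rw [h8, h9, h37]
    intro i hi
    by_cases hi' : i = s.reg 37
    · subst hi'; simp [hb]
    · have := h.queue i (by omega)
      rw [Function.update_of_ne hi', Function.update_of_ne (hne _ (by omega))]
      exact this
  · rw [h8, h9, h37]
    intro x hx hmx
    by_cases hxb : x = b
    · subst hxb; simp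
    · rw [Function.update_of_ne hxb] at hmx ⊢
      have := h.mark x hx hmx
      rw [Function.update_of_ne (by omega)]
      exact ⟨by omega, this.2⟩
  · rw [h8, h10, hres]
    intro x hx hmx hxs
    by_cases hxb : x = b
    · subst hxb
      have := h.mark a ha hma
      simp only [Function.update_self, Function.update_of_ne hab]
      exact ⟨ha, hma, by omega, hr⟩
    · rw [Function.update_of_ne hxb] at hmx ⊢
      have := h.pred x hx hmx hxs
      rw [Function.update_of_ne hxb, Function.update_of_ne (hne _ this.2.1)]
      exact this
  · rw [h9, Function.update_of_ne (by omega)]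

/-- Visit all nodes that can be reached by an arc from the node in register `40`. -/
def scanNode : Prog :=
  forLoop 39 33 (Prog.cond (arr 7 (reg 40 * reg 33 + reg 39) * Expr.eq (arr 8 (reg 39)) (const 0))
    visit skip)

theorem scanNode_runs {N src B a : ℕ} {s : State} (h : Visited N src s) (ha : a < N)
    (h33 : s.reg 33 = N) (h40 : s.reg 40 = a) (hma : s.arr 8 a ≠ 0) (hB : N + 1 ≤ B) :
    Runs B scanNode s (N * (26 + 8) + 6) fun s' => Visited N src s' ∧ s.reg 37 ≤ s'.reg 37 ∧
      (∀ i < s.reg 37, s'.arr 9 i = s.arr 9 i) ∧ (∀ b, s.arr 8 b ≠ 0 → s'.arr 8 b ≠ 0) ∧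
      ∀ b < N, 0 < residual N s a b → s'.arr 8 b ≠ 0 := by
  refine Runs.forLoop (fun j s' => Visited N src s' ∧ s.reg 37 ≤ s'.reg 37 ∧
      (∀ i < s.reg 37, s'.arr 9 i = s.arr 9 i) ∧ (∀ b, s.arr 8 b ≠ 0 → s'.arr 8 b ≠ 0) ∧
      ∀ b < j, 0 < residual N s a b → s'.arr 8 b ≠ 0) h33 (by omega) (by decide) (by decide)
      ⟨h.congr (by simp) (by simp), by simp, by simp, by simp, by simp⟩ ?_ fun s' _ h => h
  rintro j hj s₁ hA hj₁ ⟨hV, hle, hq, hmk, hcl⟩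
  have h33₁ : s₁.reg 33 = N := (hA.reg 33 (by decide)).trans h33
  have h40₁ : s₁.reg 40 = a := (hA.reg 40 (by decide)).trans h40
  have hres : residual N s₁ = residual N s := by unfold residual; rw [hA.arr 7 (by decide)]
  have hcongr : ∀ {s' : State}, Visited N src s' → Visited N src (s'.setReg 39 (j + 1)) :=
    fun h => h.congr (by simp) (by simp)
  refine Runs.cond (T₁ := 13) (fun hb => ?_) (fun hb => .skip ?_)
  · simp only [eval_mul, eval_arr, eval_add, eval_reg, eval_eq, eval_const, h33₁, h40₁, hj₁] at hb
    have hmb : s₁.arr 8 j = 0 := by by_contra h'; simp [h'] at hb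
    have hr : 0 < residual N s₁ a j := by
      rw [residual]; exact Nat.pos_of_ne_zero fun h' => by simp [h'] at hb
    refine (visit_runs hV ha hj hj₁ h40₁ (hmk a hma) hmb hr hB).post ?_
    rintro s₂ - ⟨hV₂, hle₂, h8₂, hq₂⟩
    have hmk₂ : ∀ b, s₁.arr 8 b ≠ 0 → s₂.arr 8 b ≠ 0 := fun b hb => by
      rw [h8₂, Function.update_apply]; split_ifs; exacts [by omega, hb]
    refine ⟨hcongr hV₂, by simpa using hle.trans hle₂, fun i hi => ?_, fun b hb => ?_,
      fun b hb hrb => ?_⟩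
    · rw [State.setReg_arr, hq₂ i (by omega), hq i hi]
    · exact hmk₂ b (hmk b hb)
    · rcases (by omega : b < j ∨ b = j) with hb | rfl
      · exact hmk₂ b (hcl b hb hrb)
      · rw [State.setReg_arr, h8₂]; simp
  · refine ⟨hcongr hV, by simpa using hle, hq, hmk, fun b hbj hrb => ?_⟩
    rcases (by omega : b < j ∨ b = j) with hbj | rfl
    · exact hcl b hbj hrb
    · intro h0
      rw [State.setReg_arr] at h0
      simp only [eval_mul, eval_arr, eval_add, eval_reg, eval_eq, eval_const, h33₁, h40₁, hj₁, h0,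
        if_true, mul_one] at hb
      rw [← hres, residual] at hrb
      omega

/-- Find the nodes that are reachable from the source by arcs with positive residual capacity. -/
def bfs : Prog :=
  forLoop 44 33 (store 8 (reg 44) (const 0)) ;;
  store 8 (reg 34) (const 1) ;; store 9 (const 0) (reg 34) ;; assign 37 (const 1) ;;
  forLoop 38 33 (Prog.cond (Expr.lt (reg 38) (reg 37))
    (assign 40 (arr 9 (reg 38)) ;; scanNode) skip)

/-- The outer loop always runs `N` rounds and idles past the end of the queue. Since the queue never
exceeds `N` entries, every marked node has been scanned at the end. -/
theorem bfs_runs {N src B : ℕ} {s : State} (h33 : s.reg 33 = N) (h34 : s.reg 34 = src)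
    (hsrc : src < N) (hB : N + 1 ≤ B) :
    Runs B bfs s ((N * (3 + 8) + 6) + (3 + (3 + (2 + (N * ((N * (26 + 8) + 14) + 8) + 6)))))
      fun s' => Visited N src s' ∧
        ∀ a < N, s'.arr 8 a ≠ 0 → ∀ b < N, 0 < residual N s' a b → s'.arr 8 b ≠ 0 := by
  refine Runs.seq (Runs.forLoop (fun j s' => ∀ i < j, s'.arr 8 i = 0) h33 (by omega) (by decide)
    (by decide) (by simp) ?_ ?_)
  · intro j hj s₁ hA hj₁ hI
    refine .store (by simp) fun i hi => ?_
    simp only [eval_reg, eval_const, hj₁, State.setReg_arr, State.setArr_arr, if_true,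
      Function.update_apply]
    split_ifs with h
    · rfl
    · exact hI i (by omega)
  · intro s₁ hA hI
    have h33₁ : s₁.reg 33 = N := (hA.reg 33 (by decide)).trans h33
    have h34₁ : s₁.reg 34 = src := (hA.reg 34 (by decide)).trans h34
    clear hA
    refine .store_seq (by simp; omega) (.store_seq (by simp; omega)
      (.assign_seq (by simp; omega) ?_))
    refine Runs.forLoop (fun j s' => Visited N src s' ∧ ∀ i < j, i < s'.reg 37 → ∀ b < N,
      0 < residual N s' (s'.arr 9 i) b → s'.arr 8 b ≠ 0) (by simpa using h33₁) (by omega)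
      (by decide) (by decide) ⟨⟨?_, ?_, ?_, ?_⟩, by simp⟩ ?_ ?_
    · simp [h34₁]
    · intro i hi
      obtain rfl : i = 0 := by simpa using hi
      simp [h34₁, hsrc]
    · intro b hb hmb
      have hbs : b = src := by
        by_contra hne
        simp [h34₁, hne, hI b hb] at hmb
      subst hbs
      simp [h34₁]
    · intro b hb hmb hbs
      simp [h34₁, hbs, hI b hb] at hmb
    · rintro j hj s₂ hA₂ hj₂ ⟨hV, hcl⟩
      have h33₂ : s₂.reg 33 = N := by rw [hA₂.reg 33 (by decide)]; simpa using h33₁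
      clear hA₂
      refine Runs.le (T₁ := 3 + 1 + ((3 + (N * (26 + 8) + 6)) + 1)) ?_ (by omega)
      refine .cond (fun hb => ?_) (fun hb => .skip ?_)
      · have hjq : s₂.reg 38 < s₂.reg 37 := by
          by_contra h'; simp [h'] at hb
        rw [hj₂] at hjq
        obtain ⟨hqN, hqm⟩ := hV.queue j hjq
        refine .assign_seq (by simp [hj₂]; omega) ?_
        refine (scanNode_runs (a := s₂.arr 9 j) (hV.congr (by simp) (by simp)) hqN
          (by simpa using h33₂) (by simp [hj₂]) (by simp [hqm]) hB).post ?_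
        rintro s₃ hA₃ ⟨hV₃, hle₃, hq₃, hmk₃, hcl₃⟩
        have hres : residual N s₃ = residual N s₂ := by
          unfold residual; rw [hA₃.arr 7 (by decide)]; simp
        simp only [State.setReg_reg, State.setReg_arr] at hle₃ hq₃ hmk₃
        rw [if_neg (by decide)] at hle₃ hq₃
        refine ⟨hV₃.congr (by simp) (by simp), fun i hi _ b hb hrb => ?_⟩
        rw [residual_setReg, State.setReg_arr, hq₃ i (by omega), hres] at hrb
        rw [State.setReg_arr]
        rcases (by omega : i < j ∨ i = j) with hij | rfl
        · exact hmk₃ b (hcl i hij (by omega) b hb hrb)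
        · exact hcl₃ b hb hrb
      · have hjq : ¬ s₂.reg 38 < s₂.reg 37 := by
          intro h'; simp [h'] at hb
        rw [hj₂] at hjq
        refine ⟨hV.congr (by simp) (by simp), fun i hi hi' => ?_⟩
        simp only [State.setReg_reg] at hi'
        rw [if_neg (by decide)] at hi'
        exact hcl i (by omega) hi'
    · rintro s₂ - ⟨hV, hcl⟩
      refine ⟨hV, fun a ha hma b hb hr => ?_⟩
      have h1 := hV.mark a ha hma
      have h2 := hV.length_le
      refine hcl (s₂.arr 8 a - 1) (by omega) (by omega) b hb ?_
      rw [h1.2]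
      exact hr

/-- Send one unit of flow along the path found by the breadth-first search. -/
def augment : Prog :=
  assign 41 (reg 25) ;;
  Prog.loop (const 1 - Expr.eq (reg 41) (reg 34)) (
    assign 42 (arr 10 (reg 41)) ;;
    store 7 (reg 42 * reg 33 + reg 41) (arr 7 (reg 42 * reg 33 + reg 41) - const 1) ;;
    store 7 (reg 41 * reg 33 + reg 42) (arr 7 (reg 41 * reg 33 + reg 42) + const 1) ;;
    assign 41 (reg 42))

/-- Predecessors have strictly smaller queue positions, so the position of the current node is a
variant and the walk ends at the source. The bound 2 on opposite residual capacities keeps stored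
values within a machine word. -/
theorem augment_runs {N src dst B : ℕ} {c : ℕ → ℕ → ℕ} {s : State} (hV : Visited N src s)
    (h33 : s.reg 33 = N) (h34 : s.reg 34 = src) (h25 : s.reg 25 = dst) (hdst : dst < N)
    (hm : s.arr 8 dst ≠ 0) (hle : ∀ a < N, ∀ b < N, residual N s a b + residual N s b a ≤ 2)
    (hB : N + 3 ≤ B) :
    Runs B augment s (2 + (N * (35 + 5 + 1) + (5 + 1))) fun s' =>
      PartlyAugmented N c (residual N s) dst src (residual N s') := by
  have hmN := (hV.mark dst hdst hm).1.trans hV.length_le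
  refine Runs.le (T₁ := 2 + (s.arr 8 dst * (35 + 5 + 1) + (5 + 1))) ?_ (by gcongr)
  refine .assign_seq (by simp; omega) ?_
  -- Capacities between nodes of position at most `j` are still the original ones, so the next arc
  -- towards the source still has positive residual capacity.
  refine (Runs.loop (c := 35) (fun j s' => s'.reg 41 < N ∧ s.arr 8 (s'.reg 41) = j ∧ j ≠ 0 ∧
    PartlyAugmented N c (residual N s) dst (s'.reg 41) (residual N s') ∧
    ∀ a < N, ∀ b < N, s.arr 8 a ≤ j → s.arr 8 b ≤ j → residual N s' a b = residual N s a b)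
    ⟨?_, ?_, hm, ?_, ?_⟩ ?_).post ?_
  · simpa [h25] using hdst
  · simp [h25]
  · simp only [eval_reg, State.setReg_reg, if_true, h25]
    exact partlyAugmented_refl
  · exact fun _ _ _ _ _ _ => rfl
  · rintro j s₁ hA₁ ⟨hcN, hcj, hj, hP, hun⟩ hb
    generalize hcur : s₁.reg 41 = cur at *
    have h33₁ : s₁.reg 33 = N := by rw [hA₁.reg 33 (by decide)]; simpa using h33
    have h34₁ : s₁.reg 34 = src := by rw [hA₁.reg 34 (by decide)]; simpa using h34
    have h10 : s₁.arr 10 = s.arr 10 := by rw [hA₁.arr 10 (by decide)]; simp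
    clear hA₁
    have hcs : cur ≠ src := by
      rintro rfl; simp [hcur, h34₁] at hb
    obtain ⟨hpN, hpm, hplt, hpr⟩ := hV.pred cur hcN (by omega) hcs
    generalize hp : s.arr 10 cur = p at *
    have hpc : p ≠ cur := by rintro rfl; omega
    have hrp : residual N s₁ p cur = residual N s p cur := hun p hpN cur hcN (by omega) (by omega)
    have hpair := hP.pair p hpN cur hcN
    have hle' := hle p hpN cur hcN
    refine Runs.le (T₁ := 3 + (14 + (14 + 2))) ?_ (by omega)
    have hidx : cur * N + p ≠ p * N + cur := fun h => by
      rw [mul_add_inj hpN hcN] at h; exact hpc h.2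
    refine .assign_seq (by simp [hcur, h10, hp]; omega) (.store_seq ?_ (.store_seq ?_
      (.assign (by simp [hcur, h10, hp]; omega) ?_)))
    · simp only [eval_sub, eval_arr, eval_add, eval_mul, eval_reg, eval_const, State.setReg_reg,
        State.setReg_arr, hcur, h10, hp, h33₁]
      simp only [if_true, if_neg (by decide : (33 : ℕ) ≠ 42), if_neg (by decide : (41 : ℕ) ≠ 42)]
      change residual N s₁ p cur - 1 ≤ B
      omega
    · simp only [eval_sub, eval_arr, eval_add, eval_mul, eval_reg, eval_const, State.setReg_reg,
        State.setArr_reg, State.setArr_arr, State.setReg_arr, hcur, h10, hp, h33₁]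
      simp only [if_true, if_neg (by decide : (33 : ℕ) ≠ 42), if_neg (by decide : (41 : ℕ) ≠ 42)]
      rw [Function.update_of_ne hidx]
      change residual N s₁ cur p + 1 ≤ B
      omega
    · set s₂ := (((s₁.setReg 42 _).setArr 7 _ _).setArr 7 _ _).setReg 41 _ with hs₂
      have h41 : s₂.reg 41 = p := by simp [hs₂, hcur, h10, hp]
      have hr₂ : ∀ a < N, ∀ b < N, residual N s₂ a b = push (residual N s₁) p cur a b := by
        intro a ha b hb
        simp only [hs₂, residual_setReg]
        simp only [eval_sub, eval_arr, eval_add, eval_mul, eval_reg, eval_const, State.setReg_reg,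
          State.setArr_reg, State.setArr_arr, State.setReg_arr, hcur, h10, hp, h33₁]
        simp only [if_true, if_neg (by decide : (33 : ℕ) ≠ 42), if_neg (by decide : (41 : ℕ) ≠ 42)]
        rw [residual_setArr _ hpN hb, residual_setArr _ hcN hb, residual_setReg,
          Function.update_of_ne hidx]
        unfold push
        by_cases h1 : a = cur ∧ b = p
        · obtain ⟨rfl, rfl⟩ := h1
          rw [if_pos ⟨rfl, rfl⟩, if_neg (fun h => hpc h.1.symm), if_pos ⟨rfl, rfl⟩]
          rfl
        · rw [if_neg h1, if_neg h1]
          split_ifs with h2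
          · obtain ⟨rfl, rfl⟩ := h2
            rfl
          · rfl
      clear_value s₂
      refine ⟨s.arr 8 p, by omega, ?_, ?_, hpm, ?_, ?_⟩
      · rw [h41]; exact hpN
      · rw [h41]
      · rw [h41]
        exact (hP.push hpN hcN hpc (by omega)).congr hr₂
      · intro a ha b hb hap hbp
        rw [hr₂ a ha b hb, push, if_neg, if_neg, hun a ha b hb (by omega) (by omega)]
        · rintro ⟨rfl, -⟩; omega
        · rintro ⟨-, rfl⟩; omega
  · rintro s₁ hA₁ ⟨⟨j, -, -, -, hP, -⟩, hb⟩
    have h34₁ : s₁.reg 34 = src := by rw [hA₁.reg 34 (by decide)]; simpa using h34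
    have : s₁.reg 41 = src := by
      by_contra h'; simp [h34₁, h'] at hb
    rwa [this] at hP

end TwoClub

/-! ### Maximum flow by augmenting paths and the conflict test for connected 2-clubs -/

namespace TwoClub

open RAM RAM.Expr RAM.Prog

/-- Search for an augmenting path. Increase the flow and its value in register `36` if there is one;
otherwise clear register `43`. -/
def improveFlow : Prog :=
  bfs ;; Prog.cond (arr 8 (reg 25)) (augment ;; assign 36 (reg 36 + const 1)) (assign 43 (const 0))

/-- The time for a search for an augmenting path in a network with `N` nodes. -/
def improveTime (N : ℕ) : ℕ :=
  ((N * (3 + 8) + 6) + (3 + (3 + (2 + (N * ((N * (26 + 8) + 14) + 8) + 6))))) +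
    (2 + 1 + ((2 + (N * (35 + 5 + 1) + (5 + 1)) + 4) + 2))

/-- No arc with positive residual capacity leaves some set of nodes that contains the source but not
the sink. -/
def IsSaturated (N src dst : ℕ) (r : ℕ → ℕ → ℕ) : Prop :=
  ∃ Q ⊆ Finset.range N, src ∈ Q ∧ dst ∉ Q ∧ ∀ a ∈ Q, ∀ b < N, b ∉ Q → r a b = 0

/-- If the search misses the sink, the marked nodes themselves form the closed set required by
`IsSaturated`. -/
theorem improveFlow_runs {N src dst val B : ℕ} {c : ℕ → ℕ → ℕ} {s : State}
    (h33 : s.reg 33 = N) (h34 : s.reg 34 = src) (h25 : s.reg 25 = dst) (h36 : s.reg 36 = val)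
    (hsrc : src < N) (hdst : dst < N) (hne : src ≠ dst) (hc : ∀ a b, c a b ≤ 1)
    (hr : IsResidual N c src dst val (residual N s)) (hB : N + 3 ≤ B) (hval : val + 1 ≤ B) :
    Runs B improveFlow s (improveTime N) fun s' =>
      (s'.reg 36 = val + 1 ∧ s'.reg 43 = s.reg 43 ∧
        IsResidual N c src dst (val + 1) (residual N s')) ∨
      (s'.reg 36 = val ∧ s'.reg 43 = 0 ∧ IsResidual N c src dst val (residual N s') ∧
        IsSaturated N src dst (residual N s')) := by
  refine (bfs_runs h33 h34 hsrc (by omega)).andThen ?_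
  rintro s₁ hA ⟨hV, hcl⟩
  have h33₁ : s₁.reg 33 = N := (hA.reg 33 (by decide)).trans h33
  have h34₁ : s₁.reg 34 = src := (hA.reg 34 (by decide)).trans h34
  have h25₁ : s₁.reg 25 = dst := (hA.reg 25 (by decide)).trans h25
  have h36₁ : s₁.reg 36 = val := (hA.reg 36 (by decide)).trans h36
  have h43₁ : s₁.reg 43 = s.reg 43 := hA.reg 43 (by decide)
  have hres : residual N s₁ = residual N s := by unfold residual; rw [hA.arr 7 (by decide)]
  rw [← hres] at hr
  refine .cond (fun hb => ?_) (fun hb => ?_)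
  · simp only [eval_arr, eval_reg, h25₁] at hb
    refine (augment_runs (c := c) hV h33₁ h34₁ h25₁ hdst hb (fun a ha b hb => ?_) hB).andThen ?_
    · rw [hr.pair a ha b hb]
      exact Nat.add_le_add (hc a b) (hc b a)
    · intro s₂ hA₂ hP
      have h36₂ : s₂.reg 36 = val := (hA₂.reg 36 (by decide)).trans h36₁
      have h43₂ : s₂.reg 43 = s.reg 43 := (hA₂.reg 43 (by decide)).trans h43₁
      exact .assign (by simpa [h36₂] using hval)
        (.inl ⟨by simp [h36₂], by simpa using h43₂, hr.augment hsrc hne hP⟩)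
  · simp only [eval_arr, eval_reg, h25₁] at hb
    refine .assign (by simp) (.inr ⟨by simpa using h36₁, by simp, hr,
      (Finset.range N).filter (s₁.arr 8 · ≠ 0), Finset.filter_subset _ _, ?_, ?_, ?_⟩)
    · simpa [hsrc] using hV.start
    · simp [hb]
    · intro a ha b hb hbQ
      simp only [Finset.mem_filter, Finset.mem_range, not_and, not_not] at ha hbQ
      rw [residual_setReg]
      by_contra h
      exact hcl a ha.1 ha.2 b hb (Nat.pos_of_ne_zero h) (hbQ hb)

/-- Compute in register `36` the value of a maximum flow that describes internally disjoint paths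
between the vertices in registers `24` and `25`. -/
def maxFlow : Prog :=
  initFlow ;; assign 36 (const 0) ;; assign 43 (const 1) ;; Prog.loop (reg 43) improveFlow

/-- The time for the maximum flow in a local graph with `m` vertices. -/
def maxFlowTime (m : ℕ) : ℕ :=
  (4 + (4 + (m * ((m * (100 + 8) + 6) + 8) + 6))) +
    (2 + (2 + ((m + 1) * (improveTime (2 * m) + 1 + 1) + (1 + 1))))

theorem maxFlow_runs {n : ℕ} {G : SimpleGraph (Fin n)} {t m B u w : ℕ} {f : ℕ → Fin n}
    {S : Finset ℕ} {s : State} (h : HoldsLocal G t m f S s) (hu : s.reg 24 = u)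
    (hw : s.reg 25 = w) (hadj : ¬ (G.comap f).Adj u w) (hB : 2 * m + 4 ≤ B) :
    Runs B maxFlow s (maxFlowTime m) fun s' => ∃ r,
      IsResidual (2 * m) (capacity (G.comap f) m S u w) (m + u) w (s'.reg 36) r ∧
      IsSaturated (2 * m) (m + u) w r := by
  have huS : u ∈ S := hu ▸ h.mem_left
  have hwS : w ∈ S := hw ▸ h.mem_right
  have huw : u ≠ w := hu ▸ hw ▸ h.ne
  have hum : u < m := Finset.mem_range.1 (h.subset huS)
  have hwm : w < m := Finset.mem_range.1 (h.subset hwS)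
  refine (initFlow_runs h hB).andThen ?_
  rintro s₁ hA₁ ⟨h33, h34, hcap⟩
  rw [hu] at h34
  have h25 : s₁.reg 25 = w := (hA₁.reg 25 (by decide)).trans hw
  rw [hu, hw] at hcap
  refine .assign_seq (by simp) (.assign_seq (by simp; omega) ?_)
  -- The value stays below `m` before each successful augmentation, and one further round detects
  -- saturation by clearing register `43`: hence at most `m + 1` rounds.
  refine (Runs.loop (c := improveTime (2 * m)) (j := m + 1) (fun j s' => s'.reg 36 + j =
      m + s'.reg 43 ∧ s'.reg 43 ≤ 1 ∧ IsResidual (2 * m) (capacity (G.comap f) m S u w) (m + u) w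
        (s'.reg 36) (residual (2 * m) s') ∧
      (s'.reg 43 = 0 → IsSaturated (2 * m) (m + u) w (residual (2 * m) s')))
    ⟨by simp, by simp, ?_, by simp⟩ ?_).post ?_
  · simp only [eval_const, residual_setReg, State.setReg_reg]
    exact isResidual_zero.congr (by omega) hcap
  · rintro j s₂ hA₂ ⟨hj, h43, hr, -⟩ hb
    have h33₂ : s₂.reg 33 = 2 * m := by rw [hA₂.reg 33 (by decide)]; simpa using h33
    have h34₂ : s₂.reg 34 = m + u := by rw [hA₂.reg 34 (by decide)]; simpa using h34
    have h25₂ : s₂.reg 25 = w := by rw [hA₂.reg 25 (by decide)]; simpa using h25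
    have hlt := value_lt_of_not_adj hr h.subset huS hwS huw hadj
    have h43' : s₂.reg 43 = 1 := by simp only [eval_reg] at hb; omega
    refine (improveFlow_runs h33₂ h34₂ h25₂ rfl (by omega) (by omega) (by omega)
      capacity_le_one hr (by omega) (by omega)).post ?_
    rintro s₃ - (⟨h36, h43₃, hr₃⟩ | ⟨h36, h43₃, hr₃, hsat⟩)
    · exact ⟨j - 1, by omega, by omega, by omega, h36 ▸ hr₃, by omega⟩
    · exact ⟨j - 1, by omega, by omega, by omega, h36 ▸ hr₃, fun _ => hsat⟩
  · rintro s₂ - ⟨⟨j, -, -, hr, hsat⟩, hb⟩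
    exact ⟨_, hr, hsat hb⟩

/-- Decide whether two vertices are in conflict for connected 2-clubs. -/
def connectedConf : Prog :=
  countCommon ;; Prog.cond (arr 3 (reg 24 * reg 6 + reg 25)) (assign 30 (const 0))
    (maxFlow ;; assign 30 (Expr.eq (reg 31) (const 0) + Expr.lt (reg 36) (reg 2)))

/-- Any separator has at least `val` vertices by weak duality, and the saturated cut yields one with
at most `val`. -/
theorem exists_separates_iff_value_lt {n : ℕ} {G : SimpleGraph (Fin n)} {t m val u w : ℕ}
    {f : ℕ → Fin n} {S : Finset ℕ} {r : ℕ → ℕ → ℕ} (hf : Set.InjOn f (Finset.range m))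
    (hS : S ⊆ Finset.range m) (hu : u ∈ S) (hw : w ∈ S) (huw : u ≠ w)
    (hadj : ¬ (G.comap f).Adj u w)
    (hr : IsResidual (2 * m) (capacity (G.comap f) m S u w) (m + u) w val r)
    (hsat : IsSaturated (2 * m) (m + u) w r) :
    (∃ U ⊆ S.image f, U.card < t ∧ ∃ R, Separates G (S.image f) U R (f u) (f w)) ↔ val < t := by
  rw [exists_separates_image_iff (hf.mono (by exact_mod_cast hS)) hu hw]
  constructor
  · rintro ⟨U, -, hUt, R, hsep⟩
    exact (value_le_of_separates hr hS hu hw hsep).trans_lt hUt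
  · intro hlt
    obtain ⟨Q, hQ, hsQ, hdQ, hcl⟩ := hsat
    obtain ⟨U, hU, hUv, hR⟩ := exists_separates_of_closed hr hS hu hw huw hadj hQ hsQ hdQ hcl
    exact ⟨U, hU, hUv.trans_lt hlt, hR⟩

/-- The time for the decision about a conflict for connected 2-clubs. -/
def connectedConfTime (m : ℕ) : ℕ :=
  2 + (m * (19 + 8) + 6) + (6 + 1 + (2 + (maxFlowTime m + 8)))

theorem connectedConf_decides :
    DecidesConflict connectedConf connectedConfTime fun _ => ConnectedConflict := by
  classical
  refine decidesConflict_of_holdsLocal fun n G t B m f s S h hB => ?_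
  refine (countCommon_runs h (by omega)).andThen fun s' hA hcount => ?_
  have h' := countCommon_holdsLocal h hA
  have hu : s'.reg 24 = s.reg 24 := hA.reg 24 (by decide)
  have hw : s'.reg 25 = s.reg 25 := hA.reg 25 (by decide)
  have hval := h'.adj_eval
  refine .cond (fun hb => ?_) (fun hb => ?_)
  · simp only [eval_arr, eval_add, eval_mul, eval_reg, hval] at hb
    have hadj : G.Adj (f (s'.reg 24)) (f (s'.reg 25)) := by by_contra h; simp [h] at hb
    rw [hu, hw] at hadj
    exact .assign (by simp) (by simp [ConnectedConflict, hadj])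
  · simp only [eval_arr, eval_add, eval_mul, eval_reg, hval] at hb
    have hadj : ¬ G.Adj (f (s'.reg 24)) (f (s'.reg 25)) := by intro h; simp [h] at hb
    refine (maxFlow_runs h' rfl rfl hadj (by omega)).andThen ?_
    rintro s'' hA' ⟨r, hr, hsat⟩
    have hiff := exists_separates_iff_value_lt (t := t) h.injOn h.subset h'.mem_left h'.mem_right
      h'.ne hadj hr hsat
    have h31 : s''.reg 31 = s'.reg 31 := hA'.reg 31 (by decide)
    have h2 : s''.reg 2 = t := (hA'.reg 2 (by decide)).trans h'.param
    rw [hu, hw] at hiff hadj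
    refine .assign ?_ ?_
    · simp only [eval_add, eval_eq, eval_lt]
      split_ifs <;> omega
    · simp only [eval_add, eval_eq, eval_lt, eval_reg, eval_const, h31, h2, hcount,
        State.setReg_reg, if_true, ConnectedConflict, hiff, hadj]
      split_ifs <;> simp_all

theorem connectedConf_private : Private connectedConf := ⟨by decide, by decide⟩

theorem improveTime_mono : Monotone improveTime := fun a b h => by
  unfold improveTime
  gcongr

theorem connectedConfTime_mono : Monotone connectedConfTime := fun a b h => by
  have := improveTime_mono (Nat.mul_le_mul_left 2 h)
  unfold connectedConfTime maxFlowTime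
  gcongr

theorem polyBounded_improveTime : PolyBounded improveTime := by
  have hi := PolyBounded.id
  have hk := PolyBounded.const
  exact (((hi.mul (hk _)).add (hk _)).add ((hk _).add ((hk _).add ((hk _).add ((hi.mul
    ((((hi.mul (hk _)).add (hk _))).add (hk _))).add (hk _)))))).add
      ((hk _).add ((((hk _).add ((hi.mul (hk _)).add (hk _))).add (hk _)).add (hk _)))

theorem polyBounded_connectedConfTime : PolyBounded connectedConfTime := by
  have hi := PolyBounded.id
  have hk := PolyBounded.const
  have himp := polyBounded_improveTime.comp ((hk 2).mul hi)
  exact ((hk _).add ((hi.mul (hk _)).add (hk _))).add ((hk _).add ((hk _).add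
    ((((hk _).add ((hk _).add ((hi.mul (((hi.mul (hk _)).add (hk _)).add (hk _))).add (hk _)))).add
      ((hk _).add ((hk _).add (((hi.add (hk _)).mul ((himp.add (hk _)).add (hk _))).add
        (hk _))))).add (hk _))))

/-! ### The main theorem -/

theorem one_le_maxDegreeBound {n : ℕ} (hn : 0 < n) (G : SimpleGraph (Fin n)) :
    1 ≤ maxDegreeBound n G :=
  one_le_mul_of_one_le_of_one_le (one_le_pow₀ (by norm_num)) (by exact_mod_cast hn)

theorem polyBounded_linear (a b c d : ℕ) : PolyBounded fun m => a + (m * b + c) + d :=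
  ((PolyBounded.const a).add ((PolyBounded.id.mul (.const b)).add (.const c))).add (.const d)

theorem monotone_linear (a b c d : ℕ) : Monotone fun m => a + (m * b + c) + d := fun x y h => by
  dsimp only
  gcongr

theorem solvable_isHereditaryTwoClub :
    SolvableInTime (fun _ G t S => IsHereditaryTwoClub G t S) maxDegreeBound := by
  obtain ⟨C, -, h⟩ := exists_exec_of_decidesConflict hereditaryConf_private
    (monotone_linear _ _ _ _) (polyBounded_linear _ _ _ _) hereditaryConf_decides
    (fun _ G t => hereditary_hereditaryConflict G t) (reg 3) (fun _ k => k) (fun _ => rfl)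
    (fun t k => by omega)
  refine ⟨assign 4 (reg 3) ;; mainProg hereditaryConf, 2, C, fun n hn G adj hadj t k => ?_⟩
  obtain ⟨T, s, hE, hT, h01, hiff⟩ := h n hn G adj hadj t k (isLocal_hereditaryConflict G t)
  simp only [isHereditaryTwoClub_iff]
  exact ⟨T, s, hE, hT, hiff.2, fun h => h01.resolve_right fun h1 => h (hiff.1 h1)⟩

/-- With truncated subtraction, `k + (t + 1 - k)` is the maximum of `k` and `t + 1`, so the target
size also enforces `t < |S|`. -/
theorem solvable_isConnectedTwoClub :
    SolvableInTime (fun _ G t S => IsConnectedTwoClub G t S) maxDegreeBound := by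
  obtain ⟨C, -, h⟩ := exists_exec_of_decidesConflict connectedConf_private
    connectedConfTime_mono polyBounded_connectedConfTime connectedConf_decides
    (fun _ G t => hereditary_connectedConflict G t) (reg 3 + (reg 2 + const 1 - reg 3))
    (fun t k => k + (t + 1 - k)) (fun _ => rfl) (fun t k => by omega)
  refine ⟨assign 4 (reg 3 + (reg 2 + const 1 - reg 3)) ;; mainProg connectedConf, 2, C,
    fun n hn G adj hadj t k => ?_⟩
  obtain ⟨T, s, hE, hT, h01, hiff⟩ := h n hn G adj hadj t k (isLocal_connectedConflict G t)
  have hiff' : s.reg 0 = 1 ↔ ∃ S, IsConnectedTwoClub G t S ∧ k ≤ S.card := by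
    rw [hiff]
    refine exists_congr fun S => ?_
    rw [isConnectedTwoClub_iff]
    constructor
    · exact fun h => ⟨⟨by omega, h.1⟩, by omega⟩
    · exact fun h => ⟨h.1.2, by omega⟩
  exact ⟨T, s, hE, hT, hiff'.2, fun h => h01.resolve_right fun h1 => h (hiff'.1 h1)⟩

/-- For `t = 0` the program merely tests `k < n + 1`, since the whole vertex set qualifies. The
extra `8` in the constant pays for that test and for the initial case distinction. -/
theorem solvable_isRobustTwoClub :
    SolvableInTime (fun _ G t S => IsRobustTwoClub G t S) maxDegreeBound := by
  obtain ⟨C, hC, h⟩ := exists_exec_of_decidesConflict robustConf_private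
    (monotone_linear _ _ _ _) (polyBounded_linear _ _ _ _) robustConf_decides
    (fun _ G t => hereditary_robustConflict G t) (reg 3) (fun _ k => k) (fun _ => rfl)
    (fun t k => by omega)
  refine ⟨Prog.cond (reg 2) (assign 4 (reg 3) ;; mainProg robustConf)
    (assign 0 (Expr.lt (reg 3) (reg 1 + const 1))), 2, C + 8, fun n hn G adj hadj t k => ?_⟩
  have h1 := one_le_maxDegreeBound hn G
  simp only [isRobustTwoClub_iff]
  by_cases ht : t = 0
  · subst ht
    have hfree : ∀ S, ConflictFree (RobustConflict G 0) S := fun S u _ w _ _ => by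
      simp [RobustConflict]
    have hiff : (∃ S, ConflictFree (RobustConflict G 0) S ∧ k ≤ S.card) ↔ k < n + 1 := by
      constructor
      · rintro ⟨S, -, hS⟩
        have := S.card_le_univ
        rw [Fintype.card_fin] at this
        omega
      · exact fun h => ⟨Finset.univ, hfree _, by simpa using Nat.lt_succ_iff.1 h⟩
    refine ⟨_, _, .cond_false rfl (.assign _ _ _ ?_), ?_, fun h => ?_, fun h => ?_⟩
    · simp only [eval_lt]
      split_ifs
      · exact Nat.one_le_pow _ _ (by omega)
      · omega
    · have : ((1 + 1 + (5 + 1) : ℕ) : ℝ) ≤ (C + 8) * maxDegreeBound n G := by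
        push_cast; nlinarith
      exact this
    · rw [hiff] at h
      simpa [inputState] using h
    · rw [hiff] at h
      simpa [inputState] using h
  · obtain ⟨T, s, hE, hT, h01, hiff⟩ := h n hn G adj hadj t k (isLocal_robustConflict G ht)
    refine ⟨_, s, .cond_true (by simpa [inputState] using ht) hE, ?_, hiff.2,
      fun h => h01.resolve_right fun h1 => h (hiff.1 h1)⟩
    have : ((1 + 1 + T : ℕ) : ℝ) ≤ (C + 8) * maxDegreeBound n G := by
      push_cast; nlinarith
    exact this

end TwoClub

theorem mainTheorem8 :
    SolvableInTime (fun _ G t S => IsRobustTwoClub G t S) maxDegreeBound ∧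
    SolvableInTime (fun _ G t S => IsHereditaryTwoClub G t S) maxDegreeBound ∧
    SolvableInTime (fun _ G t S => IsConnectedTwoClub G t S) maxDegreeBound := by
  exact ⟨TwoClub.solvable_isRobustTwoClub, TwoClub.solvable_isHereditaryTwoClub,
    TwoClub.solvable_isConnectedTwoClub⟩
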